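/- Let $K$ be a global field, $\mathbb A_K$ its ring of adeles, $C_K=\mathbb A_K^*/K^*$ its idele class group and $X_K=\mathbb A_K/K^*$ the adele class space, on which $C_K$ acts by multiplication. Fix a place $v$ of $K$ and let $|\cdot|_v$ be the normalized absolute value (the module of $K_v$). Let $\mathbb A^{(1)}_{K,v}$ be the set of adeles $a$ with $a_v=0$ and with $a_w$ in the interior of $\{x\in K_w : |x|\le 1\}$ for every place $w$, and let $$\mathcal G(v)=\{(k,x)\in K^*\times\mathbb A^{(1)}_{K,v} : kx\in\mathbb A^{(1)}_{K,v}\}$$ be the groupoid with source $x$, range $kx$ and product $(k_1,k_2x)(k_2,x)=(k_1k_2,x)$, with the topology induced from $K^*\times\mathbb A_K$, where $K^*$ is discrete. On $C_c(\mathcal G(v))$ consider the time evolution $\sigma^v_t(f)(k,x)=|k|_v^{it}f(k,x)$, $t\in\mathbb R$. For $y\in\mathbb A^{(1)}_{K,v}$ let $\mathcal G(v)_y$ be the set of elements with source $y$, and let $\pi_y$ be the representation of $C_c(\mathcal G(v))$ on $\ell^2(\mathcal G(v)_y)$ by left convolution, $$(\pi_y(f)\xi)(\gamma)=\sum_{\gamma_1\gamma_2=\gamma}f(\gamma_1)\,\xi(\gamma_2).$$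 Let $H_y$ be the operator $(H_y\xi)(k,y)=\log|k|_v\,\xi(k,y)$ on $\ell^2(\mathcal G(v)_y)$ with its maximal domain. Let $\Xi_{K,v}=C_K\,a^{(v)}\subset X_K$ be the orbit of the class of the adele $a^{(v)}$ with $a^{(v)}_v=0$ and $a^{(v)}_w=1$ for $w\ne v$. Then for every $y\in\mathbb A^{(1)}_{K,v}$ the Hamiltonian $H_y$ implements the time evolution, i.e. $\pi_y(\sigma^v_t(f))=e^{itH_y}\pi_y(f)e^{-itH_y}$ for all $t\in\mathbb R$ and $f\in C_c(\mathcal G(v))$, and the following are equivalent: 1. $H_y$ is bounded below; 2. $\pi_y$ is a positive energy representation, i.e. there is a self-adjoint operator $H$ on $\ell^2(\mathcal G(v)_y)$ that is bounded below and satisfies $\pi_y(\sigma^v_t(f))=e^{itH}\pi_y(f)e^{-itH}$ for all $t\in\mathbb R$ and $f\in C_c(\mathcal G(v))$; 3. the class of $y$ in $X_K$ belongs to $\Xi_{K,v}$. -/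

import Mathlib

noncomputable section
open IsDedekindDomain

/-- A global field: a number field, or a finite extension of `𝔽_p(t)` for some prime `p`. -/
class IsGlobalField (K : Type*) [Field K] : Prop where
  numberField_or_functionField : NumberField K ∨
    ∃ (p : ℕ) (_ : Fact p.Prime) (_ : Algebra (RatFunc (ZMod p)) K),
      FiniteDimensional (RatFunc (ZMod p)) K

theorem finite_valuationSubring_of_isFractionRing (R : Type*) {K : Type*} [CommRing R]
    [IsDedekindDomain R] [Field K] [Algebra R K] [IsFractionRing R K] (x : K) :
    {A : ValuationSubring K | A ≠ ⊤ ∧ (∀ r : R, algebraMap R K r ∈ A) ∧ x ∉ A}.Finite := by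
  refine ((HeightOneSpectrum.Support.finite R x).image
    fun v => (v.valuation K).valuationSubring).subset ?_
  rintro A ⟨hA, hR, hx⟩
  let f : R →+* A := (algebraMap R K).codRestrict A.toSubring hR
  let P : Ideal R := (IsLocalRing.maximalIdeal A).comap f
  have hmem : ∀ r : R, r ∉ P → (algebraMap R K r)⁻¹ ∈ A := by
    intro r hr
    by_contra h
    apply hr
    have h2 := (ValuationSubring.inv_mem_nonunits_iff (A := A)
      (x := (algebraMap R K r)⁻¹)).2 (Or.inr h)
    rw [inv_inv] at h2
    exact (ValuationSubring.coe_mem_nonunits_iff (a := f r)).1 h2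
  have hP : P ≠ ⊥ := by
    intro h0
    apply hA
    rw [eq_top_iff]
    intro z _
    obtain ⟨a, b, hb, rfl⟩ := IsFractionRing.div_surjective (A := R) z
    rw [div_eq_mul_inv]
    refine A.mul_mem _ _ (hR a) (hmem b ?_)
    rw [h0, Ideal.mem_bot]
    exact nonZeroDivisors.ne_zero hb
  let v : HeightOneSpectrum R := ⟨P, inferInstance, hP⟩
  have hle : HeightOneSpectrum.valuationSubringAtPrime K v ≤ A := by
    rintro z ⟨a, s, hs, rfl⟩
    exact A.mul_mem _ _ (hR a) (hmem s hs)
  have heq := ValuationSubring.eq_of_le_of_ne_top _ hle hA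
  rw [HeightOneSpectrum.valuationSubringAtPrime_eq_valuationSubring] at heq
  refine ⟨v, ?_, heq⟩
  rw [← heq, Valuation.mem_valuationSubring_iff, not_le] at hx
  exact hx

theorem finite_valuationSubring_of_isSeparable (R F : Type*) {E : Type*} [CommRing R]
    [IsDedekindDomain R] [Field F] [Field E] [Algebra R F] [IsFractionRing R F] [Algebra F E]
    [FiniteDimensional F E] [Algebra.IsSeparable F E] (x : E) :
    {A : ValuationSubring E | A ≠ ⊤ ∧ (∀ r : R, algebraMap F E (algebraMap R F r) ∈ A) ∧
      x ∉ A}.Finite := by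
  let : Algebra R E := ((algebraMap F E).comp (algebraMap R F)).toAlgebra
  have : IsScalarTower R F E := IsScalarTower.of_algebraMap_eq fun _ => rfl
  have := integralClosure.isDedekindDomain R F E
  have : IsFractionRing (integralClosure R E) E :=
    integralClosure.isFractionRing_of_finite_extension F E
  refine (finite_valuationSubring_of_isFractionRing (integralClosure R E) x).subset ?_
  rintro A ⟨hA, hR, hx⟩
  refine ⟨hA, fun r => ?_, hx⟩
  have hint : IsIntegral A (r : E) := by
    obtain ⟨q, hq, hq0⟩ := r.2
    refine ⟨q.map ((algebraMap R E).codRestrict A.toSubring hR), hq.map _, ?_⟩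
    rw [Polynomial.eval₂_map]
    exact hq0
  obtain ⟨a, ha⟩ := (IsIntegrallyClosed.isIntegral_iff (R := A) (K := E)).1 hint
  change (r : E) ∈ A
  rw [← ha]
  exact a.2

theorem ValuationSubring.map_zmod_mem {p : ℕ} {L : Type*} [Field L] (B : ValuationSubring L)
    (i : ZMod p →+* L) (c : ZMod p) : i c ∈ B := by
  rw [← ZMod.intCast_zmod_cast c, map_intCast]
  exact intCast_mem B _

theorem ValuationSubring.pow_mem_iff {L : Type*} [Field L] (B : ValuationSubring L) {n : ℕ}
    (hn : n ≠ 0) (z : L) : z ^ n ∈ B ↔ z ∈ B := by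
  rw [← B.valuation_le_one_iff, ← B.valuation_le_one_iff, map_pow, pow_le_one_iff hn]

/-- An element of a global field lies in all but finitely many valuation rings. -/
theorem finite_valuationSubring_notMem {K : Type*} [Field K] [IsGlobalField K] (x : K) :
    {A : ValuationSubring K | A ≠ ⊤ ∧ x ∉ A}.Finite := by
  rcases IsGlobalField.numberField_or_functionField (K := K) with h | ⟨p, hp, _, _⟩
  · refine (finite_valuationSubring_of_isSeparable ℤ ℚ x).subset ?_
    rintro A ⟨hA, hx⟩
    refine ⟨hA, fun r => ?_, hx⟩
    simp
  · let F := RatFunc (ZMod p)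
    let E := separableClosure F K
    have : DecidableEq F := Classical.decEq _
    have : CharP F p := charP_of_injective_algebraMap (algebraMap (ZMod p) F).injective p
    have : ExpChar F p := .prime hp.out
    have : CharP K p := charP_of_injective_algebraMap (algebraMap F K).injective p
    have hE : ∀ z : E, {A : ValuationSubring E | A ≠ ⊤ ∧ z ∉ A}.Finite := by
      intro z
      let O := (RatFunc.inftyValuation (ZMod p)).valuationSubring
      have : Nontrivial (MonoidWithZeroHom.valueGroup
          (.ofClass (RatFunc.inftyValuation (ZMod p)))) := by
        rw [Subgroup.nontrivial_iff_exists_ne_one]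
        refine ⟨Units.mk0 (RatFunc.inftyValuation (ZMod p) RatFunc.X) (by simp),
          MonoidWithZeroHom.mem_valueGroup _ ⟨RatFunc.X, by simp⟩, ?_⟩
        intro h
        have := congrArg Units.val h
        simp [← WithZero.exp_zero] at this
      refine ((finite_valuationSubring_of_isSeparable (Polynomial (ZMod p)) F z).union
        (finite_valuationSubring_of_isSeparable O F z)).subset ?_
      rintro A ⟨hA, hz⟩
      by_cases hX : algebraMap F E RatFunc.X ∈ A
      · refine Or.inl ⟨hA, fun r => ?_, hz⟩
        induction r using Polynomial.induction_on' with
        | add a b ha hb => simpa using A.add_mem _ _ ha hb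
        | monomial n c =>
          rw [← Polynomial.C_mul_X_pow_eq_monomial]
          simp only [map_mul, map_pow]
          exact A.mul_mem _ _ (A.map_zmod_mem (((algebraMap F E).comp
            (algebraMap (Polynomial (ZMod p)) F)).comp Polynomial.C) c) (pow_mem hX n)
      · refine Or.inr ⟨hA, fun r => ?_, hz⟩
        let B := A.comap (algebraMap F E)
        have : B.valuation.IsTrivialOn (ZMod p) := by
          refine ⟨fun c hc => ?_⟩
          apply le_antisymm
          · exact (B.valuation_le_one_iff _).2 (B.map_zmod_mem (algebraMap _ _) c)
          · have := (B.valuation_le_one_iff _).2 (B.map_zmod_mem (algebraMap _ _) c⁻¹)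
            rw [map_inv₀, map_inv₀] at this
            rwa [inv_le_one₀] at this
            simpa [zero_lt_iff] using hc
        have h1 : 1 < B.valuation RatFunc.X := by
          rw [← not_le, B.valuation_le_one_iff]
          exact hX
        have h2 := RatFunc.valuation_isEquiv_inftyValuation_of_one_lt_valuation_X h1
        have h3 := (Valuation.isEquiv_iff_valuationSubring _ _).1 h2
        rw [ValuationSubring.valuationSubring_valuation] at h3
        have : (r : F) ∈ B := by rw [h3]; exact r.2
        exact this
    obtain ⟨n, z, hz⟩ := IsPurelyInseparable.pow_mem E p x
    have hpow : ∀ (B : ValuationSubring K) (y : K) (m : ℕ) (u : E),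
        algebraMap E K u = y ^ p ^ m → (y ∈ B ↔ u ∈ B.comap (algebraMap E K)) := by
      intro B y m u hu
      rw [ValuationSubring.mem_comap, hu, B.pow_mem_iff (pow_ne_zero _ hp.out.ne_zero)]
    refine Set.Finite.of_finite_image (f := fun A => A.comap (algebraMap E K))
      ((hE z).subset ?_) ?_
    · rintro _ ⟨A, ⟨hA, hx⟩, rfl⟩
      refine ⟨fun htop => hA ?_, fun h => hx ((hpow A x n z hz).2 h)⟩
      rw [eq_top_iff]
      intro y _
      obtain ⟨m, u, hu⟩ := IsPurelyInseparable.pow_mem E p y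
      rw [hpow A y m u hu]
      have htop' : A.comap (algebraMap E K) = ⊤ := htop
      rw [htop']
      exact ValuationSubring.mem_top u
    · intro A _ B _ hAB
      ext y
      obtain ⟨m, u, hu⟩ := IsPurelyInseparable.pow_mem E p y
      rw [hpow A y m u hu, hpow B y m u hu]
      exact iff_of_eq (congrArg (fun C : ValuationSubring E => u ∈ C) hAB)

universe u

open scoped RestrictedProduct

/-- The places of a global field: the archimedean ones, and the nonarchimedean ones, given by
their valuation rings. (The nontrivial valuation subrings of a global field are exactly the
valuation rings of its nonarchimedean absolute values. In positive characteristic there are no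
field embeddings into `ℂ`, so `InfinitePlace K` is empty.) -/
inductive Place (K : Type u) [Field K] : Type u
  | infinite (v : NumberField.InfinitePlace K) : Place K
  | finite (A : ValuationSubring K) (hA : A ≠ ⊤) : Place K

namespace Place

variable {K : Type u} [Field K]

/-- The completion `K_w` of `K` at the place `w`. -/
def Completion : Place K → Type u
  | infinite v => v.Completion
  | finite A _ => A.valuation.Completion

instance : (w : Place K) → Field w.Completion
  | infinite v => inferInstanceAs (Field v.Completion)
  | finite A _ => inferInstanceAs (Field A.valuation.Completion)

instance : (w : Place K) → TopologicalSpace w.Completion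
  | infinite v => inferInstanceAs (TopologicalSpace v.Completion)
  | finite A _ => inferInstanceAs (TopologicalSpace A.valuation.Completion)

/-- The canonical embedding of `K` in `K_w`. -/
def embedding : (w : Place K) → K →+* w.Completion
  | infinite v => (algebraMap K v.Completion : K →+* v.Completion)
  | finite A _ => (UniformSpace.Completion.coeRingHom.comp
      (WithVal.equiv A.valuation).symm.toRingHom : K →+* A.valuation.Completion)

/-- The ring of integers of `K_w`, and all of `K_w` at an archimedean place. -/
def integers : (w : Place K) → Subring w.Completion
  | infinite _ => ⊤
  | finite A _ => (Valued.v : Valuation A.valuation.Completion _).integer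

/-- The set `{x ∈ K_w : |x| ≤ 1}`. -/
def closedUnitBall : (w : Place K) → Set w.Completion
  | infinite v => {x : v.Completion | ‖x‖ ≤ 1}
  | finite A _ => {x : A.valuation.Completion | Valued.v x ≤ 1}

open Classical in
/-- The normalized absolute value `|x|_w` on `K`, that is, the factor by which multiplication by
`x` scales the Haar measure of `K_w`: the usual absolute value at a real place, its square at a
complex place, and `[A : xA]⁻¹` for `0 ≠ x ∈ A` at the place with valuation ring `A`. -/
def absValue : Place K → K → ℝ
  | infinite v, x => v x ^ v.mult
  | finite A _, x =>
    if x = 0 then 0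
    else if h : x ∈ A then (Nat.card (A ⧸ Ideal.span {(⟨x, h⟩ : A)}) : ℝ)⁻¹
    else (Nat.card (A ⧸ Ideal.span {(⟨x⁻¹, (A.mem_or_inv_mem x).resolve_left h⟩ : A)}) : ℝ)

end Place

variable (K : Type u) [Field K]

/-- The adele ring `𝔸_K`, the restricted product of all completions. -/
abbrev AdeleRing : Type u :=
  Πʳ w : Place K, [w.Completion, w.integers]

variable {K}

theorem Place.eventually_embedding_mem_integers [IsGlobalField K] (x : K) :
    ∀ᶠ w : Place K in Filter.cofinite, w.embedding x ∈ w.integers := by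
  have h : {w : Place K | w.embedding x ∉ w.integers} ⊆
      {w | ∃ (A : ValuationSubring K) (hA : A ≠ ⊤), x ∉ A ∧ w = Place.finite A hA} := by
    rintro (v | ⟨A, hA⟩) hw
    · exact absurd (Subring.mem_top _) hw
    · refine ⟨A, hA, fun hx => hw ?_, rfl⟩
      change Valued.v ((((WithVal.equiv A.valuation).symm x : WithVal A.valuation) :
        A.valuation.Completion)) ≤ 1
      rw [Valued.valuedCompletion_apply]
      exact (A.valuation_le_one_iff x).2 hx
  have : Finite {A : ValuationSubring K | A ≠ ⊤ ∧ x ∉ A} := finite_valuationSubring_notMem x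
  refine (Set.finite_range fun A : {A : ValuationSubring K | A ≠ ⊤ ∧ x ∉ A} =>
    Place.finite A.1 A.2.1).subset ?_
  rintro w hw
  obtain ⟨A, hA, hx, rfl⟩ := h hw
  exact ⟨⟨A, hA, hx⟩, rfl⟩

/-- The diagonal embedding of `K` in its adele ring. -/
def AdeleRing.diagonal [IsGlobalField K] : K →+* AdeleRing K where
  toFun x := RestrictedProduct.mk (fun w => w.embedding x)
    (Place.eventually_embedding_mem_integers x)
  map_one' := by ext w; exact map_one w.embedding
  map_mul' x y := by ext w; exact map_mul w.embedding x y
  map_zero' := by ext w; exact map_zero w.embedding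
  map_add' x y := by ext w; exact map_add w.embedding x y

instance [IsGlobalField K] : Algebra K (AdeleRing K) := AdeleRing.diagonal.toAlgebra

variable (K) in
/-- The adele class space `X_K = 𝔸_K / K^*`. -/
abbrev AdeleClassSpace [IsGlobalField K] : Type u :=
  MulAction.orbitRel.Quotient Kˣ (AdeleRing K)

variable (K) in
/-- The image of `K^*` in the group of ideles. -/
abbrev principalIdeles [IsGlobalField K] : Subgroup (AdeleRing K)ˣ :=
  (Units.map (algebraMap K (AdeleRing K) : K →* AdeleRing K)).range

variable (K) in
/-- The idele class group `C_K = 𝔸_K^* / K^*`. -/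
abbrev IdeleClassGroup [IsGlobalField K] : Type u :=
  (AdeleRing K)ˣ ⧸ principalIdeles K

/-- The class of an adele in `X_K`. -/
def adeleClass [IsGlobalField K] (a : AdeleRing K) : AdeleClassSpace K := Quotient.mk _ a

/-- The action of `C_K` on `X_K` by multiplication. -/
instance [IsGlobalField K] : MulAction (IdeleClassGroup K) (AdeleClassSpace K) where
  smul c x := Quotient.liftOn₂' c x (fun j a => adeleClass ((j : AdeleRing K) * a)) (by
    rintro j a j' a' hj ⟨k, rfl⟩
    obtain ⟨l, hl⟩ := QuotientGroup.leftRel_apply.1 hj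
    refine Quotient.sound ⟨l⁻¹ * k, ?_⟩
    have hj' : j' = j * Units.map (algebraMap K (AdeleRing K) : K →* AdeleRing K) l := by
      rw [hl]; group
    subst hj'
    simp only [Units.smul_def, Algebra.smul_def, Units.val_mul, Units.coe_map, map_mul,
      MonoidHom.coe_coe]
    have hl1 : algebraMap K (AdeleRing K) (l⁻¹ : Kˣ) * algebraMap K (AdeleRing K) l = 1 := by
      rw [← map_mul, Units.inv_mul, map_one]
    linear_combination (algebraMap K (AdeleRing K) k * j * a') * hl1)
  one_smul x := by
    induction x using Quotient.inductionOn' with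
    | h a => exact congrArg adeleClass (one_mul a)
  mul_smul c d x := by
    induction c using Quotient.inductionOn' with
    | h i =>
    induction d using Quotient.inductionOn' with
    | h j =>
    induction x using Quotient.inductionOn' with
    | h a => exact congrArg adeleClass (mul_assoc (i : AdeleRing K) j a)

open Classical in
/-- The adele `a^{(v)}` with component `0` at `v` and `1` at all other places. -/
def basePoint (v : Place K) : AdeleRing K :=
  RestrictedProduct.mk (fun w => if w = v then 0 else 1) (by
    refine Filter.Eventually.of_forall fun w => ?_
    by_cases h : w = v
    · simp only [h, if_true]; exact zero_mem _
    · simp only [h, if_false]; exact one_mem _)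

/-- The orbit `Ξ_{K,v} = C_K a^{(v)}` in `X_K`. -/
def classicalOrbit [IsGlobalField K] (v : Place K) : Set (AdeleClassSpace K) :=
  MulAction.orbit (IdeleClassGroup K) (adeleClass (basePoint v))

/-- The set `𝔸^{(1)}_{K,v}` of adeles with `a_v = 0` and with `a_w` in the interior of
`{|x| ≤ 1} ⊆ K_w` at every place `w`. -/
def unitSpace (v : Place K) : Set (AdeleRing K) :=
  {a | a v = 0 ∧ ∀ w : Place K, a w ∈ interior w.closedUnitBall}

/-- The groupoid `𝒢(v)` of pairs `(k, x)` with `x` and `k x` both in `𝔸^{(1)}_{K,v}`. -/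
@[ext]
structure ValuationGroupoid [IsGlobalField K] (v : Place K) : Type u where
  k : Kˣ
  x : AdeleRing K
  source_mem : x ∈ unitSpace v
  range_mem : k • x ∈ unitSpace v

namespace ValuationGroupoid

variable [IsGlobalField K] {v : Place K}

/-- The topology of `K^* × 𝔸_K`, where `K^*` is discrete. -/
instance : TopologicalSpace (ValuationGroupoid v) :=
  TopologicalSpace.induced (fun γ => (γ.k, γ.x))
    (@instTopologicalSpaceProd Kˣ (AdeleRing K) ⊥ inferInstance)

def source (γ : ValuationGroupoid v) : unitSpace v := ⟨γ.x, γ.source_mem⟩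

def range (γ : ValuationGroupoid v) : unitSpace v := ⟨γ.k • γ.x, γ.range_mem⟩

/-- The product `(k₁, k₂ x) (k₂, x) = (k₁ k₂, x)`. -/
def comp (γ₁ γ₂ : ValuationGroupoid v) (h : γ₁.source = γ₂.range) : ValuationGroupoid v where
  k := γ₁.k * γ₂.k
  x := γ₂.x
  source_mem := γ₂.source_mem
  range_mem := by
    have h' : γ₁.x = γ₂.k • γ₂.x := congrArg Subtype.val h
    rw [mul_smul, ← h']
    exact γ₁.range_mem

/-- The inverse `(k⁻¹, k x)` of `(k, x)`. -/
def inv (γ : ValuationGroupoid v) : ValuationGroupoid v where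
  k := γ.k⁻¹
  x := γ.k • γ.x
  source_mem := γ.range_mem
  range_mem := by rw [inv_smul_smul]; exact γ.source_mem

theorem source_eq_range_inv {γ₁ γ₂ : ValuationGroupoid v} (h : γ₁.source = γ₂.source) :
    γ₁.source = γ₂.inv.range := by
  rw [h]
  exact Subtype.ext (inv_smul_smul γ₂.k γ₂.x).symm

theorem continuous_of_k {Y : Type*} [TopologicalSpace Y] (g : Kˣ → Y) :
    Continuous fun γ : ValuationGroupoid v => g γ.k := by
  let : TopologicalSpace Kˣ := ⊥
  have : DiscreteTopology Kˣ := ⟨rfl⟩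
  have h : Continuous fun γ : ValuationGroupoid v => (γ.k, γ.x) := continuous_induced_dom
  exact (continuous_of_discreteTopology (f := g)).comp (continuous_fst.comp h)

/-- The set `𝒢(v)_y` of elements with source `y`. -/
abbrev Fiber (y : unitSpace v) : Type u := {γ : ValuationGroupoid v // γ.source = y}

/-- The product `γ γ₂⁻¹` of `γ, γ₂ ∈ 𝒢(v)_y`; it is the unique `γ₁` with `γ₁ γ₂ = γ`. -/
def Fiber.div {y : unitSpace v} (γ γ₂ : Fiber y) : ValuationGroupoid v :=
  γ.1.comp γ₂.1.inv (source_eq_range_inv (γ.2.trans γ₂.2.symm))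

end ValuationGroupoid

open ValuationGroupoid

/-- Schur's test for a matrix with finitely supported rows. -/
theorem schur_bound {I : Type*} {a : I → I → ℂ} {M : ℝ}
    (hrow : ∀ i, ∀ s : Finset I, ∑ j ∈ s, ‖a i j‖ ≤ M)
    (hcol : ∀ j, ∀ s : Finset I, ∑ i ∈ s, ‖a i j‖ ≤ M)
    (hfin : ∀ i, {j | a i j ≠ 0}.Finite) (ξ : lp (fun _ : I => ℂ) 2) (s : Finset I) :
    ∑ i ∈ s, ‖∑' j, a i j * ξ j‖ ^ 2 ≤ (M * ‖ξ‖) ^ 2 := by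
  classical
  let t : Finset I := s.biUnion fun i => (hfin i).toFinset
  have hsum : ∀ i ∈ s, ∑' j, a i j * ξ j = ∑ j ∈ t, a i j * ξ j := by
    intro i hi
    refine tsum_eq_sum fun j hj => ?_
    have : a i j = 0 := by
      by_contra h
      exact hj (Finset.mem_biUnion.2 ⟨i, hi, (hfin i).mem_toFinset.2 h⟩)
    rw [this, zero_mul]
  have hξ : ∑ j ∈ t, ‖ξ j‖ ^ 2 ≤ ‖ξ‖ ^ 2 := by
    have := lp.sum_rpow_le_norm_rpow (p := 2) (by simp) ξ t
    simpa using this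
  have key : ∀ i ∈ s, ‖∑' j, a i j * ξ j‖ ^ 2 ≤ M * ∑ j ∈ t, ‖a i j‖ * ‖ξ j‖ ^ 2 := by
    intro i hi
    rw [hsum i hi]
    have h1 : ‖∑ j ∈ t, a i j * ξ j‖ ≤ ∑ j ∈ t, ‖a i j‖ * ‖ξ j‖ :=
      (norm_sum_le _ _).trans (by simp)
    have h2 : (∑ j ∈ t, ‖a i j‖ * ‖ξ j‖) ^ 2 ≤
        (∑ j ∈ t, ‖a i j‖) * ∑ j ∈ t, ‖a i j‖ * ‖ξ j‖ ^ 2 :=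
      Finset.sum_sq_le_sum_mul_sum_of_sq_le_mul _ (fun j _ => norm_nonneg _)
        (fun j _ => by positivity) (fun j _ => le_of_eq (by ring))
    calc ‖∑ j ∈ t, a i j * ξ j‖ ^ 2 ≤ (∑ j ∈ t, ‖a i j‖ * ‖ξ j‖) ^ 2 := by gcongr
      _ ≤ _ := h2
      _ ≤ _ := by
        gcongr
        exact hrow i t
  by_cases hs : s = ∅
  · subst hs
    simpa using sq_nonneg _
  obtain ⟨i₀, -⟩ := Finset.nonempty_iff_ne_empty.2 hs
  have hM : 0 ≤ M := by simpa using hrow i₀ ∅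
  calc ∑ i ∈ s, ‖∑' j, a i j * ξ j‖ ^ 2
      ≤ ∑ i ∈ s, M * ∑ j ∈ t, ‖a i j‖ * ‖ξ j‖ ^ 2 := Finset.sum_le_sum key
    _ = M * ∑ j ∈ t, (∑ i ∈ s, ‖a i j‖) * ‖ξ j‖ ^ 2 := by
        rw [← Finset.mul_sum, Finset.sum_comm]
        simp_rw [Finset.sum_mul]
    _ ≤ M * ∑ j ∈ t, M * ‖ξ j‖ ^ 2 := by
        gcongr with j _
        exact hcol j s
    _ = M ^ 2 * ∑ j ∈ t, ‖ξ j‖ ^ 2 := by rw [← Finset.mul_sum]; ring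
    _ ≤ M ^ 2 * ‖ξ‖ ^ 2 := by gcongr
    _ = (M * ‖ξ‖) ^ 2 := by ring

theorem exists_schur_bound [IsGlobalField K] {v : Place K} (y : unitSpace v)
    (f : CompactlySupportedContinuousMap (ValuationGroupoid v) ℂ) :
    ∃ M : ℝ, (∀ γ : Fiber y, ∀ s : Finset (Fiber y), ∑ γ₂ ∈ s, ‖f (γ.div γ₂)‖ ≤ M) ∧
      (∀ γ₂ : Fiber y, ∀ s : Finset (Fiber y), ∑ γ ∈ s, ‖f (γ.div γ₂)‖ ≤ M) ∧
      ∀ γ : Fiber y, {γ₂ : Fiber y | f (γ.div γ₂) ≠ 0}.Finite := by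
  classical
  obtain ⟨C, hC⟩ := f.hasCompactSupport.exists_bound_of_continuous f.continuous
  have hfin : ((fun γ : ValuationGroupoid v => γ.k) '' tsupport f).Finite := by
    let : TopologicalSpace Kˣ := ⊥
    have : DiscreteTopology Kˣ := ⟨rfl⟩
    exact (f.hasCompactSupport.image (continuous_of_k fun k => k)).finite_of_discrete
  let S : Finset Kˣ := hfin.toFinset
  have hS : ∀ γ, f γ ≠ 0 → γ.k ∈ S := fun γ hγ =>
    hfin.mem_toFinset.2 ⟨γ, subset_tsupport _ hγ, rfl⟩
  have hx : ∀ γ : Fiber y, γ.1.x = y.1 := fun γ => congrArg Subtype.val γ.2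
  have hk : ∀ γ γ' : Fiber y, γ.1.k = γ'.1.k → γ = γ' := fun γ γ' h =>
    Subtype.ext (ValuationGroupoid.ext h ((hx γ).trans (hx γ').symm))
  have inj₂ : ∀ γ : Fiber y, Function.Injective fun γ₂ : Fiber y => (γ.div γ₂).k := by
    intro γ γ₂ γ₂' h
    exact hk _ _ (inv_injective (mul_left_cancel h))
  have inj₁ : ∀ γ₂ : Fiber y, Function.Injective fun γ : Fiber y => (γ.div γ₂).k := by
    intro γ₂ γ γ' h
    exact hk _ _ (mul_right_cancel h)
  have bound : ∀ (e : Fiber y → ValuationGroupoid v), (Function.Injective fun γ => (e γ).k) →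
      ∀ s : Finset (Fiber y), ∑ γ ∈ s, ‖f (e γ)‖ ≤ S.card * |C| := by
    intro e he s
    rw [← Finset.sum_filter_add_sum_filter_not s fun γ => f (e γ) ≠ 0]
    have h0 : ∑ γ ∈ s with ¬ f (e γ) ≠ 0, ‖f (e γ)‖ = 0 :=
      Finset.sum_eq_zero fun γ hγ => by simpa using (Finset.mem_filter.1 hγ).2
    rw [h0, add_zero]
    calc _ ≤ ∑ γ ∈ s with f (e γ) ≠ 0, |C| :=
          Finset.sum_le_sum fun γ _ => (hC _).trans (le_abs_self C)
      _ = ((s.filter fun γ => f (e γ) ≠ 0).card : ℝ) * |C| := by simp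
      _ ≤ _ := by
        gcongr
        exact Finset.card_le_card_of_injOn (fun γ => (e γ).k)
          (fun γ hγ => hS _ (Finset.mem_filter.1 hγ).2) he.injOn
  refine ⟨S.card * |C|, fun γ => bound _ (inj₂ γ), fun γ₂ => bound _ (inj₁ γ₂), fun γ => ?_⟩
  refine Set.Finite.of_finite_image (f := fun γ₂ : Fiber y => (γ.div γ₂).k)
    (S.finite_toSet.subset ?_) (inj₂ γ).injOn
  rintro _ ⟨γ₂, h, rfl⟩
  exact hS _ h

/-- The regular representation `π_y` of `C_c(𝒢(v))` on `ℓ²(𝒢(v)_y)` by left convolution,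
`(π_y(f) ξ)(γ) = ∑_{γ₁ γ₂ = γ} f(γ₁) ξ(γ₂)`. -/
def regularRep [IsGlobalField K] {v : Place K} (y : unitSpace v)
    (f : CompactlySupportedContinuousMap (ValuationGroupoid v) ℂ) :
    lp (fun _ : Fiber y => ℂ) 2 →L[ℂ] lp (fun _ : Fiber y => ℂ) 2 :=
  LinearMap.mkContinuousOfExistsBound
    { toFun := fun ξ => ⟨fun γ => ∑' γ₂ : Fiber y, f (γ.div γ₂) * ξ γ₂, by
        obtain ⟨M, hrow, hcol, hfin⟩ := exists_schur_bound y f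
        exact memℓp_gen' (C := (M * ‖ξ‖) ^ 2) fun s => by
          simpa using schur_bound hrow hcol hfin ξ s⟩
      map_add' := fun ξ η => by
        obtain ⟨M, hrow, hcol, hfin⟩ := exists_schur_bound y f
        have hs : ∀ (γ : Fiber y) (ζ : lp (fun _ : Fiber y => ℂ) 2),
            Summable fun γ₂ => f (γ.div γ₂) * ζ γ₂ := fun γ ζ =>
          summable_of_hasFiniteSupport ((hfin γ).subset fun γ₂ h h0 => h (by simp [h0]))
        ext γ
        simp only [lp.coeFn_add, Pi.add_apply, mul_add]
        exact (hs γ ξ).tsum_add (hs γ η)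
      map_smul' := fun c ξ => by
        ext γ
        simp only [lp.coeFn_smul, Pi.smul_apply, smul_eq_mul, RingHom.id_apply, ← tsum_mul_left]
        exact tsum_congr fun γ₂ => by ring }
    (by
      obtain ⟨M, hrow, hcol, hfin⟩ := exists_schur_bound y f
      refine ⟨|M|, fun ξ => lp.norm_le_of_forall_sum_le (by simp) (by positivity) fun s => ?_⟩
      have h := schur_bound hrow hcol hfin ξ s
      rw [← sq_abs, abs_mul, abs_norm] at h
      simpa using h)

/-- The time evolution `σ_t(f)(k, x) = |k|_v^{it} f(k, x)` on `C_c(𝒢(v))`. -/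
def timeEvolution [IsGlobalField K] (v : Place K) (t : ℝ)
    (f : CompactlySupportedContinuousMap (ValuationGroupoid v) ℂ) :
    CompactlySupportedContinuousMap (ValuationGroupoid v) ℂ where
  toFun γ := ((v.absValue γ.k : ℝ) : ℂ) ^ (Complex.I * t) * f γ
  continuous_toFun :=
    (continuous_of_k fun k : Kˣ => ((v.absValue k : ℝ) : ℂ) ^ (Complex.I * t)).mul f.continuous
  hasCompactSupport' := f.hasCompactSupport.mul_left

/-- The operator `(H_y ξ)(k, y) = log |k|_v ξ(k, y)` on `ℓ²(𝒢(v)_y)`, with its maximal domain. -/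
def hamiltonian [IsGlobalField K] {v : Place K} (y : unitSpace v) :
    lp (fun _ : Fiber y => ℂ) 2 →ₗ.[ℂ] lp (fun _ : Fiber y => ℂ) 2 where
  domain :=
    { carrier := {ξ | Memℓp (fun γ : Fiber y => (Real.log (v.absValue γ.1.k) : ℂ) * ξ γ) 2}
      zero_mem' := by simpa using zero_mem_ℓp'
      add_mem' := fun {ξ η} hξ hη => by
        have h := Memℓp.add hξ hη
        refine (congrArg (fun g => Memℓp g 2) ?_).mp h
        funext γ
        simp [mul_add]
      smul_mem' := fun c ξ hξ => by
        have h := Memℓp.const_smul hξ c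
        refine (congrArg (fun g => Memℓp g 2) ?_).mp h
        funext γ
        simp [mul_left_comm] }
  toFun :=
    { toFun := fun ξ => ⟨fun γ => (Real.log (v.absValue γ.1.k) : ℂ) * ξ.1 γ, ξ.2⟩
      map_add' := fun ξ η => by ext γ; exact mul_add _ _ _
      map_smul' := fun c ξ => by ext γ; simp [mul_left_comm] }

section PositiveEnergy

variable {H : Type*} [NormedAddCommGroup H] [InnerProductSpace ℂ H]

/-- `U` is a strongly continuous one-parameter group of unitaries whose generator is `D`, that is,
`U t = e^{itD}`: `ξ` is in the domain of `D` with `D ξ = η` iff `t ↦ U t ξ` has derivative `i η`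
at `0`. (By Stone's theorem, `D` is then self-adjoint.) -/
structure IsUnitaryGroupGeneratedBy (U : ℝ → H ≃ₗᵢ[ℂ] H) (D : H →ₗ.[ℂ] H) : Prop where
  map_add : ∀ s t ξ, U (s + t) ξ = U s (U t ξ)
  continuous : ∀ ξ, Continuous fun t => U t ξ
  generator : ∀ ξ η, (ξ, η) ∈ D.graph ↔ HasDerivAt (fun t => U t ξ) (Complex.I • η) 0

/-- The Hamiltonian `D` implements the time evolution `σ` in the representation `π`:
`π(σ_t(b)) = e^{itD} π(b) e^{-itD}`. -/
def Implements {B : Type*} (π : B → H →L[ℂ] H) (σ : ℝ → B → B) (D : H →ₗ.[ℂ] H) : Prop :=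
  ∃ U : ℝ → H ≃ₗᵢ[ℂ] H, IsUnitaryGroupGeneratedBy U D ∧
    ∀ t b ξ, π (σ t b) ξ = U t (π b (U (-t) ξ))

/-- The operator `D` is bounded below: `⟨ξ, D ξ⟩ ≥ c ‖ξ‖²` on its domain, for some real `c`. -/
def IsBoundedBelow (D : H →ₗ.[ℂ] H) : Prop :=
  ∃ c : ℝ, ∀ ξ : D.domain, c * ‖(ξ : H)‖ ^ 2 ≤ (inner ℂ (ξ : H) (D ξ)).re

/-- `π` is a positive energy representation for `σ`: the time evolution is implemented by some
Hamiltonian that is bounded below. -/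
def IsPositiveEnergy {B : Type*} (π : B → H →L[ℂ] H) (σ : ℝ → B → B) : Prop :=
  ∃ D : H →ₗ.[ℂ] H, Implements π σ D ∧ IsBoundedBelow D

end PositiveEnergy

end

/-! In the basis of point masses of `ℓ²(𝒢(v)_y)` the Hamiltonian is diagonal. Its eigenvalues are
the energies `log |k|_v`, where `k` runs over the elements of `K^*` for which `k y` stays in the
unit space. Its unitary group is multiplication by `|k|_v^{it}`, and the implementing identity is
the multiplicativity of `|·|_v`. The theorem comes down to two facts: positive energy forces the
energies to be bounded below, and the energies are bounded below exactly when the class of `y` lies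
in `Ξ_{K,v}`.

For the first, let `D` be any implementing Hamiltonian with lower bound `c`, and let `γ₀ = (k, y)`
have energy `μ`. A bump function `f` at `γ₀`, supported where the `K^*`-coordinate is `k`, satisfies
`σ_t(f) = e^{itμ} f`. Hence `T = π_y(f)` is a contraction with `D T = T (D + μ)`. Fix `ξ` in the
domain of `D` whose coordinate at the unit has modulus at least `1/2`. Since `T` moves this
coordinate to `γ₀`, testing the lower bound on `T ξ` gives `μ ≥ c - 4 ‖ξ‖ ‖D ξ‖`, uniformly in `γ₀`
(`exists_le_energy_of_isPositiveEnergy`). Bump functions exist because `𝔸_K` is locally compact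
Hausdorff and the conditions defining the unit space, apart from `a_v = 0`, are open.

For the second, the class of `y` is in `Ξ_{K,v}` iff `y_w ≠ 0` for all `w ≠ v` and `y_w` is a unit
at almost all of them (`adeleClass_mem_classicalOrbit_iff`). In that case the multipliers with
`|k|_v ≤ 1` have bounded size at every place, so they are finite in number
(`finite_boundedMultipliers`): this is the discreteness of `K` in `𝔸_K`. Otherwise `k` may have
poles of any order at a place where `y` vanishes, or simple poles at infinitely many places where `0
< |y_w| < 1`. Either freedom produces multipliers that are arbitrarily small at `v`
(`exists_smul_mem_unitSpace_absValue_lt`). These come from the lattice-point property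
`HasSmallElements`, which is Minkowski's theorem for number fields and a pigeonhole count of
polynomials for function fields. -/

open IsDedekindDomain ValuationGroupoid Filter Topology

/-! ### Finiteness of the residue rings -/

/-- A torsion-free module of rank at most `n` over a principal ideal domain `R` satisfies
`|M / gM| ≤ |R / gR| ^ n`. -/
theorem card_quotient_smul_le {R M : Type*} [CommRing R] [IsDomain R] [IsPrincipalIdealRing R]
    [AddCommGroup M] [Module R M] [Module.IsTorsionFree R M] {n : ℕ}
    (hn : Module.rank R M ≤ n) (g : R) [Finite (R ⧸ Ideal.span {g})]
    (N : Submodule R M) (hN : ∀ m : M, g • m ∈ N) :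
    Finite (M ⧸ N) ∧ Nat.card (M ⧸ N) ≤ Nat.card (R ⧸ Ideal.span {g}) ^ n := by
  classical
  have : Fintype (R ⧸ Ideal.span {g}) := Fintype.ofFinite _
  have key : ∀ s : Finset (M ⧸ N), s.card ≤ Nat.card (R ⧸ Ideal.span {g}) ^ n := by
    intro s
    -- `M` need not be finitely generated. The span of finitely many representatives is finitely
    -- generated and torsion-free over a principal ideal domain, hence free, and its coordinates
    -- matter only modulo `g`.
    let P : Submodule R M := Submodule.span R (s.image (fun x => Quotient.out x) : Finset M)
    have : Module.Finite R P := Module.Finite.span_finset R _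
    have hfr : Module.finrank R P ≤ n := by
      have h1 : Module.rank R P ≤ n := (Submodule.rank_le P).trans hn
      have := Module.finrank_le_of_rank_le (n := n) h1
      exact this
    let b := Module.finBasis R P
    let φ : (Fin (Module.finrank R P) → R ⧸ Ideal.span {g}) → M ⧸ N :=
      fun c => N.mkQ (∑ i, (Quotient.out (c i)) • (b i : M))
    have hs : s ⊆ Finset.univ.image φ := by
      intro x hx
      let z : P := ⟨Quotient.out x, Submodule.subset_span
        (Finset.mem_coe.2 (Finset.mem_image.2 ⟨x, hx, rfl⟩))⟩
      refine Finset.mem_image.2 ⟨fun i => Ideal.Quotient.mk _ (b.repr z i), Finset.mem_univ _, ?_⟩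
      have hz : (z : M) = ∑ i, b.repr z i • (b i : M) := by
        have := congrArg Subtype.val (b.sum_repr z)
        rw [← this]
        simp only [Submodule.coe_sum, Submodule.coe_smul]
      have hxz : x = N.mkQ (z : M) := (Quotient.out_eq x).symm
      rw [hxz, hz]
      change N.mkQ _ = N.mkQ _
      rw [← sub_eq_zero, ← map_sub, ← Finset.sum_sub_distrib]
      simp only [← sub_smul]
      rw [Submodule.mkQ_apply, Submodule.Quotient.mk_eq_zero]
      refine N.sum_mem fun i _ => ?_
      have : Quotient.out (Ideal.Quotient.mk (Ideal.span {g}) (b.repr z i)) - b.repr z i ∈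
          Ideal.span {g} := by
        rw [← Ideal.Quotient.eq]
        exact Quotient.out_eq _
      obtain ⟨r, hr⟩ := Ideal.mem_span_singleton'.1 this
      rw [← hr, mul_comm, mul_smul]
      exact hN _
    calc s.card ≤ (Finset.univ.image φ).card := Finset.card_le_card hs
      _ ≤ Fintype.card (Fin (Module.finrank R P) → R ⧸ Ideal.span {g}) := Finset.card_image_le
      _ = Nat.card (R ⧸ Ideal.span {g}) ^ Module.finrank R P := by
        simp [Nat.card_eq_fintype_card]
      _ ≤ _ := Nat.pow_le_pow_right Nat.card_pos hfr
  have hfin : Finite (M ⧸ N) := by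
    by_contra h
    rw [not_finite_iff_infinite] at h
    obtain ⟨s, hs⟩ := Infinite.exists_subset_card_eq (M ⧸ N)
      (Nat.card (R ⧸ Ideal.span {g}) ^ n + 1)
    have := key s
    lia
  have : Fintype (M ⧸ N) := Fintype.ofFinite _
  refine ⟨hfin, ?_⟩
  rw [Nat.card_eq_fintype_card (α := M ⧸ N)]
  exact key Finset.univ

theorem finite_int_quotient {g : ℤ} (hg : g ≠ 0) : Finite (ℤ ⧸ Ideal.span {g}) := by
  have : NeZero g.natAbs := ⟨by simpa using hg⟩
  exact Finite.of_equiv _ (Int.quotientSpanEquivZMod g).symm.toEquiv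

theorem card_polynomial_quotient {F : Type*} [Field F] [Finite F] {g : Polynomial F} (hg : g ≠ 0) :
    Finite (Polynomial F ⧸ Ideal.span {g}) ∧
      Nat.card (Polynomial F ⧸ Ideal.span {g}) = Nat.card F ^ g.natDegree := by
  have h : Module.finrank F (Polynomial F ⧸ Ideal.span {g}) = g.natDegree :=
    finrank_quotient_span_eq_natDegree
  have : Module.Finite F (Polynomial F ⧸ Ideal.span {g}) := (AdjoinRoot.powerBasis hg).finite
  refine ⟨Module.finite_of_finite F, ?_⟩
  rw [← h]
  exact Module.natCard_eq_pow_finrank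

/-- Multiplication by `u` is injective and carries the pair `I ⊆ S` to `u I ⊆ u S`, so it preserves
the index. The rest is multiplicativity of indices in a tower, valid also for infinite index with
the value `0`. -/
theorem card_quotient_span_mul {S : Type*} [CommRing S] [IsDomain S] {u : S} (hu : u ≠ 0)
    (I : Ideal S) :
    Nat.card (S ⧸ (Ideal.span {u} * I)) = Nat.card (S ⧸ Ideal.span {u}) * Nat.card (S ⧸ I) := by
  let f : S →+ S := AddMonoidHom.mulLeft u
  have hf : Function.Injective f := mul_right_injective₀ hu
  have h1 : (Ideal.span {u} * I).toAddSubgroup = I.toAddSubgroup.map f := by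
    ext x
    simp [Ideal.mem_span_singleton_mul, f]
  have h2 : (Ideal.span {u}).toAddSubgroup = (⊤ : AddSubgroup S).map f := by
    ext x
    simp [Ideal.mem_span_singleton, f, dvd_def, eq_comm]
  have h := AddSubgroup.relIndex_mul_index (H := (Ideal.span {u} * I).toAddSubgroup)
    (K := (Ideal.span {u}).toAddSubgroup)
    (Ideal.mul_le_left (I := Ideal.span {u}) (J := I))
  rw [h1, h2, AddSubgroup.relIndex_map_map_of_injective _ _ hf, AddSubgroup.relIndex_top_right,
    ← h1, ← h2, mul_comm] at h
  exact h.symm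

/-- Since `X⁻¹` is transcendental, the substitution `X ↦ X⁻¹` extends to the fraction field, where
it is an involution. It serves to turn a pole of `X` into a zero. -/
theorem RatFunc.exists_ringEquiv_inv (F : Type*) [Field F] :
    ∃ σ : RatFunc F ≃+* RatFunc F, σ RatFunc.X = RatFunc.X⁻¹ := by
  have htr : Transcendental F (RatFunc.X⁻¹ : RatFunc F) := by
    rw [Transcendental, IsAlgebraic.inv_iff]
    exact RatFunc.transcendental_X
  have hinj : Function.Injective (Polynomial.aeval (R := F) (RatFunc.X⁻¹ : RatFunc F)) :=
    transcendental_iff_injective.1 htr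
  let σ : RatFunc F →ₐ[F] RatFunc F := RatFunc.liftAlgHom
    (Polynomial.aeval (RatFunc.X⁻¹ : RatFunc F))
    (nonZeroDivisors_le_comap_nonZeroDivisors_of_injective _ hinj)
  have hσ : ∀ q : Polynomial F, σ (algebraMap _ _ q) =
      Polynomial.aeval (RatFunc.X⁻¹ : RatFunc F) q := by
    intro q
    have := RatFunc.liftAlgHom_apply_div (Polynomial.aeval (RatFunc.X⁻¹ : RatFunc F))
      (nonZeroDivisors_le_comap_nonZeroDivisors_of_injective _ hinj) q 1
    simpa using this
  have hX : σ RatFunc.X = RatFunc.X⁻¹ := by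
    conv_lhs => rw [← RatFunc.algebraMap_X, hσ, Polynomial.aeval_X]
  have h1 : ∀ q : Polynomial F, σ (σ (algebraMap _ _ q)) = algebraMap _ _ q := by
    intro q
    rw [hσ, ← Polynomial.aeval_algHom_apply, map_inv₀, hX, inv_inv, ← RatFunc.algebraMap_X,
      Polynomial.aeval_algebraMap_apply, Polynomial.aeval_X_left_apply]
  have h2 : ∀ r, σ (σ r) = r := by
    intro r
    obtain ⟨a, b, -, rfl⟩ := IsFractionRing.div_surjective (A := Polynomial F) r
    rw [map_div₀, map_div₀, h1, h1]
  exact ⟨RingEquiv.ofRingHom σ.toRingHom σ.toRingHom (RingHom.ext h2) (RingHom.ext h2), hX⟩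

/-- A valuation ring of a function field contains the image of `X` for a suitable choice of the
field of rational functions. -/
theorem exists_algebra_ratFunc_mem {K : Type*} [Field K] {p : ℕ} [Fact p.Prime]
    [Algebra (RatFunc (ZMod p)) K] [FiniteDimensional (RatFunc (ZMod p)) K]
    (A : ValuationSubring K) :
    ∃ (_ : Algebra (RatFunc (ZMod p)) K) (_ : FiniteDimensional (RatFunc (ZMod p)) K),
      algebraMap (RatFunc (ZMod p)) K RatFunc.X ∈ A := by
  rcases A.mem_or_inv_mem (algebraMap (RatFunc (ZMod p)) K RatFunc.X) with h | h
  · exact ⟨_, inferInstance, h⟩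
  · obtain ⟨σ, hσ⟩ := RatFunc.exists_ringEquiv_inv (ZMod p)
    let φ := algebraMap (RatFunc (ZMod p)) K
    have hφ : φ.comp σ.toRingHom RatFunc.X ∈ A := by
      change φ (σ RatFunc.X) ∈ A
      rwa [hσ, map_inv₀]
    refine ⟨(φ.comp σ.toRingHom).toAlgebra, ?_, hφ⟩
    refine @Module.Finite.of_equiv_equiv (RatFunc (ZMod p)) K (RatFunc (ZMod p)) K _ _ _ _ _
      (φ.comp σ.toRingHom).toAlgebra σ.symm (RingEquiv.refl K) ?_ ‹_›
    ext r
    exact congrArg φ (σ.apply_symm_apply r)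

theorem ValuationSubring.algebraMap_polynomial_mem {K : Type*} [Field K] {p : ℕ} [Fact p.Prime]
    [Algebra (RatFunc (ZMod p)) K] {A : ValuationSubring K}
    (hA : algebraMap (RatFunc (ZMod p)) K RatFunc.X ∈ A) (q : Polynomial (ZMod p)) :
    algebraMap (RatFunc (ZMod p)) K (algebraMap _ _ q) ∈ A := by
  induction q using Polynomial.induction_on' with
  | add a b ha hb => simpa using A.add_mem _ _ ha hb
  | monomial n c =>
    rw [← Polynomial.C_mul_X_pow_eq_monomial]
    simp only [map_mul, map_pow, RatFunc.algebraMap_X]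
    exact A.mul_mem _ _ (A.map_zmod_mem (((algebraMap (RatFunc (ZMod p)) K).comp
      (algebraMap (Polynomial (ZMod p)) (RatFunc (ZMod p)))).comp Polynomial.C) c) (pow_mem hA n)

theorem rank_le_finrank_of_isFractionRing (R F : Type*) {K : Type*} [CommRing R] [IsDomain R]
    [Field F] [Field K] [Algebra R F] [IsFractionRing R F] [Algebra F K] [Algebra R K]
    [IsScalarTower R F K] [FiniteDimensional F K] (N : Submodule R K) :
    Module.rank R N ≤ Module.finrank F K := by
  refine (Submodule.rank_le N).trans ?_
  rw [← IsLocalization.rank_eq F (nonZeroDivisors R) le_rfl, Module.finrank_eq_rank]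

/-- An algebraic `x ≠ 0` divides in `A` some nonzero `g` coming from `R`. As an `R`-module, `A` is
torsion-free of rank at most `[K : F]`, so `card_quotient_smul_le` applies although `A` may not be
finitely generated over `R`. -/
theorem ValuationSubring.finite_quotient_of_isFractionRing (R F : Type*) {K : Type*} [CommRing R]
    [IsDomain R] [IsPrincipalIdealRing R] [Field F] [Field K] [Algebra R F] [IsFractionRing R F]
    [Algebra F K] [FiniteDimensional F K]
    (hR : ∀ g : R, g ≠ 0 → Finite (R ⧸ Ideal.span {g})) (A : ValuationSubring K)
    (hA : ∀ r : R, algebraMap F K (algebraMap R F r) ∈ A) {x : A} (hx : x ≠ 0) :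
    Finite (A ⧸ Ideal.span {x}) := by
  let : Algebra R K := ((algebraMap F K).comp (algebraMap R F)).toAlgebra
  have : IsScalarTower R F K := IsScalarTower.of_algebraMap_eq fun _ => rfl
  let : Algebra R A := ((algebraMap R K).codRestrict A.toSubring hA).toAlgebra
  have : IsScalarTower R A K := IsScalarTower.of_algebraMap_eq fun _ => rfl
  have hinjRK : Function.Injective (algebraMap R K) :=
    (algebraMap F K).injective.comp (IsFractionRing.injective R F)
  have : FaithfulSMul R K := (faithfulSMul_iff_algebraMap_injective R K).2 hinjRK
  have : Algebra.IsAlgebraic R K :=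
    (IsFractionRing.comap_isAlgebraic_iff (A := R) (K := F) (C := K)).2 inferInstance
  have halg : IsAlgebraic R x := by
    rw [← isAlgebraic_algebraMap_iff (A := K) Subtype.val_injective]
    exact Algebra.IsAlgebraic.isAlgebraic _
  obtain ⟨g, hg, hxg⟩ := halg.exists_nonzero_dvd (mem_nonZeroDivisors_of_ne_zero hx)
  have := hR g hg
  let ι : A →ₗ[R] K := (IsScalarTower.toAlgHom R A K).toLinearMap
  have hrank : Module.rank R A ≤ Module.finrank F K := by
    have e := LinearEquiv.ofInjective ι Subtype.val_injective
    rw [e.rank_eq]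
    exact rank_le_finrank_of_isFractionRing R F _
  have : Module.IsTorsionFree R A :=
    Function.Injective.moduleIsTorsionFree ι Subtype.val_injective fun r m => map_smul ι r m
  refine (card_quotient_smul_le hrank g ((Ideal.span {x}).restrictScalars R) fun m => ?_).1
  rw [Algebra.smul_def]
  exact Ideal.mul_mem_right _ _ (Ideal.mem_span_singleton.2 hxg)

/-- The proper quotients of a valuation ring of a global field are finite. -/
theorem ValuationSubring.finite_quotient {K : Type*} [Field K] [IsGlobalField K]
    (A : ValuationSubring K) {x : A} (hx : x ≠ 0) : Finite (A ⧸ Ideal.span {x}) := by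
  rcases IsGlobalField.numberField_or_functionField (K := K) with h | ⟨p, hp, _, _⟩
  · exact A.finite_quotient_of_isFractionRing ℤ ℚ (fun g hg => finite_int_quotient hg)
      (fun r => by simp) hx
  · obtain ⟨_, _, hX⟩ := exists_algebra_ratFunc_mem (p := p) A
    exact A.finite_quotient_of_isFractionRing (Polynomial (ZMod p)) (RatFunc (ZMod p))
      (fun g hg => (card_polynomial_quotient hg).1) (fun r => A.algebraMap_polynomial_mem hX r) hx

theorem ValuationSubring.card_quotient_mul {K : Type*} [Field K] (A : ValuationSubring K)
    {x y : A} (hx : x ≠ 0) : Nat.card (A ⧸ Ideal.span {x * y}) =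
    Nat.card (A ⧸ Ideal.span {x}) * Nat.card (A ⧸ Ideal.span {y}) := by
  rw [← card_quotient_span_mul hx, Ideal.span_singleton_mul_span_singleton]

namespace ValuationSubring

variable {K : Type*} [Field K] [IsGlobalField K] (A : ValuationSubring K)

theorem card_quotient_pos {x : A} (hx : x ≠ 0) : 0 < Nat.card (A ⧸ Ideal.span {x}) := by
  have := A.finite_quotient hx
  exact Nat.card_pos

/-- Powers of a nonunit are eventually divisible by any given nonzero element. -/
theorem exists_dvd_pow {x u : A} (hx : (x : K) ∈ A.nonunits) (hu : u ≠ 0) : ∃ n : ℕ, u ∣ x ^ n := by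
  have := A.finite_quotient hu
  -- Two powers agree modulo `u`. In `x ^ i - x ^ j = x ^ i * (1 - x ^ (j - i))` the second factor
  -- is a unit of the local ring, so `u` divides `x ^ i`.
  obtain ⟨i, j, hij, h⟩ := Finite.exists_ne_map_eq_of_infinite
    fun n : ℕ => Ideal.Quotient.mk (Ideal.span {u}) (x ^ n)
  wlog hlt : i < j generalizing i j
  · exact this j i hij.symm h.symm (by lia)
  refine ⟨i, ?_⟩
  rw [Ideal.Quotient.eq, Ideal.mem_span_singleton] at h
  have hunit : IsUnit (1 - x ^ (j - i)) := by
    have hx' : x ∈ IsLocalRing.maximalIdeal A := coe_mem_nonunits_iff.1 hx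
    have : x ^ (j - i) ∈ IsLocalRing.maximalIdeal A :=
      Ideal.pow_mem_of_mem _ hx' _ (by lia)
    by_contra hn
    have h1 := Ideal.add_mem _ ((IsLocalRing.mem_maximalIdeal _).2 hn) this
    rw [sub_add_cancel] at h1
    exact (Ideal.ne_top_iff_one _).1 (IsLocalRing.maximalIdeal.isMaximal A).ne_top h1
  have h2 : x ^ i - x ^ j = x ^ i * (1 - x ^ (j - i)) := by
    rw [mul_sub, mul_one, ← pow_add]
    congr 2
    lia
  rw [h2] at h
  exact (hunit.dvd_mul_right).1 h

end ValuationSubring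

/-! ### The normalized absolute values -/

namespace Place

variable {K : Type*} [Field K]

theorem exists_eq_div_valuationSubring (A : ValuationSubring K) {x : K} (hx : x ≠ 0) :
    ∃ a b : A, a ≠ 0 ∧ b ≠ 0 ∧ x = a / b := by
  rcases A.mem_or_inv_mem x with h | h
  · exact ⟨⟨x, h⟩, 1, fun h0 => hx (congrArg Subtype.val h0), one_ne_zero, by simp⟩
  · exact ⟨1, ⟨x⁻¹, h⟩, one_ne_zero, fun h0 => inv_ne_zero hx (congrArg Subtype.val h0), by simp⟩

theorem absValue_zero (w : Place K) : w.absValue 0 = 0 := by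
  rcases w with w | ⟨A, hA⟩
  · simp [absValue, NumberField.InfinitePlace.mult_ne_zero]
  · simp [absValue]

variable [IsGlobalField K]

/-- This removes the case distinction in the definition: the formula holds for every way of writing
an element as a fraction. Positivity and multiplicativity of `|·|_w` are read off from it. -/
theorem absValue_finite_div (A : ValuationSubring K) (hA : A ≠ ⊤) {a b : A} (ha : a ≠ 0)
    (hb : b ≠ 0) : (Place.finite A hA).absValue ((a : K) / b) =
      Nat.card (A ⧸ Ideal.span {b}) / Nat.card (A ⧸ Ideal.span {a}) := by
  have ha' : (a : K) ≠ 0 := by simpa using ha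
  have hb' : (b : K) ≠ 0 := by simpa using hb
  have pa : (Nat.card (A ⧸ Ideal.span {a}) : ℝ) ≠ 0 := by
    exact_mod_cast (A.card_quotient_pos ha).ne'
  have pb : (Nat.card (A ⧸ Ideal.span {b}) : ℝ) ≠ 0 := by
    exact_mod_cast (A.card_quotient_pos hb).ne'
  rw [absValue, if_neg (div_ne_zero ha' hb')]
  split_ifs with h
  · have e : a = b * ⟨(a : K) / b, h⟩ := Subtype.ext (by simp [mul_div_cancel₀ _ hb'])
    have := A.card_quotient_mul (y := ⟨(a : K) / b, h⟩) hb
    rw [← e] at this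
    rw [this] at pa ⊢
    push_cast at pa ⊢
    field_simp
  · have h' := (A.mem_or_inv_mem _).resolve_left h
    have e : b = a * ⟨((a : K) / b)⁻¹, h'⟩ := Subtype.ext (by simp [mul_div_cancel₀ _ ha'])
    have := A.card_quotient_mul (y := ⟨((a : K) / b)⁻¹, h'⟩) ha
    rw [← e] at this
    rw [this]
    push_cast
    field_simp

theorem absValue_pos (w : Place K) {x : K} (hx : x ≠ 0) : 0 < w.absValue x := by
  rcases w with w | ⟨A, hA⟩
  · exact pow_pos (w.pos_iff.2 hx) _
  · obtain ⟨a, b, ha, hb, rfl⟩ := exists_eq_div_valuationSubring A hx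
    rw [absValue_finite_div A hA ha hb]
    have := A.card_quotient_pos ha
    have := A.card_quotient_pos hb
    positivity

theorem absValue_mul (w : Place K) (x y : K) :
    w.absValue (x * y) = w.absValue x * w.absValue y := by
  by_cases hx : x = 0
  · simp [hx, absValue_zero]
  by_cases hy : y = 0
  · simp [hy, absValue_zero]
  rcases w with w | ⟨A, hA⟩
  · simp [absValue, mul_pow]
  · obtain ⟨a, b, ha, hb, rfl⟩ := exists_eq_div_valuationSubring A hx
    obtain ⟨c, d, hc, hd, rfl⟩ := exists_eq_div_valuationSubring A hy
    have e : (a : K) / b * (c / d) = (a * c : A) / (b * d : A) := by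
      push_cast
      rw [div_mul_div_comm]
    rw [e, absValue_finite_div A hA ha hb, absValue_finite_div A hA hc hd,
      absValue_finite_div A hA (mul_ne_zero ha hc) (mul_ne_zero hb hd), A.card_quotient_mul ha,
      A.card_quotient_mul hb]
    push_cast
    rw [div_mul_div_comm]

/-- The normalized absolute value, as a multiplicative map. -/
noncomputable def absValueHom (w : Place K) : K →*₀ ℝ where
  toFun := w.absValue
  map_zero' := w.absValue_zero
  map_one' := by
    have h := w.absValue_mul 1 1
    rw [one_mul] at h
    exact (mul_eq_left₀ (w.absValue_pos one_ne_zero).ne').1 h.symm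
  map_mul' := w.absValue_mul

theorem absValue_inv (w : Place K) (x : K) : w.absValue x⁻¹ = (w.absValue x)⁻¹ :=
  map_inv₀ w.absValueHom x

theorem absValue_pow (w : Place K) (x : K) (n : ℕ) : w.absValue (x ^ n) = w.absValue x ^ n :=
  map_pow w.absValueHom x n

theorem absValue_finite_le_one {A : ValuationSubring K} (hA : A ≠ ⊤) {x : K} (hx : x ∈ A) :
    (Place.finite A hA).absValue x ≤ 1 := by
  by_cases h0 : x = 0
  · simp [h0, absValue_zero]
  rw [absValue, if_neg h0, dif_pos hx]
  refine inv_le_one_of_one_le₀ ?_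
  have := A.card_quotient_pos (x := ⟨x, hx⟩) fun h => h0 (congrArg Subtype.val h)
  exact_mod_cast this

theorem absValue_finite_lt_one {A : ValuationSubring K} (hA : A ≠ ⊤) {x : K}
    (hx : x ∈ A.nonunits) : (Place.finite A hA).absValue x < 1 := by
  by_cases h0 : x = 0
  · simp [h0, absValue_zero]
  have hxA : x ∈ A := ValuationSubring.nonunits_subset hx
  rw [absValue, if_neg h0, dif_pos hxA]
  refine inv_lt_one_of_one_lt₀ ?_
  have := A.finite_quotient (x := ⟨x, hxA⟩) fun h => h0 (congrArg Subtype.val h)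
  have : Nontrivial (A ⧸ Ideal.span {(⟨x, hxA⟩ : A)}) := by
    rw [Ideal.Quotient.nontrivial_iff]
    intro h
    have := Ideal.span_singleton_eq_top.1 h
    exact (ValuationSubring.coe_mem_nonunits_iff (a := ⟨x, hxA⟩)).1 hx this
  exact_mod_cast Finite.one_lt_card

theorem absValue_finite_le_one_iff {A : ValuationSubring K} (hA : A ≠ ⊤) {x : K} :
    (Place.finite A hA).absValue x ≤ 1 ↔ x ∈ A := by
  refine ⟨fun h => ?_, absValue_finite_le_one hA⟩
  by_contra hx
  have h1 := (ValuationSubring.inv_mem_nonunits_iff (A := A) (x := x)).2 (Or.inr hx)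
  have h2 := absValue_finite_lt_one hA h1
  have h0 : x ≠ 0 := by rintro rfl; exact hx A.zero_mem
  rw [absValue_inv, inv_lt_one₀ (absValue_pos _ h0)] at h2
  exact absurd h (not_le.2 h2)

end Place

theorem ValuationSubring.exists_ne_zero_mem_nonunits {K : Type*} [Field K] {A : ValuationSubring K}
    (hA : A ≠ ⊤) : ∃ x ∈ A.nonunits, x ≠ 0 := by
  by_contra! h
  apply hA
  refine top_unique (SetLike.le_def.2 fun {x} _ => ?_)
  by_contra hx
  have h1 := (ValuationSubring.inv_mem_nonunits_iff (A := A) (x := x)).2 (Or.inr hx)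
  have h2 := h _ h1
  rw [inv_eq_zero] at h2
  exact hx (h2 ▸ A.zero_mem)

/-! ### Diagonal unitary groups on `ℓ²` -/

section Diagonal

variable {I : Type*}

/-- Dominated convergence in `ℓ²`. -/
theorem lp.tendsto_of_dominated {α : Type*} {l : Filter α} {F : α → lp (fun _ : I => ℂ) 2}
    {G : lp (fun _ : I => ℂ) 2} {B : I → ℂ} (hB : Memℓp B 2)
    (hF : ∀ᶠ a in l, ∀ i, ‖F a i - G i‖ ≤ ‖B i‖)
    (hlim : ∀ i, Tendsto (fun a => F a i) l (𝓝 (G i))) : Tendsto F l (𝓝 G) := by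
  have hnorm : ∀ ξ : lp (fun _ : I => ℂ) 2, ‖ξ‖ ^ 2 = ∑' i, ‖ξ i‖ ^ 2 := by
    intro ξ
    have := lp.norm_rpow_eq_tsum (p := 2) (by simp) ξ
    simpa using this
  have hsum : Summable fun i => ‖B i‖ ^ 2 := by
    have := hB.summable (by simp)
    simpa using this
  have h : Tendsto (fun a => ‖F a - G‖ ^ 2) l (𝓝 0) := by
    have := tendsto_tsum_of_dominated_convergence (𝓕 := l) (f := fun a i => ‖F a i - G i‖ ^ 2)
      (g := fun _ => (0 : ℝ)) hsum (fun i => by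
        have := ((tendsto_sub_nhds_zero_iff.2 (hlim i)).norm).pow 2
        simpa using this)
      (by
        filter_upwards [hF] with a ha i
        rw [Real.norm_of_nonneg (by positivity)]
        gcongr
        exact ha i)
    simp only [tsum_zero] at this
    refine this.congr fun a => ?_
    rw [hnorm]
    rfl
  rw [← tendsto_sub_nhds_zero_iff, tendsto_zero_iff_norm_tendsto_zero]
  have := h.sqrt
  simpa [Real.sqrt_sq] using this

/-- Multiplication by a function of modulus one on `ℓ²`. -/
noncomputable def diagonalIsometry (u : I → ℂ) (hu : ∀ i, ‖u i‖ = 1) :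
    lp (fun _ : I => ℂ) 2 →ₗᵢ[ℂ] lp (fun _ : I => ℂ) 2 where
  toFun ξ := ⟨fun i => u i * ξ i, (lp.memℓp ξ).mono'
    fun i => le_of_eq (by rw [norm_mul, hu, one_mul])⟩
  map_add' ξ η := by ext i; exact mul_add _ _ _
  map_smul' c ξ := by ext i; simp [mul_left_comm]
  norm_map' ξ := by
    rw [lp.norm_eq_tsum_rpow (by simp), lp.norm_eq_tsum_rpow (by simp)]
    simp [hu]

/-- The one-parameter group `e^{itℓ}` of the multiplication operator by a real function `ℓ`. -/
noncomputable def diagonalGroup (ℓ : I → ℝ) (t : ℝ) :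
    lp (fun _ : I => ℂ) 2 ≃ₗᵢ[ℂ] lp (fun _ : I => ℂ) 2 :=
  { diagonalIsometry (fun i => Complex.exp ((t * ℓ i : ℝ) * Complex.I))
      (fun i => Complex.norm_exp_ofReal_mul_I _) with
    invFun := diagonalIsometry (fun i => Complex.exp ((-t * ℓ i : ℝ) * Complex.I))
      (fun i => Complex.norm_exp_ofReal_mul_I _)
    left_inv := fun ξ => by
      ext i
      change Complex.exp _ * (Complex.exp _ * ξ i) = ξ i
      rw [← mul_assoc, ← Complex.exp_add]
      simp
    right_inv := fun ξ => by
      ext i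
      change Complex.exp _ * (Complex.exp _ * ξ i) = ξ i
      rw [← mul_assoc, ← Complex.exp_add]
      simp }

theorem diagonalGroup_apply (ℓ : I → ℝ) (t : ℝ) (ξ : lp (fun _ : I => ℂ) 2) (i : I) :
    diagonalGroup ℓ t ξ i = Complex.exp ((t * ℓ i : ℝ) * Complex.I) * ξ i := rfl

theorem hasDerivAt_exp_ofReal_mul_I (r : ℝ) :
    HasDerivAt (fun t : ℝ => Complex.exp ((t * r : ℝ) * Complex.I)) (r * Complex.I) 0 := by
  have h1 : HasDerivAt (fun t : ℝ => ((t * r : ℝ) : ℂ) * Complex.I)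
      (((1 * r : ℝ) : ℂ) * Complex.I) 0 :=
    (((hasDerivAt_id (0 : ℝ)).mul_const r).ofReal_comp).mul_const Complex.I
  simpa using h1.cexp

/-- Coordinatewise differentiation forces `η = ℓ ξ`. Conversely, `|e^{itℓ} - 1| ≤ |t ℓ|` bounds the
difference quotients by `|η|`, which is in `ℓ²`, so dominated convergence applies. The generator
thus has the maximal domain. -/
theorem hasDerivAt_diagonalGroup_iff (ℓ : I → ℝ) (ξ η : lp (fun _ : I => ℂ) 2) :
    HasDerivAt (fun t => diagonalGroup ℓ t ξ) (Complex.I • η) 0 ↔ ∀ i, η i = ℓ i * ξ i := by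
  constructor
  · intro h i
    have h1 : HasDerivAt (fun t => diagonalGroup ℓ t ξ i) (Complex.I * η i) 0 :=
      (((lp.evalCLM (𝕜 := ℂ) (fun _ : I => ℂ) 2 i).restrictScalars ℝ).hasFDerivAt).comp_hasDerivAt
        (0 : ℝ) h
    have h2 : HasDerivAt (fun t => diagonalGroup ℓ t ξ i) (ℓ i * Complex.I * ξ i) 0 :=
      (hasDerivAt_exp_ofReal_mul_I (ℓ i)).mul_const (ξ i)
    have h3 := h1.unique h2
    have : Complex.I * η i = Complex.I * (ℓ i * ξ i) := by rw [h3]; ring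
    exact mul_left_cancel₀ Complex.I_ne_zero this
  · intro h
    rw [hasDerivAt_iff_tendsto_slope_zero]
    -- The factor `2` counts `|η i|` once for the difference quotient and once for its limit.
    refine lp.tendsto_of_dominated (B := fun i => 2 * η i)
      (Memℓp.const_mul (𝕜 := ℂ) (lp.memℓp η) 2) ?_ fun i => ?_
    · filter_upwards [self_mem_nhdsWithin] with t ht i
      have ht : t ≠ 0 := ht
      have e : (t⁻¹ • (diagonalGroup ℓ (0 + t) ξ - diagonalGroup ℓ 0 ξ) : lp (fun _ : I => ℂ) 2) i
          = (t⁻¹ : ℝ) * (Complex.exp (Complex.I * (t * ℓ i : ℝ)) - 1) * ξ i := by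
        change t⁻¹ • (diagonalGroup ℓ (0 + t) ξ i - diagonalGroup ℓ 0 ξ i) = _
        rw [diagonalGroup_apply, diagonalGroup_apply, Complex.real_smul]
        simp only [zero_add, zero_mul, Complex.ofReal_zero, Complex.exp_zero, mul_comm Complex.I]
        ring
      rw [e]
      refine (norm_sub_le _ _).trans ?_
      have h1 : ‖((t⁻¹ : ℝ) : ℂ) * (Complex.exp (Complex.I * (t * ℓ i : ℝ)) - 1) * ξ i‖ ≤
          ‖η i‖ := by
        rw [norm_mul, norm_mul, h i, norm_mul, Complex.norm_real, Complex.norm_real]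
        gcongr
        have := Real.norm_exp_I_mul_ofReal_sub_one_le (x := t * ℓ i)
        calc ‖t⁻¹‖ * _ ≤ ‖t⁻¹‖ * ‖t * ℓ i‖ := by gcongr
          _ = ‖ℓ i‖ := by rw [← norm_mul, inv_mul_cancel_left₀ ht]
      have h2 : ‖(Complex.I • η : lp (fun _ : I => ℂ) 2) i‖ = ‖η i‖ := by
        change ‖Complex.I * η i‖ = _
        simp
      have h3 : ‖2 * η i‖ = 2 * ‖η i‖ := by rw [norm_mul, Complex.norm_ofNat]
      rw [h2, h3]
      linarith
    · have h2 : HasDerivAt (fun t => diagonalGroup ℓ t ξ i) (ℓ i * Complex.I * ξ i) 0 :=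
        (hasDerivAt_exp_ofReal_mul_I (ℓ i)).mul_const (ξ i)
      have h3 : (Complex.I • η : lp (fun _ : I => ℂ) 2) i = ℓ i * Complex.I * ξ i := by
        change Complex.I * η i = _
        rw [h i]; ring
      rw [h3]
      have h4 := hasDerivAt_iff_tendsto_slope_zero.1 h2
      refine h4.congr fun t => ?_
      rfl

theorem continuous_diagonalGroup (ℓ : I → ℝ) (ξ : lp (fun _ : I => ℂ) 2) :
    Continuous fun t => diagonalGroup ℓ t ξ := by
  rw [continuous_iff_continuousAt]
  intro s
  refine lp.tendsto_of_dominated (B := fun i => 2 * ξ i) (Memℓp.const_mul (𝕜 := ℂ) (lp.memℓp ξ) 2)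
    (Eventually.of_forall fun t i => ?_) fun i => ?_
  · rw [diagonalGroup_apply, diagonalGroup_apply]
    refine (norm_sub_le _ _).trans ?_
    rw [norm_mul, norm_mul, norm_mul, Complex.norm_exp_ofReal_mul_I, Complex.norm_exp_ofReal_mul_I]
    simp only [Complex.norm_ofNat]
    linarith
  · simp only [diagonalGroup_apply]
    exact Continuous.tendsto (by fun_prop) s

end Diagonal

/-! ### The Hamiltonian `H_y` -/

section Hamiltonian

variable {K : Type*} [Field K] [IsGlobalField K] {v : Place K}

/-- The values `log |k|_v` of the Hamiltonian on `𝒢(v)_y`. -/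
noncomputable def energy (y : unitSpace v) (γ : Fiber y) : ℝ := Real.log (v.absValue γ.1.k)

theorem mem_graph_hamiltonian_iff (y : unitSpace v) (ξ η : lp (fun _ : Fiber y => ℂ) 2) :
    (ξ, η) ∈ (hamiltonian y).graph ↔ ∀ γ, η γ = energy y γ * ξ γ := by
  rw [LinearPMap.mem_graph_iff]
  constructor
  · rintro ⟨z, hz, hη⟩ γ
    have hz : (z : lp (fun _ : Fiber y => ℂ) 2) = ξ := hz
    have hη : hamiltonian y z = η := hη
    subst hz hη
    rfl
  · intro h
    have hm : ξ ∈ (hamiltonian y).domain := by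
      change Memℓp (fun γ : Fiber y => (Real.log (v.absValue γ.1.k) : ℂ) * ξ γ) 2
      exact (congrArg (fun g => Memℓp g 2) (funext h)).mp (lp.memℓp η)
    refine ⟨⟨ξ, hm⟩, rfl, ?_⟩
    ext γ
    exact (h γ).symm

theorem Place.cpow_absValue (v : Place K) (k : Kˣ) (t : ℝ) :
    ((v.absValue k : ℝ) : ℂ) ^ (Complex.I * t) =
      Complex.exp ((t * Real.log (v.absValue k) : ℝ) * Complex.I) := by
  have h := v.absValue_pos k.ne_zero
  rw [Complex.cpow_def_of_ne_zero (by exact_mod_cast h.ne'), ← Complex.ofReal_log h.le]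
  congr 1
  push_cast
  ring

theorem Place.log_absValue_mul_inv (v : Place K) (k l : Kˣ) :
    Real.log (v.absValue (k * l⁻¹ : Kˣ)) = Real.log (v.absValue k) - Real.log (v.absValue l) := by
  rw [Units.val_mul, Units.val_inv_eq_inv_val, v.absValue_mul, v.absValue_inv,
    Real.log_mul (v.absValue_pos k.ne_zero).ne' (inv_ne_zero (v.absValue_pos l.ne_zero).ne'),
    Real.log_inv, sub_eq_add_neg]

/-- The Hamiltonian `H_y` implements the time evolution. -/
theorem implements_hamiltonian (y : unitSpace v) :
    Implements (regularRep y) (timeEvolution v) (hamiltonian y) := by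
  refine ⟨diagonalGroup (energy y), ⟨fun s t ξ => ?_, continuous_diagonalGroup _, fun ξ η => ?_⟩,
    fun t f ξ => ?_⟩
  · ext γ
    simp only [diagonalGroup_apply]
    rw [← mul_assoc, ← Complex.exp_add]
    congr 2
    push_cast
    ring
  · exact (mem_graph_hamiltonian_iff y ξ η).trans (hasDerivAt_diagonalGroup_iff _ ξ η).symm
  · ext γ
    rw [diagonalGroup_apply]
    change ∑' γ₂ : Fiber y, timeEvolution v t f (γ.div γ₂) * ξ γ₂ =
      _ * ∑' γ₂ : Fiber y, f (γ.div γ₂) * diagonalGroup (energy y) (-t) ξ γ₂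
    rw [← tsum_mul_left]
    refine tsum_congr fun γ₂ => ?_
    rw [diagonalGroup_apply]
    change ((v.absValue (γ.div γ₂).k : ℝ) : ℂ) ^ (Complex.I * t) * f (γ.div γ₂) * ξ γ₂ = _
    have hk : (γ.div γ₂).k = γ.1.k * γ₂.1.k⁻¹ := rfl
    -- The phase of the matrix entry at `(γ, γ₂)` splits into a row phase and the inverse of a
    -- column phase, which is conjugation by the diagonal group.
    have e : Complex.exp ((t * Real.log (v.absValue (γ.div γ₂).k) : ℝ) * Complex.I) =
        Complex.exp ((t * energy y γ : ℝ) * Complex.I) *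
          Complex.exp ((-t * energy y γ₂ : ℝ) * Complex.I) := by
      rw [hk, v.log_absValue_mul_inv, ← Complex.exp_add, energy, energy]
      congr 1
      push_cast
      ring
    rw [v.cpow_absValue, e]
    ring

/-- The quadratic form is the sum of `energy y γ * |ξ γ|²`, compared termwise with `c ‖ξ‖²`. -/
theorem isBoundedBelow_hamiltonian (y : unitSpace v) {c : ℝ} (hc : ∀ γ, c ≤ energy y γ) :
    IsBoundedBelow (hamiltonian y) := by
  refine ⟨c, fun ξ => ?_⟩
  have h1 : HasSum (fun γ => (inner ℂ (ξ.1 γ) (hamiltonian y ξ γ)).re)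
      (inner ℂ (ξ : lp (fun _ : Fiber y => ℂ) 2) (hamiltonian y ξ)).re :=
    Complex.hasSum_re (lp.hasSum_inner _ _)
  have h2 : HasSum (fun γ => c * (inner ℂ (ξ.1 γ) (ξ.1 γ)).re)
      (c * (inner ℂ (ξ : lp (fun _ : Fiber y => ℂ) 2) (ξ : lp (fun _ : Fiber y => ℂ) 2)).re) :=
    (Complex.hasSum_re (lp.hasSum_inner _ _)).mul_left c
  have e : (inner ℂ (ξ : lp (fun _ : Fiber y => ℂ) 2) (ξ : lp (fun _ : Fiber y => ℂ) 2)).re =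
      ‖(ξ : lp (fun _ : Fiber y => ℂ) 2)‖ ^ 2 := by
    rw [inner_self_eq_norm_sq_to_K]
    norm_cast
  rw [← e]
  refine hasSum_le (fun γ => ?_) h2 h1
  have hξ : hamiltonian y ξ γ = energy y γ * ξ.1 γ := rfl
  rw [hξ]
  have e2 : (inner ℂ (ξ.1 γ) (energy y γ * ξ.1 γ)).re =
      energy y γ * (inner ℂ (ξ.1 γ) (ξ.1 γ)).re := by
    rw [← smul_eq_mul, inner_smul_right, Complex.re_ofReal_mul]
  rw [e2]
  gcongr
  · exact inner_self_nonneg (𝕜 := ℂ) (x := ξ.1 γ)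
  · exact hc γ

end Hamiltonian

/-! ### Generators of one-parameter unitary groups -/

section Generator

variable {H : Type*} [NormedAddCommGroup H] [InnerProductSpace ℂ H] {U : ℝ → H ≃ₗᵢ[ℂ] H}
  {D : H →ₗ.[ℂ] H}

theorem IsUnitaryGroupGeneratedBy.map_zero (hU : IsUnitaryGroupGeneratedBy U D) (ξ : H) :
    U 0 ξ = ξ := by
  have h := hU.map_add 0 0 ξ
  rw [add_zero] at h
  exact ((U 0).injective h).symm

/-- The generator of a one-parameter unitary group is densely defined. -/
theorem IsUnitaryGroupGeneratedBy.dense_domain [CompleteSpace H]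
    (hU : IsUnitaryGroupGeneratedBy U D) : Dense (D.domain : Set H) := by
  intro ξ
  -- Averaging the orbit gives smooth vectors: `U t (F s) = F (s + t) - F t` is differentiable in
  -- `t`, so `F s` lies in the domain, while `s⁻¹ • F s` tends to `ξ`.
  let F : ℝ → H := fun s => ∫ r in (0 : ℝ)..s, U r ξ
  have hF : ∀ s, HasDerivAt F (U s ξ) s := fun s =>
    ((hU.continuous ξ).integral_hasStrictDerivAt 0 s).hasDerivAt
  have hmem : ∀ s, F s ∈ D.domain := by
    intro s
    have hU' : ∀ t, U t (F s) = F (s + t) - F t := by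
      intro t
      have h1 : U t (F s) = ∫ r in (0 : ℝ)..s, U t (U r ξ) :=
        ((U t).toContinuousLinearEquiv.toContinuousLinearMap.intervalIntegral_comp_comm
          ((hU.continuous ξ).intervalIntegrable 0 s)).symm
      rw [h1]
      simp_rw [← hU.map_add]
      rw [intervalIntegral.integral_comp_add_left (fun r => U r ξ) t, add_zero, add_comm t s]
      exact (intervalIntegral.integral_interval_sub_left
        ((hU.continuous ξ).intervalIntegrable _ _) ((hU.continuous ξ).intervalIntegrable _ _)).symm
    have hd : HasDerivAt (fun t => U t (F s)) (U s ξ - ξ) 0 := by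
      simp_rw [hU']
      have h1 : HasDerivAt (fun t => F (s + t)) (U s ξ) 0 :=
        HasDerivAt.comp_const_add s 0 (by simpa using hF s)
      have h2 : HasDerivAt F ξ 0 := by simpa [hU.map_zero] using hF 0
      exact h1.sub h2
    have hg : (F s, -Complex.I • (U s ξ - ξ)) ∈ D.graph := by
      rw [hU.generator, smul_smul]
      simpa using hd
    exact LinearPMap.mem_domain_of_mem_graph hg
  have hlim : Tendsto (fun s : ℝ => (s⁻¹ : ℝ) • F s) (𝓝[≠] 0) (𝓝 ξ) := by
    have := hasDerivAt_iff_tendsto_slope_zero.1 (hF 0)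
    simpa [hU.map_zero, F] using this
  refine mem_closure_of_tendsto hlim (Eventually.of_forall fun s => ?_)
  have : ((s⁻¹ : ℝ) • F s) = ((s⁻¹ : ℝ) : ℂ) • F s := rfl
  rw [this]
  exact D.domain.smul_mem _ (hmem s)

/-- If conjugation by `e^{itD}` multiplies `T` by `e^{itμ}`, then `D T = T (D + μ)`. -/
theorem IsUnitaryGroupGeneratedBy.apply_mem_graph (hU : IsUnitaryGroupGeneratedBy U D)
    {T : H →L[ℂ] H} {μ : ℝ}
    (hT : ∀ t ξ, Complex.exp ((t * μ : ℝ) * Complex.I) • T ξ = U t (T (U (-t) ξ))) {ξ η : H}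
    (h : (ξ, η) ∈ D.graph) : (T ξ, (μ : ℂ) • T ξ + T η) ∈ D.graph := by
  -- The hypothesis on `T` amounts to `U t T = e^{itμ} T U t`. The product rule at `t = 0` then
  -- gives the new generator value.
  rw [hU.generator] at h ⊢
  have e : ∀ t, U t (T ξ) = Complex.exp ((t * μ : ℝ) * Complex.I) • T (U t ξ) := by
    intro t
    rw [hT, ← hU.map_add, neg_add_cancel, hU.map_zero]
  simp_rw [e]
  have h1 : HasDerivAt (fun t => T (U t ξ)) (T (Complex.I • η)) 0 :=
    ((T.restrictScalars ℝ).hasFDerivAt).comp_hasDerivAt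
        (0 : ℝ) h
  have h2 := (hasDerivAt_exp_ofReal_mul_I μ).smul h1
  have e2 : Complex.I • ((μ : ℂ) • T ξ + T η) = Complex.exp ((0 * μ : ℝ) * Complex.I) •
      T (Complex.I • η) + (μ * Complex.I) • T (U 0 ξ) := by
    rw [hU.map_zero, map_smul, smul_add, smul_smul, mul_comm, add_comm]
    simp
  rw [e2]
  exact h2

/-- The lower bound is tested on `T ξ`, where `⟨T ξ, D T ξ⟩ = μ ‖T ξ‖² + ⟨T ξ, T η⟩`; the last term
is at most `‖ξ‖ ‖η‖` because `T` is a contraction. -/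
theorem IsUnitaryGroupGeneratedBy.le_of_isBoundedBelow (hU : IsUnitaryGroupGeneratedBy U D)
    {c : ℝ} (hc : ∀ ξ : D.domain, c * ‖(ξ : H)‖ ^ 2 ≤ (inner ℂ (ξ : H) (D ξ)).re)
    {T : H →L[ℂ] H} (hT1 : ∀ ζ, ‖T ζ‖ ≤ ‖ζ‖) {μ : ℝ}
    (hT : ∀ t ξ, Complex.exp ((t * μ : ℝ) * Complex.I) • T ξ = U t (T (U (-t) ξ))) {ξ η : H}
    (h : (ξ, η) ∈ D.graph) : (c - μ) * ‖T ξ‖ ^ 2 ≤ ‖ξ‖ * ‖η‖ := by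
  obtain ⟨z, hz, hDz⟩ := (LinearPMap.mem_graph_iff _).1 (hU.apply_mem_graph hT h)
  have hb := hc z
  simp only at hz hDz
  rw [hDz, hz, inner_add_right, inner_smul_right, Complex.add_re, inner_self_eq_norm_sq_to_K] at hb
  have h1 : ((μ : ℂ) * ((‖T ξ‖ : ℝ) : ℂ) ^ 2).re = μ * ‖T ξ‖ ^ 2 := by
    norm_cast
  have h2 : (inner ℂ (T ξ) (T η)).re ≤ ‖ξ‖ * ‖η‖ :=
    (Complex.re_le_norm _).trans ((norm_inner_le_norm _ _).trans
      (mul_le_mul (hT1 _) (hT1 _) (norm_nonneg _) (norm_nonneg _)))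
  have h3 : c * ‖T ξ‖ ^ 2 ≤ μ * ‖T ξ‖ ^ 2 + (inner ℂ (T ξ) (T η)).re := by
    rw [← h1]; exact hb
  linarith

end Generator

/-! ### Positive energy bounds the energies from below -/

section PositiveEnergy

variable {K : Type*} [Field K] [IsGlobalField K] {v : Place K}

theorem Fiber.ext_k {y : unitSpace v} {γ γ' : Fiber y} (h : γ.1.k = γ'.1.k) : γ = γ' :=
  Subtype.ext (ValuationGroupoid.ext h
    ((congrArg Subtype.val γ.2).trans (congrArg Subtype.val γ'.2).symm))

/-- The unit of the groupoid at `y`. -/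
def Fiber.one (y : unitSpace v) : Fiber y :=
  ⟨⟨1, y.1, y.2, by rw [one_smul]; exact y.2⟩, rfl⟩

theorem Fiber.div_one {y : unitSpace v} (γ : Fiber y) : γ.div (Fiber.one y) = γ.1 := by
  refine ValuationGroupoid.ext ?_ ?_
  · change γ.1.k * (1 : Kˣ)⁻¹ = γ.1.k
    rw [inv_one, mul_one]
  · change (1 : Kˣ) • y.1 = γ.1.x
    rw [one_smul]
    exact (congrArg Subtype.val γ.2).symm

theorem regularRep_apply (y : unitSpace v)
    (f : CompactlySupportedContinuousMap (ValuationGroupoid v) ℂ)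
    (ξ : lp (fun _ : Fiber y => ℂ) 2) (γ : Fiber y) :
    regularRep y f ξ γ = ∑' γ₂ : Fiber y, f (γ.div γ₂) * ξ γ₂ := rfl

variable {y : unitSpace v} {f : CompactlySupportedContinuousMap (ValuationGroupoid v) ℂ}

/-- An element of the fiber is determined by its `K^*`-coordinate. A function living over a single
`k` therefore gives a matrix with at most one nonzero entry in each row and column, and Schur's test
holds with constant `1`. -/
theorem norm_regularRep_apply_le {k : Kˣ} (hf : ∀ γ, ‖f γ‖ ≤ 1) (hk : ∀ γ, f γ ≠ 0 → γ.k = k)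
    (ξ : lp (fun _ : Fiber y => ℂ) 2) : ‖regularRep y f ξ‖ ≤ ‖ξ‖ := by
  classical
  have bound : ∀ (e : Fiber y → ValuationGroupoid v), (Function.Injective fun γ => (e γ).k) →
      ∀ s : Finset (Fiber y), ∑ γ ∈ s, ‖f (e γ)‖ ≤ 1 := by
    intro e he s
    rw [← Finset.sum_filter_add_sum_filter_not s fun γ => f (e γ) ≠ 0]
    have h0 : ∑ γ ∈ s with ¬ f (e γ) ≠ 0, ‖f (e γ)‖ = 0 :=
      Finset.sum_eq_zero fun γ hγ => by simpa using (Finset.mem_filter.1 hγ).2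
    rw [h0, add_zero]
    have h1 : (s.filter fun γ => f (e γ) ≠ 0).card ≤ 1 := by
      refine Finset.card_le_one.2 fun a ha b hb => he ?_
      exact (hk _ (Finset.mem_filter.1 ha).2).trans (hk _ (Finset.mem_filter.1 hb).2).symm
    calc _ ≤ ∑ γ ∈ s with f (e γ) ≠ 0, (1 : ℝ) := Finset.sum_le_sum fun γ _ => hf _
      _ = ((s.filter fun γ => f (e γ) ≠ 0).card : ℝ) := by simp
      _ ≤ 1 := by exact_mod_cast h1
  obtain ⟨M, -, -, hfin⟩ := exists_schur_bound y f
  refine lp.norm_le_of_forall_sum_le (by simp) (norm_nonneg _) fun s => ?_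
  have h := schur_bound (a := fun γ γ₂ : Fiber y => f (γ.div γ₂)) (M := 1)
    (fun γ => bound _ fun γ₂ γ₂' h => Fiber.ext_k (inv_injective (mul_left_cancel h)))
    (fun γ₂ => bound _ fun γ γ' h => Fiber.ext_k (mul_right_cancel h)) hfin ξ s
  rw [one_mul] at h
  simpa [regularRep_apply] using h

theorem regularRep_apply_of_support {γ₀ : Fiber y} (h1 : f γ₀.1 = 1)
    (hk : ∀ γ, f γ ≠ 0 → γ.k = γ₀.1.k) (ξ : lp (fun _ : Fiber y => ℂ) 2) :
    regularRep y f ξ γ₀ = ξ (Fiber.one y) := by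
  rw [regularRep_apply, tsum_eq_single (Fiber.one y), Fiber.div_one, h1, one_mul]
  intro γ₂ hγ₂
  rw [mul_eq_zero]
  left
  by_contra h
  apply hγ₂
  refine Fiber.ext_k ?_
  have : γ₀.1.k * γ₂.1.k⁻¹ = γ₀.1.k := hk _ h
  rw [mul_eq_left, inv_eq_one] at this
  exact this

theorem regularRep_timeEvolution {k : Kˣ} (hk : ∀ γ, f γ ≠ 0 → γ.k = k) (t : ℝ)
    (ξ : lp (fun _ : Fiber y => ℂ) 2) :
    regularRep y (timeEvolution v t f) ξ =
      Complex.exp ((t * Real.log (v.absValue k) : ℝ) * Complex.I) • regularRep y f ξ := by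
  ext γ
  rw [lp.coeFn_smul, Pi.smul_apply, regularRep_apply, regularRep_apply, smul_eq_mul,
    ← tsum_mul_left]
  refine tsum_congr fun γ₂ => ?_
  change ((v.absValue (γ.div γ₂).k : ℝ) : ℂ) ^ (Complex.I * t) * f (γ.div γ₂) * ξ γ₂ = _
  by_cases h : f (γ.div γ₂) = 0
  · simp [h]
  · rw [hk _ h, v.cpow_absValue, mul_assoc]

/-- A point mass need not lie in the domain of an unknown generator, but density provides a domain
vector within `1 / 2` of it. -/
theorem IsUnitaryGroupGeneratedBy.exists_mem_graph_half_le {I : Type*}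
    {U : ℝ → lp (fun _ : I => ℂ) 2 ≃ₗᵢ[ℂ] lp (fun _ : I => ℂ) 2}
    {D : lp (fun _ : I => ℂ) 2 →ₗ.[ℂ] lp (fun _ : I => ℂ) 2}
    (hU : IsUnitaryGroupGeneratedBy U D) (i : I) :
    ∃ ξ η, (ξ, η) ∈ D.graph ∧ 1 / 2 ≤ ‖ξ i‖ := by
  classical
  let δ : lp (fun _ : I => ℂ) 2 := lp.single 2 i (1 : ℂ)
  have hδ : δ i = 1 := lp.single_apply_self (E := fun _ : I => ℂ) 2 i 1
  obtain ⟨ξ, hξ, hdist⟩ := hU.dense_domain.exists_dist_lt δ (ε := 1 / 2) (by norm_num)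
  refine ⟨ξ, D ⟨ξ, hξ⟩, (LinearPMap.mem_graph_iff _).2 ⟨⟨ξ, hξ⟩, rfl, rfl⟩, ?_⟩
  rw [dist_eq_norm] at hdist
  have h1 : ‖δ i - ξ i‖ ≤ 1 / 2 :=
    (lp.norm_apply_le_norm two_ne_zero (δ - ξ) i).trans hdist.le
  rw [hδ] at h1
  have h2 := norm_sub_norm_le (1 : ℂ) (ξ i)
  rw [norm_one] at h2
  linarith

/-- If the time evolution is implemented by a Hamiltonian that is bounded below, then the values
`log |k|_v` are bounded below on `𝒢(v)_y`, as soon as `𝒢(v)` has enough bump functions. -/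
theorem exists_le_energy_of_isPositiveEnergy
    (hbump : ∀ γ₀ : Fiber y, ∃ f : CompactlySupportedContinuousMap (ValuationGroupoid v) ℂ,
      f γ₀.1 = 1 ∧ (∀ γ, ‖f γ‖ ≤ 1) ∧ ∀ γ, f γ ≠ 0 → γ.k = γ₀.1.k)
    (hpos : IsPositiveEnergy (regularRep y) (timeEvolution v)) :
    ∃ c : ℝ, ∀ γ, c ≤ energy y γ := by
  obtain ⟨D, ⟨U, hU, himp⟩, c, hc⟩ := hpos
  obtain ⟨ξ, η, hgraph, ha⟩ := hU.exists_mem_graph_half_le (Fiber.one y)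
  -- The vectors `ξ` and `η` are fixed before `γ₀`, so the bound is uniform. The factor `4` comes
  -- from `‖T ξ‖² ≥ 1 / 4`.
  refine ⟨c - 4 * (‖ξ‖ * ‖η‖), fun γ₀ => ?_⟩
  obtain ⟨f, hf1, hf, hk⟩ := hbump γ₀
  have h := hU.le_of_isBoundedBelow hc (T := regularRep y f) (norm_regularRep_apply_le hf hk)
    (μ := energy y γ₀) (fun t ζ => by
      rw [← himp]
      exact (regularRep_timeEvolution hk t ζ).symm) hgraph
  have hT : 1 / 2 ≤ ‖regularRep y f ξ‖ := by
    refine ha.trans ?_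
    rw [← regularRep_apply_of_support hf1 hk ξ]
    exact lp.norm_apply_le_norm two_ne_zero (regularRep y f ξ) γ₀
  by_contra! hlt
  have hprod : 0 ≤ ‖ξ‖ * ‖η‖ := by positivity
  have hT2 : 1 / 4 ≤ ‖regularRep y f ξ‖ ^ 2 := by nlinarith
  nlinarith

end PositiveEnergy

/-! ### Local compactness of the completions -/

namespace ValuationSubring

variable {K : Type*} [Field K] (A : ValuationSubring K)

/-- The embedding of `K` in its completion at a valuation ring. -/
noncomputable def toCompletion : K →+* A.valuation.Completion :=
  UniformSpace.Completion.coeRingHom.comp (WithVal.equiv A.valuation).symm.toRingHom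

theorem v_toCompletion (x : K) : Valued.v (A.toCompletion x) = A.valuation x :=
  Valued.valuedCompletion_apply _

theorem exists_valuation_eq (x : A.valuation.Completion) : ∃ b : K, Valued.v x = A.valuation b := by
  obtain ⟨r, hr⟩ := Valued.exists_coe_eq_v (K := WithVal A.valuation) x
  exact ⟨WithVal.equiv A.valuation r, hr⟩

theorem denseRange_toCompletion : DenseRange A.toCompletion :=
  UniformSpace.Completion.denseRange_coe.comp (WithVal.equiv A.valuation).symm.surjective.denseRange
    (UniformSpace.Completion.continuous_coe _)

variable {A}

/-- The completion has the same values as `K`, so a basic neighbourhood is cut out by a strict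
inequality against some `b` in `K`. A nonzero nonunit supplies an element of `A` strictly below `b`.
Having `u` in `A` makes the finiteness of `A / u A` available. -/
theorem exists_ball_subset_of_mem_nhds_zero (hA : A ≠ ⊤) {s : Set A.valuation.Completion}
    (hs : s ∈ 𝓝 0) : ∃ u : A, u ≠ 0 ∧ {x | Valued.v x ≤ A.valuation u} ⊆ s := by
  obtain ⟨γ, hγ⟩ := Valued.mem_nhds_zero.1 hs
  obtain ⟨z, hz⟩ := MonoidWithZeroHom.ValueGroup₀.restrict₀_surjective
    (.ofClass (Valued.v : Valuation A.valuation.Completion A.ValueGroup)) γ.1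
  obtain ⟨b, hb⟩ := A.exists_valuation_eq z
  have hz0 : z ≠ 0 := by
    rintro rfl
    rw [map_zero] at hz
    exact γ.ne_zero hz.symm
  have hb0 : b ≠ 0 := by
    rintro rfl
    rw [map_zero] at hb
    exact hz0 ((Valuation.zero_iff _).1 hb)
  obtain ⟨π, hπ, hπ0⟩ := exists_ne_zero_mem_nonunits hA
  have key : ∃ u : A, u ≠ 0 ∧ A.valuation u < A.valuation b := by
    have hπ' : A.valuation π < 1 := (mem_nonunits_iff A).1 hπ
    by_cases hbA : b ∈ A
    · refine ⟨⟨b * π, A.mul_mem _ _ hbA (nonunits_subset hπ)⟩, ?_, ?_⟩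
      · exact fun h => mul_ne_zero hb0 hπ0 (congrArg Subtype.val h)
      · rw [map_mul]
        exact mul_lt_of_lt_one_right (zero_lt_iff.2 (by simpa using hb0)) hπ'
    · refine ⟨⟨π, nonunits_subset hπ⟩, fun h => hπ0 (congrArg Subtype.val h), hπ'.trans ?_⟩
      rw [← not_le, valuation_le_one_iff]
      exact hbA
  obtain ⟨u, hu, hub⟩ := key
  refine ⟨u, hu, fun x hx => hγ ?_⟩
  rw [Set.mem_ofPred_eq, ← hz, ← Valuation.restrict_def, Valuation.restrict_lt_iff, hb]
  exact lt_of_le_of_lt hx hub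

/-- The integers are closed in a complete field, hence complete. They are totally bounded because
`K` is dense and the finitely many classes of `A` modulo `u` form a net of radius `|u|`. -/
theorem isCompact_integer [IsGlobalField K] (hA : A ≠ ⊤) :
    IsCompact {x : A.valuation.Completion | Valued.v x ≤ 1} := by
  rw [isCompact_iff_totallyBounded_isComplete]
  refine ⟨?_, (Valued.isClosed_integer A.valuation.Completion).isComplete⟩
  rw [totallyBounded_iff_subset_finite_iUnion_nhds_zero]
  intro U hU
  obtain ⟨u, hu, huU⟩ := exists_ball_subset_of_mem_nhds_zero hA hU
  have := A.finite_quotient hu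
  let φ : A ⧸ Ideal.span {u} → A.valuation.Completion :=
    fun q => A.toCompletion (Quotient.out q : A)
  refine ⟨Set.range φ, Set.finite_range φ, fun x hx => ?_⟩
  have hx : Valued.v x ≤ 1 := hx
  have hnhds : {z : A.valuation.Completion | Valued.v (x - z) ≤ A.valuation u} ∈ 𝓝 x := by
    have hball : {z : A.valuation.Completion | Valued.v z ≤ A.valuation u} ∈ 𝓝 0 := by
      rw [Valued.mem_nhds_zero]
      have hu0 : Valued.v (A.toCompletion u) ≠ 0 := by
        rw [v_toCompletion]
        simpa using hu
      refine ⟨Units.mk0 (Valued.v.restrict (A.toCompletion u)) ?_, fun z hz => ?_⟩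
      · rwa [Ne, Valuation.restrict_eq_zero_iff]
      · rw [Set.mem_ofPred_eq, Units.val_mk0, Valuation.restrict_lt_iff, v_toCompletion] at hz
        exact hz.le
    have hc : Tendsto (fun z => x - z) (𝓝 x) (𝓝 0) :=
      (Continuous.tendsto' (by fun_prop) x 0 (sub_self x))
    exact hc hball
  obtain ⟨a, ha⟩ := A.denseRange_toCompletion.mem_nhds hnhds
  have ha : Valued.v (x - A.toCompletion a) ≤ A.valuation u := ha
  have haA : a ∈ A := by
    rw [← valuation_le_one_iff, ← v_toCompletion]
    have h1 : A.toCompletion a = x - (x - A.toCompletion a) := by ring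
    rw [h1]
    exact (Valuation.map_sub _ _ _).trans (max_le hx (ha.trans (A.valuation_le_one u)))
  let q : A ⧸ Ideal.span {u} := Ideal.Quotient.mk _ ⟨a, haA⟩
  refine Set.mem_iUnion₂.2 ⟨φ q, ⟨q, rfl⟩, ?_⟩
  rw [Set.mem_vadd_set_iff_neg_vadd_mem, vadd_eq_add, neg_add_eq_sub]
  refine huU ?_
  have hq : (⟨a, haA⟩ : A) - Quotient.out q ∈ Ideal.span {u} := by
    rw [← Ideal.Quotient.eq]
    exact (Quotient.out_eq q).symm
  obtain ⟨r, hr⟩ := Ideal.mem_span_singleton'.1 hq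
  have h2 : Valued.v (A.toCompletion a - φ q) ≤ A.valuation u := by
    change Valued.v (A.toCompletion a - A.toCompletion (Quotient.out q : A)) ≤ _
    rw [← map_sub, v_toCompletion]
    have : a - (Quotient.out q : A) = (r : K) * u := (congrArg Subtype.val hr).symm
    rw [this, map_mul]
    exact mul_le_of_le_one_left' (A.valuation_le_one r)
  have h3 : x - φ q = (x - A.toCompletion a) + (A.toCompletion a - φ q) := by ring
  rw [Set.mem_ofPred_eq, h3]
  exact (Valuation.map_add _ _ _).trans (max_le ha h2)

end ValuationSubring

namespace Place

variable {K : Type*} [Field K]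

instance : (w : Place K) → IsTopologicalRing w.Completion
  | infinite v => inferInstanceAs (IsTopologicalRing v.Completion)
  | finite A _ => inferInstanceAs (IsTopologicalRing A.valuation.Completion)

instance : (w : Place K) → T2Space w.Completion
  | infinite v => inferInstanceAs (T2Space v.Completion)
  | finite A _ => inferInstanceAs (T2Space A.valuation.Completion)

theorem isOpen_integers : (w : Place K) → IsOpen (w.integers : Set w.Completion)
  | infinite _ => isOpen_univ
  | finite A _ => Valued.isOpen_integer A.valuation.Completion

theorem interior_closedUnitBall_finite (A : ValuationSubring K) (hA : A ≠ ⊤) :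
    interior (finite A hA).closedUnitBall = (finite A hA).integers :=
  (Valued.isOpen_integer A.valuation.Completion).interior_eq

variable [IsGlobalField K]

instance : (w : Place K) → LocallyCompactSpace w.Completion
  | infinite v => inferInstanceAs (LocallyCompactSpace v.Completion)
  | finite A hA => by
    have h := ValuationSubring.isCompact_integer hA
    exact IsCompact.locallyCompactSpace_of_mem_nhds_of_addGroup (G := A.valuation.Completion) h
      ((Valued.isOpen_integer A.valuation.Completion).mem_nhds (zero_mem (Valued.v.integer)))

variable (K) in
theorem finite_infinitePlace : Finite (NumberField.InfinitePlace K) := by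
  rcases IsGlobalField.numberField_or_functionField (K := K) with h | ⟨p, hp, _, _⟩
  · infer_instance
  · have : CharP (RatFunc (ZMod p)) p :=
      charP_of_injective_algebraMap (algebraMap (ZMod p) (RatFunc (ZMod p))).injective p
    have : CharP K p := charP_of_injective_algebraMap (algebraMap (RatFunc (ZMod p)) K).injective p
    have : IsEmpty (NumberField.InfinitePlace K) := by
      refine ⟨fun w => ?_⟩
      have : CharP ℂ p := charP_of_injective_ringHom w.embedding.injective p
      exact hp.out.ne_zero (CharP.eq ℂ this (CharP.ofCharZero ℂ))
    infer_instance

variable (K) in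
theorem eventually_exists_finite :
    ∀ᶠ w : Place K in cofinite, ∃ A hA, w = finite A hA := by
  have := finite_infinitePlace K
  refine (Set.finite_range (infinite (K := K))).subset fun w hw => ?_
  rcases w with w | ⟨A, hA⟩
  · exact ⟨w, rfl⟩
  · exact absurd ⟨A, hA, rfl⟩ hw

end Place

/-- The condition is an intersection of integrality conditions at almost all places, open in the
restricted product, with finitely many open conditions on single coordinates. -/
theorem AdeleRing.isOpen_forall_mem {K : Type*} [Field K]
    {U : (w : Place K) → Set w.Completion}
    (hU : ∀ w, IsOpen (U w)) (hUint : ∀ᶠ w in cofinite, U w = w.integers) :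
    IsOpen {a : AdeleRing K | ∀ w, a w ∈ U w} := by
  have h1 := RestrictedProduct.isOpen_forall_imp_mem (Place.isOpen_integers (K := K))
    (p := fun w => U w = w.integers)
  have hfin : {w : Place K | ¬ U w = w.integers}.Finite := hUint
  have h2 : IsOpen (⋂ w ∈ {w : Place K | ¬ U w = w.integers}, {a : AdeleRing K | a w ∈ U w}) :=
    hfin.isOpen_biInter fun w _ => (hU w).preimage (RestrictedProduct.continuous_eval w)
  convert! h1.inter h2 using 1
  ext a
  simp only [Set.mem_inter_iff, Set.mem_ofPred_eq, Set.mem_iInter]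
  refine ⟨fun h => ⟨fun w hw => hw ▸ h w, fun w _ => h w⟩, fun h w => ?_⟩
  by_cases hw : U w = w.integers
  · rw [hw]
    exact h.1 w hw
  · exact h.2 w hw

/-! ### Adeles and bump functions on the groupoid -/

section AdeleRing

variable {K : Type*} [Field K] [IsGlobalField K]

theorem AdeleRing.smul_apply (k : Kˣ) (a : AdeleRing K) (w : Place K) :
    (k • a) w = w.embedding k * a w := rfl

instance : T2Space (AdeleRing K) :=
  T2Space.of_injective_continuous (f := fun (a : AdeleRing K) (w : Place K) => a w)
    DFunLike.coe_injective RestrictedProduct.continuous_coe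

instance : LocallyCompactSpace (AdeleRing K) := by
  have : WeaklyLocallyCompactSpace (AdeleRing K) := by
    refine RestrictedProduct.weaklyLocallyCompactSpace_of_cofinite Place.isOpen_integers ?_
    filter_upwards [Place.eventually_exists_finite K] with w hw
    obtain ⟨A, hA, rfl⟩ := hw
    exact ValuationSubring.isCompact_integer hA
  infer_instance

/-- At almost every place `k` is integral and the interior of the unit ball is the ring of integers,
so the condition on `k a` follows from the one on `a`. Together with `a_v = 0`, this open set
describes the sources of the groupoid elements over `k`. -/
theorem isOpen_forall_mem_interior (k : Kˣ) :
    IsOpen {a : AdeleRing K | ∀ w, a w ∈ interior w.closedUnitBall ∧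
      w.embedding (k : K) * a w ∈ interior w.closedUnitBall} := by
  refine AdeleRing.isOpen_forall_mem (U := fun w => {z | z ∈ interior w.closedUnitBall ∧
    w.embedding (k : K) * z ∈ interior w.closedUnitBall}) (fun w => ?_) ?_
  · exact isOpen_interior.inter (isOpen_interior.preimage (continuous_const.mul continuous_id))
  · filter_upwards [Place.eventually_exists_finite K,
      Place.eventually_embedding_mem_integers (k : K)] with w hw hk
    obtain ⟨A, hA, rfl⟩ := hw
    simp only [Place.interior_closedUnitBall_finite]
    ext z
    exact ⟨fun h => h.1, fun h => ⟨h, mul_mem hk h⟩⟩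

/-- The groupoid `𝒢(v)` has enough compactly supported functions. -/
theorem ValuationGroupoid.exists_bump {v : Place K} (γ₀ : ValuationGroupoid v) :
    ∃ f : CompactlySupportedContinuousMap (ValuationGroupoid v) ℂ,
      f γ₀ = 1 ∧ (∀ γ, ‖f γ‖ ≤ 1) ∧ ∀ γ, f γ ≠ 0 → γ.k = γ₀.k := by
  classical
  let : TopologicalSpace Kˣ := ⊥
  have : DiscreteTopology Kˣ := ⟨rfl⟩
  obtain ⟨φ, hφ1, hφc, hφs, hφ⟩ := exists_continuousMap_one_of_isCompact_subset_isOpen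
    (isCompact_singleton (x := γ₀.x)) (isOpen_forall_mem_interior γ₀.k)
    (by
      rintro _ rfl w
      exact ⟨γ₀.source_mem.2 w, γ₀.range_mem.2 w⟩)
  have hind : IsInducing fun γ : ValuationGroupoid v => (γ.k, γ.x) := ⟨rfl⟩
  have hx : Continuous fun γ : ValuationGroupoid v => γ.x := continuous_snd.comp hind.continuous
  let g : ValuationGroupoid v → ℂ := fun γ => (if γ.k = γ₀.k then 1 else 0) * (φ γ.x : ℂ)
  have hg : Continuous g := (continuous_of_k fun k => if k = γ₀.k then (1 : ℂ) else 0).mul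
    (Complex.continuous_ofReal.comp (φ.continuous.comp hx))
  have hsupp : ∀ γ, g γ ≠ 0 → γ.k = γ₀.k := by
    intro γ h
    by_contra hne
    exact h (by simp [g, hne])
  let C : Set (ValuationGroupoid v) := {γ | γ.k = γ₀.k ∧ γ.x ∈ tsupport φ}
  -- The support of `φ` lies in the open set of the previous lemma, so each of its points with `a_v
  -- = 0` is a source for `k`. Nothing is lost in passing to the groupoid, and `C` corresponds to a
  -- closed subset of a compact set.
  have hC : IsCompact C := by
    rw [hind.isCompact_iff]
    have himg : (fun γ : ValuationGroupoid v => (γ.k, γ.x)) '' C =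
        {γ₀.k} ×ˢ (tsupport φ ∩ {a : AdeleRing K | a v = 0}) := by
      ext ⟨k, a⟩
      constructor
      · rintro ⟨γ, ⟨h1, h2⟩, he⟩
        obtain ⟨rfl, rfl⟩ := Prod.mk.inj he
        exact ⟨h1, h2, γ.source_mem.1⟩
      · rintro ⟨h1, h2, h3⟩
        have h1 : k = γ₀.k := h1
        have h3 : a v = 0 := h3
        subst h1
        have hV := hφs h2
        refine ⟨⟨γ₀.k, a, ⟨h3, fun w => (hV w).1⟩, ?_, fun w => (hV w).2⟩, ⟨rfl, h2⟩, rfl⟩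
        rw [AdeleRing.smul_apply, h3, mul_zero]
    rw [himg]
    refine isCompact_singleton.prod (hφc.inter_right ?_)
    exact isClosed_singleton.preimage (RestrictedProduct.continuous_eval v)
  refine ⟨⟨⟨g, hg⟩, HasCompactSupport.intro' hC ?_ ?_⟩, ?_, ?_, hsupp⟩
  · have hkclosed : IsClosed {γ : ValuationGroupoid v | γ.k = γ₀.k} :=
      isClosed_singleton.preimage (continuous_of_k fun k => k)
    exact hkclosed.inter ((isClosed_tsupport φ).preimage hx)
  · intro γ hγ
    by_contra hne
    refine hγ ⟨hsupp γ hne, subset_tsupport _ fun h0 => hne ?_⟩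
    change _ * (φ γ.x : ℂ) = 0
    rw [h0]
    simp
  · change (if γ₀.k = γ₀.k then (1 : ℂ) else 0) * (φ γ₀.x : ℂ) = 1
    rw [hφ1 rfl]
    simp
  · intro γ
    change ‖(if γ.k = γ₀.k then (1 : ℂ) else 0) * (φ γ.x : ℂ)‖ ≤ 1
    rw [norm_mul, Complex.norm_real, Real.norm_of_nonneg (hφ _).1]
    split_ifs
    · simpa using (hφ γ.x).2
    · simp

end AdeleRing

/-! ### Classical classes and finiteness of multipliers -/

section ClassicalOrbit

variable {K : Type*} [Field K] [IsGlobalField K]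

/-- The orbit `Ξ_{K,v}` consists of the classes of the adeles `y` with `y_v = 0` whose other
components are nonzero, and units at almost all places. -/
theorem adeleClass_mem_classicalOrbit_iff {v : Place K} {y : AdeleRing K} (hy : y v = 0) :
    adeleClass y ∈ classicalOrbit v ↔
      (∀ w, w ≠ v → y w ≠ 0) ∧ ∀ᶠ w in cofinite, w ≠ v → (y w)⁻¹ ∈ w.integers := by
  classical
  constructor
  · rintro ⟨c, hc⟩
    induction c using Quotient.inductionOn' with
    | h j =>
    have hc : adeleClass ((j : AdeleRing K) * basePoint v) = adeleClass y := hc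
    obtain ⟨k, hk⟩ := Quotient.exact hc.symm
    have hyw : ∀ w, w ≠ v → y w = w.embedding (k : K) * (j : AdeleRing K) w := by
      intro w hw
      rw [← hk]
      change w.embedding (k : K) * ((j : AdeleRing K) w * if w = v then 0 else 1) = _
      rw [if_neg hw, mul_one]
    have hjw : ∀ w, (j : AdeleRing K) w * (j⁻¹ : (AdeleRing K)ˣ).1 w = 1 := by
      intro w
      have := congrArg (fun a : AdeleRing K => a w) j.mul_inv
      exact this
    have hk0 : ∀ w : Place K, w.embedding (k : K) ≠ 0 := fun w => by
      simp
    refine ⟨fun w hw => ?_, ?_⟩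
    · rw [hyw w hw]
      exact mul_ne_zero (hk0 w) (left_ne_zero_of_mul_eq_one (hjw w))
    · filter_upwards [Place.eventually_embedding_mem_integers ((k : K)⁻¹),
        (j⁻¹ : (AdeleRing K)ˣ).1.2] with w hkw hjw' hw
      rw [hyw w hw, mul_inv, ← map_inv₀, inv_eq_of_mul_eq_one_right (hjw w)]
      exact mul_mem hkw hjw'
  · rintro ⟨h1, h2⟩
    -- Replacing the zero component at `v` by `1` makes `y` an idele, which sends the base point to
    -- `y`.
    let j : AdeleRing K := RestrictedProduct.mk (fun w => if w = v then 1 else y w) (by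
      filter_upwards [y.2] with w hw
      by_cases h : w = v
      · simp only [h, if_true]
        exact one_mem _
      · simp only [h, if_false]
        exact hw)
    let i : AdeleRing K := RestrictedProduct.mk (fun w => if w = v then 1 else (y w)⁻¹) (by
      filter_upwards [h2] with w hw
      by_cases h : w = v
      · simp only [h, if_true]
        exact one_mem _
      · simp only [h, if_false]
        exact hw h)
    have hji : j * i = 1 := by
      ext w
      change (if w = v then 1 else y w) * (if w = v then 1 else (y w)⁻¹) = 1
      by_cases h : w = v
      · simp [h]
      · simp [h, h1 w h]
    let u : (AdeleRing K)ˣ := ⟨j, i, hji, by rw [mul_comm, hji]⟩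
    refine ⟨(u : IdeleClassGroup K), ?_⟩
    change adeleClass (j * basePoint v) = adeleClass y
    congr 1
    ext w
    change (if w = v then 1 else y w) * (if w = v then 0 else 1) = y w
    by_cases h : w = v
    · subst h
      simp [hy]
    · simp [h]

/-- The integral closure of the prime ring is the intersection of the valuation rings containing it,
and every valuation ring contains it. The prime ring is a quotient of `ℤ`, so the monic equation
lifts. -/
theorem isIntegral_int_of_forall_mem {K : Type*} [Field K] {x : K}
    (hx : ∀ A : ValuationSubring K, A ≠ ⊤ → x ∈ A) : IsIntegral ℤ x := by
  have h := iInf_valuationSubring_superset (K := K) (s := ∅)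
  have hx' : x ∈ (integralClosure (Subring.closure (∅ : Set K)) K).toSubring := by
    rw [← h]
    simp only [Subring.mem_iInf]
    rintro ⟨A, -⟩
    by_cases hA : A = ⊤
    · subst hA
      exact Subring.mem_top x
    · exact hx A hA
  obtain ⟨q, hq, hq0⟩ := hx'
  have hsurj : Function.Surjective (Int.castRingHom (Subring.closure (∅ : Set K))) := by
    rintro ⟨z, hz⟩
    rw [Subring.closure_empty] at hz
    obtain ⟨n, rfl⟩ := Subring.mem_bot.1 hz
    exact ⟨n, Subtype.ext (by simp)⟩
  obtain ⟨q', hq', -, hmonic⟩ := Polynomial.lifts_and_natDegree_eq_and_monic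
    ((Polynomial.mem_lifts _).2 (Polynomial.map_surjective _ hsurj q)) hq
  refine ⟨q', hmonic, ?_⟩
  rw [← hq', Polynomial.eval₂_map] at hq0
  have e : algebraMap ℤ K = (algebraMap (Subring.closure (∅ : Set K)) K).comp
      (Int.castRingHom _) := RingHom.ext_int _ _
  rw [e]
  exact hq0

/-- An element integral over `𝔽_p` generates a finite ring, so two of its powers coincide, whereas
the powers of a nonzero nonunit have strictly decreasing valuations. -/
theorem eq_zero_of_isIntegral_of_mem_nonunits {K : Type*} [Field K] {p : ℕ} [Fact p.Prime]
    [CharP K p] {x : K} (hx : IsIntegral ℤ x) {A : ValuationSubring K} (hxA : x ∈ A.nonunits) :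
    x = 0 := by
  by_contra h0
  let : Algebra (ZMod p) K := ZMod.algebra K p
  have hint : IsIntegral (ZMod p) x := hx.tower_top
  have : Module.Finite (ZMod p) (Algebra.adjoin (ZMod p) {x}) :=
    Module.Finite.iff_fg.2 hint.fg_adjoin_singleton
  have : Finite (Algebra.adjoin (ZMod p) {x}) := Module.finite_of_finite (ZMod p)
  obtain ⟨i, j, hij, h⟩ := Finite.exists_ne_map_eq_of_infinite
    fun n : ℕ => (⟨x, Algebra.self_mem_adjoin_singleton _ x⟩ : Algebra.adjoin (ZMod p) {x}) ^ n
  wlog hlt : i < j generalizing i j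
  · exact this j i hij.symm h.symm (by lia)
  have h : x ^ i = x ^ j := congrArg Subtype.val h
  have hv : A.valuation x < 1 := (ValuationSubring.mem_nonunits_iff A).1 hxA
  have h2 := congrArg A.valuation h
  rw [map_pow, map_pow] at h2
  exact (pow_lt_pow_right_of_lt_one₀ (zero_lt_iff.2 (by simpa using h0)) hv hlt).ne' h2

/-- This is the discreteness of `K` in its adeles. In a number field, algebraic integers with
bounded conjugates are finite in number. In a function field, an everywhere integral element that is
a nonunit at one place is zero, which is why `S` must then be nonempty. -/
theorem finite_bounded_integral (S : Set (ValuationSubring K))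
    (hS : IsEmpty (NumberField.InfinitePlace K) → S.Nonempty)
    (B : NumberField.InfinitePlace K → ℝ) :
    {x : K | (∀ A : ValuationSubring K, A ≠ ⊤ → x ∈ A) ∧ (∀ A ∈ S, x ∈ A.nonunits) ∧
      ∀ w : NumberField.InfinitePlace K, w x ≤ B w}.Finite := by
  rcases IsGlobalField.numberField_or_functionField (K := K) with h | ⟨p, hp, _, _⟩
  · obtain ⟨C, hC⟩ := (Set.finite_range B).bddAbove
    refine (NumberField.Embeddings.finite_of_norm_le K ℂ C).subset ?_
    rintro x ⟨hx, -, hw⟩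
    refine ⟨isIntegral_int_of_forall_mem hx, fun φ => ?_⟩
    exact (hw (NumberField.InfinitePlace.mk φ)).trans (hC ⟨_, rfl⟩)
  · have : CharP (RatFunc (ZMod p)) p :=
      charP_of_injective_algebraMap (algebraMap (ZMod p) (RatFunc (ZMod p))).injective p
    have : CharP K p := charP_of_injective_algebraMap (algebraMap (RatFunc (ZMod p)) K).injective p
    obtain ⟨A, hA⟩ := hS ⟨fun w => by
      have : CharP ℂ p := charP_of_injective_ringHom w.embedding.injective p
      exact hp.out.ne_zero (CharP.eq ℂ this (CharP.ofCharZero ℂ))⟩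
    refine (Set.finite_singleton (0 : K)).subset ?_
    rintro x ⟨hx, hxS, -⟩
    exact eq_zero_of_isIntegral_of_mem_nonunits (isIntegral_int_of_forall_mem hx) (hxS A hA)

/-- The set of `k` with `|k|_v ≤ 1` that map `y` to the unit balls away from `v`. -/
def boundedMultipliers (v : Place K) (y : AdeleRing K) : Set K :=
  {k | v.absValue k ≤ 1 ∧ ∀ w, w ≠ v → w.embedding k * y w ∈ w.closedUnitBall}

/-- Away from `v`, some `b` in `K` has the same valuation as the component of `y`, so it bounds the
denominators of all multipliers. At `v` itself they are already integral. -/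
theorem exists_mul_mem_of_ne_zero {v : Place K} {y : AdeleRing K} (hy : y ∈ unitSpace v)
    (hy0 : ∀ w, w ≠ v → y w ≠ 0) (A : ValuationSubring K) (hA : A ≠ ⊤) :
    ∃ b : A, b ≠ 0 ∧ ∀ k ∈ boundedMultipliers v y, k * b ∈ A := by
  by_cases hv : Place.finite A hA = v
  · refine ⟨1, one_ne_zero, fun k hk => ?_⟩
    subst hv
    rw [OneMemClass.coe_one, mul_one]
    exact (Place.absValue_finite_le_one_iff hA).1 hk.1
  · let z : A.valuation.Completion := y (Place.finite A hA)
    obtain ⟨b, hb⟩ := A.exists_valuation_eq z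
    have hz : z ≠ 0 := hy0 _ hv
    have hz1 : Valued.v z ≤ 1 :=
      show y (Place.finite A hA) ∈ (Place.finite A hA).closedUnitBall from interior_subset (hy.2 _)
    have hbA : b ∈ A := by
      rw [← A.valuation_le_one_iff, ← hb]
      exact hz1
    refine ⟨⟨b, hbA⟩, fun h0 => ?_, fun k hk => ?_⟩
    · have : b = 0 := congrArg Subtype.val h0
      rw [this, map_zero, Valuation.zero_iff] at hb
      exact hz hb
    · have h1 : Valued.v (A.toCompletion k * z) ≤ 1 := hk.2 _ hv
      rw [map_mul, A.v_toCompletion, hb, ← map_mul, A.valuation_le_one_iff] at h1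
      exact h1

theorem mem_of_inv_mem_integers {K : Type*} [Field K] {v : Place K}
    {y : AdeleRing K} {A : ValuationSubring K}
    {hA : A ≠ ⊤} (hv : Place.finite A hA ≠ v) (hy0 : y (Place.finite A hA) ≠ 0)
    (hy : (y (Place.finite A hA))⁻¹ ∈ (Place.finite A hA).integers) {k : K}
    (hk : k ∈ boundedMultipliers v y) : k ∈ A := by
  let z : A.valuation.Completion := y (Place.finite A hA)
  have hz : z ≠ 0 := hy0
  have h1 : Valued.v (A.toCompletion k * z) ≤ 1 := hk.2 _ hv
  have h2 : Valued.v z⁻¹ ≤ 1 := hy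
  rw [← A.valuation_le_one_iff, ← A.v_toCompletion]
  have e : A.toCompletion k = A.toCompletion k * z * z⁻¹ := by field_simp
  rw [e, map_mul]
  exact mul_le_one' h1 h2

theorem NumberField.InfinitePlace.norm_algebraMap_completion {K : Type*} [Field K]
    (w : NumberField.InfinitePlace K) (k : K) : ‖algebraMap K w.Completion k‖ = w k :=
  NumberField.InfinitePlace.Completion.norm_coe w ((WithAbs.equiv w.1).symm k)

theorem exists_infinitePlace_bound {K : Type*} [Field K] {v : Place K} {y : AdeleRing K}
    (hy0 : ∀ w, w ≠ v → y w ≠ 0) (w : NumberField.InfinitePlace K) :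
    ∃ B : ℝ, ∀ k ∈ boundedMultipliers v y, w k ≤ B := by
  by_cases hv : Place.infinite w = v
  · subst hv
    refine ⟨1, fun k hk => ?_⟩
    have h : w k ^ w.mult ≤ 1 := hk.1
    exact (pow_le_one_iff_of_nonneg (apply_nonneg w k) w.mult_ne_zero).1 h
  · let z : w.Completion := y (Place.infinite w)
    have hz : z ≠ 0 := hy0 _ hv
    refine ⟨‖z‖⁻¹, fun k hk => ?_⟩
    have h1 : ‖algebraMap K w.Completion k * z‖ ≤ 1 := hk.2 _ hv
    rw [norm_mul, w.norm_algebraMap_completion] at h1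
    rwa [← one_div, le_div_iff₀ (norm_pos_iff.2 hz)]

/-- If the components of `y` outside `v` are nonzero, and units at almost all places, then there
are only finitely many `k` with `|k|_v ≤ 1` that map `y` to the unit balls away from `v`. -/
theorem finite_boundedMultipliers {v : Place K} {y : AdeleRing K} (hy : y ∈ unitSpace v)
    (hy0 : ∀ w, w ≠ v → y w ≠ 0) (hyu : ∀ᶠ w in cofinite, w ≠ v → (y w)⁻¹ ∈ w.integers) :
    (boundedMultipliers v y).Finite := by
  classical
  -- Outside `S` every multiplier is integral. Putting a nonarchimedean `v` in `S` ensures that `S`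
  -- is nonempty for function fields.
  let S : Set (ValuationSubring K) := {A | ∃ hA : A ≠ ⊤, Place.finite A hA = v ∨
    ¬ (Place.finite A hA ≠ v → (y (Place.finite A hA))⁻¹ ∈ (Place.finite A hA).integers)}
  have hSfin : S.Finite := by
    have h1 : {w : Place K | w = v ∨ ¬ (w ≠ v → (y w)⁻¹ ∈ w.integers)}.Finite :=
      (Set.finite_singleton v).union hyu
    refine (Set.Finite.preimage (f := fun A : {A : ValuationSubring K // A ≠ ⊤} =>
      Place.finite A.1 A.2) ?_ h1).image Subtype.val |>.subset ?_
    · rintro ⟨A, hA⟩ _ ⟨B, hB⟩ _ h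
      exact Subtype.ext (Place.finite.inj h)
    · rintro A ⟨hA, h⟩
      exact ⟨⟨A, hA⟩, h, rfl⟩
  have hSne : IsEmpty (NumberField.InfinitePlace K) → S.Nonempty := by
    intro hempty
    rcases v with w | ⟨A, hA⟩
    · exact hempty.elim w
    · exact ⟨A, hA, Or.inl rfl⟩
  have hS : ∀ A : ValuationSubring K, A ∉ S → A ≠ ⊤ → ∀ k ∈ boundedMultipliers v y, k ∈ A := by
    intro A hAS hA k hk
    have h : ¬ (Place.finite A hA = v ∨ ¬ (Place.finite A hA ≠ v →
      (y (Place.finite A hA))⁻¹ ∈ (Place.finite A hA).integers)) := fun h => hAS ⟨hA, h⟩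
    push Not at h
    exact mem_of_inv_mem_integers h.1 (hy0 _ h.1) (h.2 h.1) hk
  have hb : ∀ A : S, ∃ b : A.1, b ≠ 0 ∧ ∀ k ∈ boundedMultipliers v y, k * b ∈ A.1 := fun A =>
    exists_mul_mem_of_ne_zero hy hy0 A.1 A.2.choose
  choose b hb0 hb using hb
  have hc : ∀ A : S, ∃ c : A.1, (c : K) ∈ A.1.nonunits ∧ c ≠ 0 := by
    intro A
    obtain ⟨c, hc, hc0⟩ := ValuationSubring.exists_ne_zero_mem_nonunits A.2.choose
    exact ⟨⟨c, ValuationSubring.nonunits_subset hc⟩, hc, fun h => hc0 (congrArg Subtype.val h)⟩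
  choose c hc hc0 using hc
  choose B hB using exists_infinitePlace_bound hy0
  have : Finite S := hSfin
  have : ∀ A : S, Finite (A.1 ⧸ Ideal.span {b A * c A}) := fun A =>
    A.1.finite_quotient (mul_ne_zero (hb0 A) (hc0 A))
  -- There are finitely many colours. If `k` and `l` share one, then `(k - l) * b` lies in `b c A`,
  -- so `k - l` lies in `c A` and is a nonunit at every ring in `S`; `finite_bounded_integral` then
  -- controls each colour class.
  let colour : K → (A : S) → A.1 ⧸ Ideal.span {b A * c A} := fun k A =>
    if h : k * b A ∈ A.1 then Ideal.Quotient.mk _ ⟨k * b A, h⟩ else 0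
  refine Set.Finite.of_finite_fibers colour (Set.toFinite _) ?_
  rintro _ ⟨l, hl, rfl⟩
  refine ((finite_bounded_integral S hSne fun w => B w + B w).preimage
    (f := fun k => k - l) (sub_left_injective.injOn)).subset ?_
  rintro k ⟨hk, hkl⟩
  have hnon : ∀ A : S, k - l ∈ A.1.nonunits := by
    intro A
    have h := congrFun (Set.mem_singleton_iff.1 hkl) A
    simp only [colour, dif_pos (hb A k hk), dif_pos (hb A l hl)] at h
    rw [Ideal.Quotient.eq] at h
    obtain ⟨r, hr⟩ := Ideal.mem_span_singleton'.1 h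
    have hr' : (r : K) * (b A * c A) = k * b A - l * b A := congrArg Subtype.val hr
    have hbA : (b A : K) ≠ 0 := by simpa using hb0 A
    have e : k - l = c A * r := by
      apply mul_right_cancel₀ hbA
      rw [sub_mul, ← hr']
      ring
    rw [e, ValuationSubring.mem_nonunits_iff, map_mul]
    exact mul_lt_one_of_lt_of_le ((ValuationSubring.mem_nonunits_iff _).1 (hc A))
      (A.1.valuation_le_one r)
  refine ⟨fun A hA => ?_, fun A hA => hnon ⟨A, hA⟩, fun w => ?_⟩
  · by_cases hAS : A ∈ S
    · exact ValuationSubring.nonunits_subset (hnon ⟨A, hAS⟩)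
    · exact sub_mem (hS A hAS hA k hk) (hS A hAS hA l hl)
  · exact (map_sub_le_add w.1 k l).trans (add_le_add (hB w k hk) (hB w l hl))

theorem exists_le_energy_of_mem_classicalOrbit {v : Place K} (y : unitSpace v)
    (hy : adeleClass (y : AdeleRing K) ∈ classicalOrbit v) : ∃ c : ℝ, ∀ γ, c ≤ energy y γ := by
  obtain ⟨h1, h2⟩ := (adeleClass_mem_classicalOrbit_iff y.2.1).1 hy
  obtain ⟨c, hc⟩ := ((finite_boundedMultipliers y.2 h1 h2).image
    fun k => Real.log (v.absValue k)).bddBelow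
  -- Elements with `|k|_v ≥ 1` have nonnegative energy; the finitely many remaining `k` are bounded
  -- by `c`.
  refine ⟨min c 0, fun γ => ?_⟩
  have hx : γ.1.x = y.1 := congrArg Subtype.val γ.2
  rcases le_total (v.absValue (γ.1.k : K)) 1 with h | h
  · refine (min_le_left _ _).trans (hc ⟨(γ.1.k : K), ⟨h, fun w _ => ?_⟩, rfl⟩)
    have := interior_subset (γ.1.range_mem.2 w)
    rwa [hx] at this
  · exact (min_le_right _ _).trans (Real.log_nonneg h)

theorem inv_algebraMap_mem_of_notMem {S K : Type*} [CommRing S] [Field K] [Algebra S K]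
    {A : ValuationSubring K} {P : Ideal S}
    (hP : ∀ r : S, algebraMap S K r ∈ A.nonunits ↔ r ∈ P) {r : S} (hr : r ∉ P) :
    (algebraMap S K r)⁻¹ ∈ A := by
  by_contra h
  apply hr
  have h2 := (ValuationSubring.inv_mem_nonunits_iff (A := A)
    (x := (algebraMap S K r)⁻¹)).2 (Or.inr h)
  rw [inv_inv] at h2
  exact (hP r).1 h2

end ClassicalOrbit

/-! ### Products of primes in a Dedekind domain -/

section Dedekind

variable {S : Type*} [CommRing S] [IsDedekindDomain S]

/-- Nonzero ideals cancel in a Dedekind domain, so `I * P` is strictly smaller than `I` and has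
index at least `2` in it. -/
theorem two_mul_card_quotient_le (hfin : ∀ I : Ideal S, I ≠ ⊥ → Finite (S ⧸ I)) {I : Ideal S}
    (hI : I ≠ ⊥) (P : HeightOneSpectrum S) :
    2 * Nat.card (S ⧸ I) ≤ Nat.card (S ⧸ (I * P.asIdeal)) := by
  have h := AddSubgroup.relIndex_mul_index (H := (I * P.asIdeal).toAddSubgroup)
    (K := I.toAddSubgroup) (Ideal.mul_le_left (I := I) (J := P.asIdeal))
  have hIP : I * P.asIdeal ≠ ⊥ := mul_ne_zero hI P.ne_bot
  have := hfin _ hIP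
  have hpos : 0 < Nat.card (S ⧸ (I * P.asIdeal)) := Nat.card_pos
  change _ * Nat.card (S ⧸ I) = Nat.card (S ⧸ (I * P.asIdeal)) at h
  have h0 : (I * P.asIdeal).toAddSubgroup.relIndex I.toAddSubgroup ≠ 0 := by
    intro h0
    rw [h0, zero_mul] at h
    exact hpos.ne h
  have h1 : (I * P.asIdeal).toAddSubgroup.relIndex I.toAddSubgroup ≠ 1 := by
    intro h1
    have hle : I ≤ I * P.asIdeal := AddSubgroup.relIndex_eq_one.1 h1
    have heq : I * P.asIdeal = I * 1 := by
      rw [mul_one]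
      exact le_antisymm Ideal.mul_le_left hle
    have := mul_left_cancel₀ hI heq
    exact P.isPrime.ne_top (this.trans Ideal.one_eq_top)
  rw [← h]
  exact Nat.mul_le_mul_right _ (by lia)

/-- The product of a list of maximal ideals. -/
def primeProduct (l : List (HeightOneSpectrum S)) : Ideal S :=
  (l.map HeightOneSpectrum.asIdeal).prod

theorem primeProduct_ne_bot (l : List (HeightOneSpectrum S)) : primeProduct l ≠ ⊥ := by
  refine List.prod_ne_zero fun h => ?_
  obtain ⟨P, -, hP⟩ := List.mem_map.1 h
  exact P.ne_bot hP

/-- The bound depends only on the number of factors. One estimate thus covers both a high power of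
one prime and a product of many distinct primes. -/
theorem card_quotient_mul_two_pow_le (hfin : ∀ I : Ideal S, I ≠ ⊥ → Finite (S ⧸ I))
    (l : List (HeightOneSpectrum S)) {I : Ideal S} (hI : I ≠ ⊥) :
    Nat.card (S ⧸ I) * 2 ^ l.length ≤ Nat.card (S ⧸ (I * primeProduct l)) := by
  induction l generalizing I with
  | nil => simp [primeProduct]
  | cons P l ih =>
    have h1 := ih (I := I * P.asIdeal) (mul_ne_zero hI P.ne_bot)
    have h2 := two_mul_card_quotient_le hfin hI P
    have e : I * primeProduct (P :: l) = I * P.asIdeal * primeProduct l := by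
      simp [primeProduct, mul_assoc]
    rw [e, List.length_cons, pow_succ]
    calc _ = 2 * Nat.card (S ⧸ I) * 2 ^ l.length := by ring
      _ ≤ _ := (Nat.mul_le_mul_right _ h2).trans h1

theorem exists_mem_primeProduct_notMem {l : List (HeightOneSpectrum S)} {P : HeightOneSpectrum S}
    (hP : P ∉ l) : ∃ q ∈ primeProduct l, q ∉ P.asIdeal := by
  induction l with
  | nil => exact ⟨1, by simp [primeProduct], (Ideal.ne_top_iff_one _).1 P.isPrime.ne_top⟩
  | cons Q l ih =>
    rw [List.mem_cons, not_or] at hP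
    obtain ⟨hPQ, hPl⟩ := hP
    obtain ⟨q, hq, hqP⟩ := ih hPl
    have hQP : ¬ Q.asIdeal ≤ P.asIdeal := fun h =>
      hPQ (HeightOneSpectrum.ext (Q.isMaximal.eq_of_le P.isPrime.ne_top h)).symm
    obtain ⟨a, ha, haP⟩ := Set.not_subset.1 hQP
    refine ⟨a * q, ?_, fun h => (P.isPrime.mem_or_mem h).elim haP hqP⟩
    rw [primeProduct, List.map_cons, List.prod_cons]
    exact Ideal.mul_mem_mul ha hq

variable {K : Type*} [Field K] [Algebra S K]

/-- An element `k` with `k ∏ P ⊆ u S` lies in `u A` if the prime of `A` is not among the `P`. -/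
theorem div_mem_of_notMem_list {A : ValuationSubring K} (hS : ∀ r : S, algebraMap S K r ∈ A)
    {P : HeightOneSpectrum S} (hP : ∀ r : S, algebraMap S K r ∈ A.nonunits ↔ r ∈ P.asIdeal)
    {l : List (HeightOneSpectrum S)} (hl : P ∉ l) {k u : K} (hu : u ≠ 0)
    (hk : ∀ q ∈ primeProduct l, ∃ z : S, k * algebraMap S K q = u * algebraMap S K z) :
    k / u ∈ A := by
  obtain ⟨q, hq, hqP⟩ := exists_mem_primeProduct_notMem hl
  obtain ⟨z, hz⟩ := hk q hq
  have hq0 : algebraMap S K q ≠ 0 := by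
    intro h
    exact hqP ((hP q).1 (by simp [h]))
  have e : k / u = algebraMap S K z * (algebraMap S K q)⁻¹ := by
    field_simp
    rw [hz, mul_comm]
  rw [e]
  exact A.mul_mem _ _ (hS z) (inv_algebraMap_mem_of_notMem hP hqP)

variable [IsFractionRing S K]

/-- A valuation ring containing a Dedekind domain with the same fraction field is the localization
at a maximal ideal. -/
theorem exists_valuationSubringAtPrime_eq {A : ValuationSubring K} (hA : A ≠ ⊤)
    (hS : ∀ r : S, algebraMap S K r ∈ A) :
    ∃ P : HeightOneSpectrum S, HeightOneSpectrum.valuationSubringAtPrime K P = A ∧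
      ∀ r : S, algebraMap S K r ∈ A.nonunits ↔ r ∈ P.asIdeal := by
  let f : S →+* A := (algebraMap S K).codRestrict A.toSubring hS
  let P : Ideal S := (IsLocalRing.maximalIdeal A).comap f
  have hmemP : ∀ r : S, algebraMap S K r ∈ A.nonunits ↔ r ∈ P := fun r =>
    ValuationSubring.coe_mem_nonunits_iff (a := f r)
  have hmem : ∀ r : S, r ∉ P → (algebraMap S K r)⁻¹ ∈ A := fun r hr =>
    inv_algebraMap_mem_of_notMem hmemP hr
  have hP : P ≠ ⊥ := by
    intro h0
    apply hA
    refine top_unique (SetLike.le_def.2 fun {z} _ => ?_)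
    obtain ⟨a, b, hb, rfl⟩ := IsFractionRing.div_surjective (A := S) z
    rw [div_eq_mul_inv]
    refine A.mul_mem _ _ (hS a) (hmem b ?_)
    rw [h0, Ideal.mem_bot]
    exact nonZeroDivisors.ne_zero hb
  refine ⟨⟨P, inferInstance, hP⟩, ?_, hmemP⟩
  refine ValuationSubring.eq_of_le_of_ne_top _ ?_ hA
  rintro z ⟨a, s, hs, rfl⟩
  exact A.mul_mem _ _ (hS a) (hmem s hs)

/-- An element `k` with `k ∏ P ⊆ u S` satisfies `k 𝔪 ⊆ u A` if the prime of `A` occurs once among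
the `P`. -/
theorem mul_div_mem_of_nodup_list {A : ValuationSubring K} (hS : ∀ r : S, algebraMap S K r ∈ A)
    {P : HeightOneSpectrum S} (hPA : HeightOneSpectrum.valuationSubringAtPrime K P = A)
    (hP : ∀ r : S, algebraMap S K r ∈ A.nonunits ↔ r ∈ P.asIdeal)
    {l : List (HeightOneSpectrum S)} (hnodup : l.Nodup) (hl : P ∈ l) {k u : K} (hu : u ≠ 0)
    (hk : ∀ q ∈ primeProduct l, ∃ z : S, k * algebraMap S K q = u * algebraMap S K z)
    {π : K} (hπ : π ∈ A.nonunits) : k * π / u ∈ A := by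
  classical
  have hπA : π ∈ HeightOneSpectrum.valuationSubringAtPrime K P := by
    rw [hPA]
    exact ValuationSubring.nonunits_subset hπ
  obtain ⟨a, s, hs, rfl⟩ := hπA
  have hs : s ∉ P.asIdeal := hs
  have hs0 : algebraMap S K s ≠ 0 := by
    intro h
    exact hs ((hP s).1 (by simp [h]))
  have ha : a ∈ P.asIdeal := by
    rw [← hP]
    have hsA := hS s
    have e : algebraMap S K a = algebraMap S K a * (algebraMap S K s)⁻¹ * algebraMap S K s := by
      field_simp
    rw [e, ValuationSubring.mem_nonunits_iff, map_mul]
    exact mul_lt_one_of_lt_of_le ((ValuationSubring.mem_nonunits_iff _).1 hπ)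
      ((A.valuation_le_one_iff _).2 hsA)
  -- Write `π` as `a / s` with `a` in `P` and `s` outside it. As `a` absorbs the single factor `P`,
  -- the previous case applies to `k * a` and the remaining primes.
  have hne : P ∉ l.erase P := fun h => (hnodup.mem_erase_iff.1 h).1 rfl
  have e : k * (algebraMap S K a * (algebraMap S K s)⁻¹) / u =
      (k * algebraMap S K a) / u * (algebraMap S K s)⁻¹ := by
    field_simp
  rw [e]
  refine A.mul_mem _ _ (div_mem_of_notMem_list hS hP hne hu fun q hq => ?_)
    (inv_algebraMap_mem_of_notMem hP hs)
  obtain ⟨z, hz⟩ := hk (a * q) (by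
    have : primeProduct l = P.asIdeal * primeProduct (l.erase P) := by
      rw [primeProduct, ((List.perm_cons_erase hl).map _).prod_eq, List.map_cons, List.prod_cons]
      rfl
    rw [this]
    exact Ideal.mul_mem_mul ha hq)
  refine ⟨z, ?_⟩
  rw [← hz, map_mul, mul_assoc]

end Dedekind

/-! ### Elements with prescribed poles from small lattice points -/

/-- The place `w` is nonarchimedean and its valuation ring contains `S`. -/
def Place.IsOver (S : Type*) {K : Type*} [CommRing S] [Field K] [Algebra S K] : Place K → Prop
  | .infinite _ => False
  | .finite A _ => ∀ r : S, algebraMap S K r ∈ A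

theorem Place.not_isOver_infinite (S : Type*) {K : Type*} [CommRing S] [Field K] [Algebra S K]
    (w : NumberField.InfinitePlace K) : ¬ (Place.infinite w).IsOver S :=
  id

/-- A Minkowski-type property: an ideal `I` of `S` of sufficiently small index relative to
`[S : gS]` contains a nonzero element `x` such that `x / g` is small at all places that are
not over `S`. -/
def HasSmallElements (R S K : Type*) [CommRing R] [CommRing S] [Field K] [Algebra R S]
    [Algebra S K] : Prop :=
  ∀ ε : ℝ, 0 < ε → ∃ C : ℝ, ∀ I : Ideal S, I ≠ ⊥ → ∀ g : R, g ≠ 0 →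
    C * Nat.card (S ⧸ I) < Nat.card (S ⧸ Ideal.span {algebraMap R S g}) →
    ∃ x ∈ I, x ≠ 0 ∧ ∀ w : Place K, ¬ w.IsOver S →
      w.absValue (algebraMap S K x / algebraMap S K (algebraMap R S g)) < ε

section

variable {R S K : Type*} [CommRing R] [CommRing S] [IsDedekindDomain S] [Field K]
  [Algebra R S] [FaithfulSMul R S] [Algebra.IsAlgebraic R S] [Algebra S K]

theorem exists_ne_zero_algebraMap_mem (R : Type*) {S : Type*} [CommRing R] [CommRing S] [IsDomain S]
    [Algebra R S] [Algebra.IsAlgebraic R S] {I : Ideal S} (hI : I ≠ ⊥) :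
    ∃ r : R, r ≠ 0 ∧ algebraMap R S r ∈ I := by
  obtain ⟨q, hq, hq0⟩ := Submodule.exists_mem_ne_zero_of_ne_bot hI
  obtain ⟨r, hr, hqr⟩ := (Algebra.IsAlgebraic.isAlgebraic (R := R) q).exists_nonzero_dvd
    (mem_nonZeroDivisors_of_ne_zero hq0)
  exact ⟨r, hr, I.mem_of_dvd hqr hq⟩

/-- Choose a nonzero `g` of `R` in the product `J` of the primes and write `(g) = J I`. The ideal `u
I` has index `[S : u] [S : I]`, while `[S : g] ≥ 2 ^ length * [S : I]`. A long list therefore yields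
a small `x` in `u I`, and `k = x / g` satisfies `k J ⊆ u S`: its poles are confined to the list and
its numerator is divisible by `u`. -/
theorem HasSmallElements.exists_of_list (h : HasSmallElements R S K)
    [FaithfulSMul S K] (hfin : ∀ I : Ideal S, I ≠ ⊥ → Finite (S ⧸ I)) {ε : ℝ} (hε : 0 < ε) {u : S}
    (hu : u ≠ 0) : ∃ N : ℕ, ∀ l : List (HeightOneSpectrum S), N ≤ l.length →
      ∃ k : K, k ≠ 0 ∧ (∀ w : Place K, ¬ w.IsOver S → w.absValue k < ε) ∧
        ∀ q ∈ primeProduct l, ∃ z : S,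
          k * algebraMap S K q = algebraMap S K u * algebraMap S K z := by
  obtain ⟨C, hC⟩ := h ε hε
  obtain ⟨N, hN⟩ := pow_unbounded_of_one_lt (C * Nat.card (S ⧸ Ideal.span {u})) one_lt_two
  refine ⟨N, fun l hl => ?_⟩
  obtain ⟨g, hg0, hg⟩ := exists_ne_zero_algebraMap_mem R (primeProduct_ne_bot l)
  have hgS : algebraMap R S g ≠ 0 := by
    rwa [Ne, FaithfulSMul.algebraMap_eq_zero_iff]
  have hgK : algebraMap S K (algebraMap R S g) ≠ 0 := by
    rwa [Ne, FaithfulSMul.algebraMap_eq_zero_iff]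
  obtain ⟨I, hI⟩ := Ideal.dvd_iff_le.2 ((Ideal.span_singleton_le_iff_mem _).2 hg)
  have hI0 : I ≠ ⊥ := by
    rintro rfl
    rw [Ideal.mul_bot, Ideal.span_singleton_eq_bot] at hI
    exact hgS hI
  have hcard := card_quotient_mul_two_pow_le hfin l hI0
  rw [mul_comm I, ← hI] at hcard
  have := hfin I hI0
  have hIpos : (0 : ℝ) < Nat.card (S ⧸ I) := by exact_mod_cast Nat.card_pos
  obtain ⟨x, hx, hx0, hsmall⟩ := hC (Ideal.span {u} * I)
    (mul_ne_zero (by rwa [Ne, Submodule.zero_eq_bot, Ideal.span_singleton_eq_bot]) hI0) g hg0 (by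
      rw [card_quotient_span_mul hu]
      calc C * ((Nat.card (S ⧸ Ideal.span {u}) * Nat.card (S ⧸ I) : ℕ) : ℝ)
          = C * Nat.card (S ⧸ Ideal.span {u}) * Nat.card (S ⧸ I) := by push_cast; ring
        _ < 2 ^ N * Nat.card (S ⧸ I) := by gcongr
        _ ≤ 2 ^ l.length * Nat.card (S ⧸ I) := by
          gcongr
          exact one_le_two
        _ ≤ _ := by
          rw [mul_comm]
          exact_mod_cast hcard)
  obtain ⟨x', hx', rfl⟩ := Ideal.mem_span_singleton_mul.1 hx
  refine ⟨_, div_ne_zero (by rwa [Ne, FaithfulSMul.algebraMap_eq_zero_iff]) hgK, hsmall, ?_⟩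
  intro q hq
  have hmem : q * x' ∈ Ideal.span {algebraMap R S g} := by
    rw [hI]
    exact Ideal.mul_mem_mul hq hx'
  obtain ⟨z, hz⟩ := Ideal.mem_span_singleton'.1 hmem
  refine ⟨z, ?_⟩
  have hz' := congrArg (algebraMap S K) hz
  rw [map_mul, map_mul] at hz'
  rw [map_mul]
  field_simp
  linear_combination -(algebraMap S K u) * hz'

variable [IsGlobalField K] [IsFractionRing S K]

/-- A nonzero element of `S` that is small at a given place over `S`. -/
theorem exists_ne_zero_absValue_lt (S : Type*) {K : Type*} [CommRing S] [IsDedekindDomain S]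
    [Field K] [Algebra S K] [IsGlobalField K] [IsFractionRing S K] (v : Place K) {ε : ℝ} (hε : 0 < ε) :
    ∃ u : S, u ≠ 0 ∧ (v.IsOver S → v.absValue (algebraMap S K u) < ε) := by
  rcases v with v | ⟨A, hA⟩
  · exact ⟨1, one_ne_zero, fun h => h.elim⟩
  by_cases h : (Place.finite A hA).IsOver S
  · obtain ⟨P, -, hP⟩ := exists_valuationSubringAtPrime_eq hA h
    obtain ⟨r, hr, hr0⟩ := Submodule.exists_mem_ne_zero_of_ne_bot P.ne_bot
    have h1 := Place.absValue_finite_lt_one hA ((hP r).2 hr)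
    obtain ⟨n, hn⟩ := exists_pow_lt_of_lt_one hε h1
    refine ⟨r ^ n, pow_ne_zero _ hr0, fun _ => ?_⟩
    rwa [map_pow, Place.absValue_pow]
  · exact ⟨1, one_ne_zero, fun h' => absurd h' h⟩

/-- Small elements with arbitrary denominators at one place. -/
theorem HasSmallElements.exists_of_place (h : HasSmallElements R S K)
    (hfin : ∀ I : Ideal S, I ≠ ⊥ → Finite (S ⧸ I)) {ε : ℝ} (hε : 0 < ε) {v w₀ : Place K}
    (hv : v ≠ w₀) (hw₀ : w₀.IsOver S) :
    ∃ k : K, k ≠ 0 ∧ v.absValue k < ε ∧ ∀ w, w ≠ v → w ≠ w₀ → w.absValue k ≤ 1 := by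
  rcases w₀ with w₀ | ⟨B, hB⟩
  · exact hw₀.elim
  have : FaithfulSMul S K := (faithfulSMul_iff_algebraMap_injective S K).2
    (IsFractionRing.injective S K)
  obtain ⟨u, hu, huv⟩ := exists_ne_zero_absValue_lt S v hε
  have huK : algebraMap S K u ≠ 0 := by rwa [Ne, FaithfulSMul.algebraMap_eq_zero_iff]
  obtain ⟨Q, hQB, -⟩ := exists_valuationSubringAtPrime_eq hB hw₀
  -- The bound `ε` is for `v` when it is not over `S`, and the bound `1` is for the other places not
  -- over `S`. If `v` is over `S`, divisibility by `u` gives the smallness. All primes of the list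
  -- equal `Q`, so only `w₀` can carry a pole.
  obtain ⟨N, hN⟩ := h.exists_of_list hfin (lt_min hε one_pos) hu
  obtain ⟨k, hk0, hksmall, hk⟩ := hN (List.replicate N Q) (by simp)
  have key : ∀ (A : ValuationSubring K) (hA : A ≠ ⊤), (∀ r : S, algebraMap S K r ∈ A) →
      Place.finite A hA ≠ Place.finite B hB → k / algebraMap S K u ∈ A := by
    intro A hA hSA hAB
    obtain ⟨P, hPA, hP⟩ := exists_valuationSubringAtPrime_eq hA hSA
    refine div_mem_of_notMem_list hSA hP (fun hmem => hAB ?_) huK hk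
    have : P = Q := List.eq_of_mem_replicate hmem
    subst this
    simp only [Place.finite.injEq]
    exact hPA.symm.trans hQB
  refine ⟨k, hk0, ?_, fun w hwv hw => ?_⟩
  · rcases v with v | ⟨A, hA⟩
    · exact (hksmall _ (Place.not_isOver_infinite S _)).trans_le (min_le_left _ _)
    · by_cases hSA : (Place.finite A hA).IsOver S
      · have h1 := Place.absValue_finite_le_one hA (key A hA hSA hv)
        have e : k = k / algebraMap S K u * algebraMap S K u := by field_simp
        rw [e, Place.absValue_mul]
        exact lt_of_le_of_lt (mul_le_of_le_one_left (Place.absValue_pos _ huK).le h1) (huv hSA)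
      · exact (hksmall _ hSA).trans_le (min_le_left _ _)
  · rcases w with w | ⟨A, hA⟩
    · exact ((hksmall _ (Place.not_isOver_infinite S _)).trans_le (min_le_right _ _)).le
    · by_cases hSA : (Place.finite A hA).IsOver S
      · have e : k = k / algebraMap S K u * algebraMap S K u := by field_simp
        rw [e]
        exact Place.absValue_finite_le_one hA (A.mul_mem _ _ (key A hA hSA hw) (hSA u))
      · exact ((hksmall _ hSA).trans_le (min_le_right _ _)).le

/-- Small elements with simple denominators at infinitely many places. -/
theorem HasSmallElements.exists_of_infinite (h : HasSmallElements R S K)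
    (hfin : ∀ I : Ideal S, I ≠ ⊥ → Finite (S ⧸ I)) {ε : ℝ} (hε : 0 < ε) {v : Place K}
    {T : Set (ValuationSubring K)} (hT : T.Infinite)
    (hTS : ∀ A ∈ T, ∃ hA : A ≠ ⊤, Place.finite A hA ≠ v ∧ (Place.finite A hA).IsOver S) :
    ∃ k : K, k ≠ 0 ∧ v.absValue k < ε ∧ (∀ A ∈ T, ∀ π ∈ A.nonunits, k * π ∈ A) ∧
      ∀ w, w ≠ v → w.absValue k ≤ 1 ∨ ∃ A ∈ T, ∃ hA, w = Place.finite A hA := by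
  classical
  have : FaithfulSMul S K := (faithfulSMul_iff_algebraMap_injective S K).2
    (IsFractionRing.injective S K)
  obtain ⟨u, hu, huv⟩ := exists_ne_zero_absValue_lt S v hε
  have huK : algebraMap S K u ≠ 0 := by rwa [Ne, FaithfulSMul.algebraMap_eq_zero_iff]
  obtain ⟨N, hN⟩ := h.exists_of_list hfin (lt_min hε one_pos) hu
  obtain ⟨F, hFT, hFN⟩ := hT.exists_subset_card_eq N
  have hprime : ∀ A : F, ∃ P : HeightOneSpectrum S,
      HeightOneSpectrum.valuationSubringAtPrime K P = A.1 ∧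
        ∀ r : S, algebraMap S K r ∈ A.1.nonunits ↔ r ∈ P.asIdeal := by
    intro A
    obtain ⟨hA, -, hSA⟩ := hTS A.1 (hFT A.2)
    exact exists_valuationSubringAtPrime_eq hA hSA
  choose p hp hp' using hprime
  have hpinj : Function.Injective p := by
    intro A B hAB
    rw [Subtype.ext_iff, ← hp A, ← hp B, hAB]
  -- The list has no repetitions, so each pole is simple; the length `N` is reached by using many
  -- places of `T`.
  let l : List (HeightOneSpectrum S) := (F.attach.image p).toList
  have hl : l.length = N := by
    rw [Finset.length_toList, Finset.card_image_of_injective _ hpinj, Finset.card_attach, hFN]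
  have hmeml : ∀ P ∈ l, HeightOneSpectrum.valuationSubringAtPrime K P ∈ F := by
    intro P hP
    rw [Finset.mem_toList, Finset.mem_image] at hP
    obtain ⟨A, -, rfl⟩ := hP
    rw [hp]
    exact A.2
  obtain ⟨k, hk0, hksmall, hk⟩ := hN l hl.ge
  have key : ∀ (A : ValuationSubring K) (hA : A ≠ ⊤), (∀ r : S, algebraMap S K r ∈ A) →
      A ∉ F → k / algebraMap S K u ∈ A := by
    intro A hA hSA hAF
    obtain ⟨P, hPA, hP⟩ := exists_valuationSubringAtPrime_eq hA hSA
    refine div_mem_of_notMem_list hSA hP (fun hmem => hAF ?_) huK hk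
    rw [← hPA]
    exact hmeml P hmem
  have hdiv : ∀ A : ValuationSubring K, (∀ r : S, algebraMap S K r ∈ A) → ∀ z : K,
      z / algebraMap S K u ∈ A → z ∈ A := by
    intro A hSA z hz
    have e : z = z / algebraMap S K u * algebraMap S K u := by field_simp
    rw [e]
    exact A.mul_mem _ _ hz (hSA u)
  refine ⟨k, hk0, ?_, fun A hAT π hπ => ?_, fun w hwv => ?_⟩
  · rcases v with v | ⟨A, hA⟩
    · exact (hksmall _ (Place.not_isOver_infinite S _)).trans_le (min_le_left _ _)
    · by_cases hSA : (Place.finite A hA).IsOver S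
      · have hAF : A ∉ F := fun hAF => by
          obtain ⟨_, hne, -⟩ := hTS A (hFT hAF)
          exact hne rfl
        have h1 := Place.absValue_finite_le_one hA (key A hA hSA hAF)
        have e : k = k / algebraMap S K u * algebraMap S K u := by field_simp
        rw [e, Place.absValue_mul]
        exact lt_of_le_of_lt (mul_le_of_le_one_left (Place.absValue_pos _ huK).le h1) (huv hSA)
      · exact (hksmall _ hSA).trans_le (min_le_left _ _)
  · obtain ⟨hA, -, hSA⟩ := hTS A hAT
    by_cases hAF : A ∈ F
    · refine hdiv A hSA _ (mul_div_mem_of_nodup_list hSA (hp ⟨A, hAF⟩) (hp' ⟨A, hAF⟩)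
        (Finset.nodup_toList _) ?_ huK hk hπ)
      exact Finset.mem_toList.2 (Finset.mem_image_of_mem _ (Finset.mem_attach _ _))
    · exact A.mul_mem _ _ (hdiv A hSA _ (key A hA hSA hAF)) (ValuationSubring.nonunits_subset hπ)
  · rcases w with w | ⟨A, hA⟩
    · exact Or.inl ((hksmall _ (Place.not_isOver_infinite S _)).trans_le (min_le_right _ _)).le
    · by_cases hSA : (Place.finite A hA).IsOver S
      · by_cases hAF : A ∈ F
        · exact Or.inr ⟨A, hFT hAF, hA, rfl⟩
        · exact Or.inl (Place.absValue_finite_le_one hA (hdiv A hSA _ (key A hA hSA hAF)))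
      · exact Or.inl ((hksmall _ hSA).trans_le (min_le_right _ _)).le

end

theorem ValuationSubring.mem_of_isIntegral {R K : Type*} [CommRing R] [Field K] [Algebra R K]
    (A : ValuationSubring K) (hA : ∀ r : R, algebraMap R K r ∈ A) {x : K} (hx : IsIntegral R x) :
    x ∈ A := by
  let : Algebra R A := ((algebraMap R K).codRestrict A.toSubring hA).toAlgebra
  have : IsScalarTower R A K := IsScalarTower.of_algebraMap_eq fun _ => rfl
  obtain ⟨a, ha⟩ := (IsIntegrallyClosed.isIntegral_iff (R := A) (K := K)).1 hx.tower_top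
  rw [← ha]
  exact a.2

/-! ### Small elements in number fields -/

namespace NumberField

variable (K : Type*) [Field K] [NumberField K]

open scoped NNReal

/-- Minkowski's convex body theorem applies, because the covolume of the lattice of `I` is its index
times a constant of `K`. -/
theorem exists_ne_zero_mem_ideal_lt : ∃ C : ℝ, ∀ I : Ideal (𝓞 K), I ≠ ⊥ →
    ∀ f : InfinitePlace K → ℝ≥0, C * Nat.card (𝓞 K ⧸ I) < ∏ w, (f w : ℝ) ^ w.mult →
      ∃ x ∈ I, x ≠ 0 ∧ ∀ w : InfinitePlace K, w (x : K) < f w := by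
  classical
  let V := MeasureTheory.volume (ZSpan.fundamentalDomain (mixedEmbedding.latticeBasis K))
  have hV : V ≠ ⊤ := (ZSpan.fundamentalDomain_isBounded _).measure_lt_top.ne
  let n := Module.finrank ℝ (mixedEmbedding.mixedSpace K)
  refine ⟨V.toReal * 2 ^ n, fun I hI f h => ?_⟩
  have hI' : (I : FractionalIdeal (nonZeroDivisors (𝓞 K)) K) ≠ 0 := by
    rwa [Ne, FractionalIdeal.coeIdeal_eq_zero]
  have hlt : mixedEmbedding.minkowskiBound K (Units.mk0 _ hI') <
      MeasureTheory.volume (mixedEmbedding.convexBodyLT K f) := by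
    rw [mixedEmbedding.minkowskiBound,
      mixedEmbedding.volume_fundamentalDomain_fractionalIdealLatticeBasis,
      mixedEmbedding.convexBodyLT_volume, Units.val_mk0, FractionalIdeal.coeIdeal_absNorm]
    have e1 : ENNReal.ofReal (((Ideal.absNorm I : ℚ) : ℝ)) * V * 2 ^ n =
        ENNReal.ofReal (V.toReal * 2 ^ n * Nat.card (𝓞 K ⧸ I)) := by
      rw [mul_comm _ (Nat.card (𝓞 K ⧸ I) : ℝ), ENNReal.ofReal_mul (by positivity),
        ENNReal.ofReal_mul (by positivity), ENNReal.ofReal_toReal hV, mul_assoc]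
      congr 2
      rw [ENNReal.ofReal_pow (by norm_num)]
      norm_num
    have e2 : ENNReal.ofReal (∏ w, (f w : ℝ) ^ w.mult) = ∏ w, (f w : ENNReal) ^ w.mult := by
      rw [ENNReal.ofReal_prod_of_nonneg fun w _ => by positivity]
      refine Finset.prod_congr rfl fun w _ => ?_
      rw [ENNReal.ofReal_pow (by positivity), ENNReal.ofReal_coe_nnreal]
    rw [e1]
    have hpos : 0 < ∏ w, (f w : ℝ) ^ w.mult := lt_of_le_of_lt (by positivity) h
    refine ((ENNReal.ofReal_lt_ofReal_iff hpos).2 h).trans_le ?_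
    rw [e2, ENNReal.ofNNReal_finsetProd]
    simp_rw [ENNReal.coe_pow]
    exact le_mul_of_one_le_left' (ENNReal.one_le_coe_iff.2
      (mixedEmbedding.one_le_convexBodyLTFactor K))
  obtain ⟨a, ha, ha0, hw⟩ := mixedEmbedding.exists_ne_zero_mem_ideal_lt K (Units.mk0 _ hI') hlt
  obtain ⟨x, hx, rfl⟩ := (FractionalIdeal.mem_coeIdeal _).1 ha
  refine ⟨x, hx, fun h0 => ha0 (by simp [h0]), hw⟩

variable {K}

theorem isOver_ringOfIntegers {K : Type*} [Field K] (A : ValuationSubring K) (hA : A ≠ ⊤) :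
    (Place.finite A hA).IsOver (𝓞 K) :=
  fun r => A.mem_of_isIntegral (R := ℤ) (fun n => by simp) r.2

theorem pow_mult_lt {K : Type*} [Field K] {w : InfinitePlace K} {x δ ε : ℝ} (hx : 0 ≤ x)
    (hxδ : x < δ) (hδ1 : δ ≤ 1)
    (hδ : δ ≤ ε) : x ^ w.mult < ε := by
  have h1 : x ^ w.mult ≤ x := pow_le_of_le_one hx (hxδ.le.trans hδ1) w.mult_ne_zero
  linarith

-- Minkowski's theorem is applied to the box of radius `δ |g|` at each archimedean place. Its volume
-- is governed by `δ ^ n |g| ^ n = δ ^ n [𝓞 : g]`, which explains `C / δ ^ n`; division by `g`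
-- rescales the radius to `δ`.
variable (K) in
theorem hasSmallElements : HasSmallElements ℤ (𝓞 K) K := by
  intro ε hε
  obtain ⟨C, hC⟩ := exists_ne_zero_mem_ideal_lt K
  let δ : ℝ≥0 := ⟨min ε 1, (lt_min hε one_pos).le⟩
  have hδ : (0 : ℝ) < δ := lt_min hε one_pos
  let n := Module.finrank ℚ K
  refine ⟨C / (δ : ℝ) ^ n, fun I hI g hg h => ?_⟩
  have hg0 : (0 : ℝ) < |(g : ℝ)| := by positivity
  have hcard : Nat.card (𝓞 K ⧸ Ideal.span {algebraMap ℤ (𝓞 K) g}) = g.natAbs ^ n := by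
    have h1 : Nat.card (𝓞 K ⧸ Ideal.span {algebraMap ℤ (𝓞 K) g}) =
      Ideal.absNorm (Ideal.span {algebraMap ℤ (𝓞 K) g}) := rfl
    rw [h1, Ideal.absNorm_span_singleton, Algebra.norm_algebraMap_of_basis
      (Module.Free.chooseBasis ℤ (𝓞 K)), Int.natAbs_pow,
      ← Module.finrank_eq_card_chooseBasisIndex, RingOfIntegers.rank]
  obtain ⟨x, hx, hx0, hw⟩ := hC I hI (fun _ => δ * Real.nnabs g) (by
    rw [Finset.prod_pow_eq_pow_sum, InfinitePlace.sum_mult_eq]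
    rw [hcard, div_mul_eq_mul_div, div_lt_iff₀ (by positivity)] at h
    refine h.trans_le (le_of_eq ?_)
    push_cast
    rw [mul_pow, mul_comm, Nat.cast_natAbs]
    push_cast
    rfl)
  refine ⟨x, hx, hx0, fun w hwS => ?_⟩
  rcases w with w | ⟨A, hA⟩
  · change w _ ^ w.mult < ε
    refine pow_mult_lt (δ := δ) (apply_nonneg w _) ?_ (min_le_right _ _) (min_le_left _ _)
    have h1 := hw w
    have h2 : w (algebraMap (𝓞 K) K (algebraMap ℤ (𝓞 K) g)) = |(g : ℝ)| := by
      simp [← InfinitePlace.norm_embedding_eq]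
    rw [map_div₀, h2, div_lt_iff₀ hg0]
    simpa using h1
  · exact absurd (isOver_ringOfIntegers A hA) hwS

/-- Small elements of a number field that are large at one archimedean place. -/
theorem exists_of_infinitePlace [IsGlobalField K] {ε : ℝ} (hε : 0 < ε) {v : Place K}
    {w₀ : InfinitePlace K} (hv : v ≠ Place.infinite w₀) :
    ∃ k : K, k ≠ 0 ∧ v.absValue k < ε ∧
      ∀ w, w ≠ v → w ≠ Place.infinite w₀ → w.absValue k ≤ 1 := by
  obtain ⟨u, hu, huv⟩ := exists_ne_zero_absValue_lt (𝓞 K) v hε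
  obtain ⟨C, hC⟩ := exists_ne_zero_mem_ideal_lt K
  let δ : ℝ≥0 := ⟨min ε 1, (lt_min hε one_pos).le⟩
  have hδ : δ ≠ 0 := fun h => (lt_min hε one_pos).ne' (congrArg NNReal.toReal h)
  -- All radii are `δ` except the one at `w₀`, which is adjusted so that the product exceeds
  -- Minkowski's bound.
  obtain ⟨f, hf, hprod⟩ := mixedEmbedding.adjust_f K (w₁ := w₀) (f := fun _ => δ)
    (Real.toNNReal (C * Nat.card (𝓞 K ⧸ Ideal.span {u}) + 1)) fun _ _ => hδ
  obtain ⟨x, hx, hx0, hw⟩ := hC (Ideal.span {u}) (by rwa [Ne, Ideal.span_singleton_eq_bot]) f (by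
    have := congrArg NNReal.toReal hprod
    push_cast at this
    rw [this]
    exact lt_of_lt_of_le (lt_add_one _) (Real.le_coe_toNNReal _))
  obtain ⟨r, rfl⟩ := Ideal.mem_span_singleton'.1 hx
  have hsmall : ∀ w : InfinitePlace K, w ≠ w₀ →
      (Place.infinite w).absValue (r * u : 𝓞 K) < min ε 1 := by
    intro w hne
    have h1 := hw w
    rw [hf w hne] at h1
    exact pow_mult_lt (δ := δ) (apply_nonneg w _) h1 (min_le_right _ _) le_rfl
  have hxK : ((r * u : 𝓞 K) : K) ≠ 0 := by simpa using hx0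
  refine ⟨(r * u : 𝓞 K), hxK, ?_, fun w hwv hw0 => ?_⟩
  · rcases v with v | ⟨A, hA⟩
    · exact (hsmall v fun h => hv (congrArg _ h)).trans_le (min_le_left _ _)
    · have h1 := Place.absValue_finite_le_one hA (isOver_ringOfIntegers A hA r)
      have e : ((r * u : 𝓞 K) : K) = algebraMap (𝓞 K) K r * algebraMap (𝓞 K) K u := map_mul _ _ _
      rw [e, Place.absValue_mul]
      exact lt_of_le_of_lt (mul_le_of_le_one_left (Place.absValue_pos _ (by simpa using hu)).le h1)
        (huv (isOver_ringOfIntegers A hA))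
  · rcases w with w | ⟨A, hA⟩
    · exact ((hsmall w fun h => hw0 (congrArg _ h)).trans_le (min_le_right _ _)).le
    · exact Place.absValue_finite_le_one hA (isOver_ringOfIntegers A hA _)

end NumberField

/-! ### Small elements in function fields -/

theorem integralClosure.card_quotient_le (R F K : Type*) [CommRing R] [IsDomain R]
    [IsPrincipalIdealRing R] [Field F] [Field K] [Algebra R F] [IsFractionRing R F] [Algebra F K]
    [Algebra R K] [IsScalarTower R F K] [FiniteDimensional F K]
    {g : R} [Finite (R ⧸ Ideal.span {g})]
    {I : Ideal (integralClosure R K)} (hg : algebraMap R (integralClosure R K) g ∈ I) :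
    Finite (integralClosure R K ⧸ I) ∧ Nat.card (integralClosure R K ⧸ I) ≤
      Nat.card (R ⧸ Ideal.span {g}) ^ Module.finrank F K := by
  have hinj : Function.Injective (algebraMap R K) := by
    rw [IsScalarTower.algebraMap_eq R F K]
    exact (algebraMap F K).injective.comp (IsFractionRing.injective R F)
  have : FaithfulSMul R K := (faithfulSMul_iff_algebraMap_injective R K).2 hinj
  refine card_quotient_smul_le (rank_le_finrank_of_isFractionRing R F
    (Subalgebra.toSubmodule (integralClosure R K))) g (I.restrictScalars R) fun m => ?_
  have h := Ideal.mul_mem_right (⟨m.1, m.2⟩ : integralClosure R K) I hg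
  rwa [← Algebra.smul_def] at h

theorem integralClosure.finite_quotient (R F K : Type*) [CommRing R] [IsDomain R]
    [IsPrincipalIdealRing R] [Field F] [Field K] [Algebra R F] [IsFractionRing R F] [Algebra F K]
    [Algebra R K] [IsScalarTower R F K] [FiniteDimensional F K]
    (hR : ∀ g : R, g ≠ 0 → Finite (R ⧸ Ideal.span {g}))
    {I : Ideal (integralClosure R K)} (hI : I ≠ ⊥) : Finite (integralClosure R K ⧸ I) := by
  obtain ⟨g, hg, hgI⟩ := exists_ne_zero_algebraMap_mem R hI
  have := hR g hg
  exact (integralClosure.card_quotient_le R F K hgI).1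

/-- Modulo a principal ideal generated by a nonzero member, an ideal becomes a submodule of a finite
module. -/
theorem isNoetherianRing_of_finite_quotient {S : Type*} [CommRing S]
    (h : ∀ I : Ideal S, I ≠ ⊥ → Finite (S ⧸ I)) : IsNoetherianRing S := by
  rw [isNoetherianRing_iff_ideal_fg]
  intro I
  by_cases hI : I = ⊥
  · exact hI ▸ Submodule.fg_bot
  obtain ⟨q, hq, hq0⟩ := Submodule.exists_mem_ne_zero_of_ne_bot hI
  have := h (Ideal.span {q}) (by rwa [Ne, Ideal.span_singleton_eq_bot])
  refine Submodule.fg_of_fg_map_of_fg_inf_ker (Submodule.mkQ (Ideal.span {q}))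
    (IsNoetherian.noetherian _) ?_
  rw [Submodule.ker_mkQ, inf_eq_right.2 ((Ideal.span_singleton_le_iff_mem _).2 hq)]
  exact Submodule.fg_span_singleton q

/-- The integral closure is a Dedekind domain even in an inseparable extension, as soon as the
proper quotients of the base ring are finite. -/
theorem integralClosure.isDedekindDomain_of_finite_quotient (R F K : Type*) [CommRing R]
    [IsDomain R] [IsPrincipalIdealRing R] [Field F] [Field K] [Algebra R F] [IsFractionRing R F] [Algebra F K]
    [Algebra R K] [IsScalarTower R F K] [FiniteDimensional F K]
    (hR : ∀ g : R, g ≠ 0 → Finite (R ⧸ Ideal.span {g})) :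
    IsDedekindDomain (integralClosure R K) := by
  have : IsFractionRing (integralClosure R K) K :=
    integralClosure.isFractionRing_of_finite_extension F K
  have : IsNoetherianRing (integralClosure R K) :=
    isNoetherianRing_of_finite_quotient fun I hI => integralClosure.finite_quotient R F K hR hI
  have : IsIntegrallyClosed (integralClosure R K) :=
    integralClosure.isIntegrallyClosedOfFiniteExtension F
  have : Ring.DimensionLEOne (integralClosure R K) := inferInstance
  exact {}

section

variable {K : Type*} [Field K] {p : ℕ} [Fact p.Prime] [Algebra (RatFunc (ZMod p)) K]

/-- Where `X` is not integral, the valuation induced on `𝔽_p(X)` is equivalent to the one at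
infinity, so integrality of a fraction is a comparison of degrees. -/
theorem ValuationSubring.algebraMap_div_mem {A : ValuationSubring K}
    (hA : algebraMap (RatFunc (ZMod p)) K RatFunc.X ∉ A) {h g : Polynomial (ZMod p)}
    (hg : g ≠ 0) (hh : h.degree ≤ g.degree) :
    algebraMap (RatFunc (ZMod p)) K (algebraMap _ _ h / algebraMap _ _ g) ∈ A := by
  classical
  let F := RatFunc (ZMod p)
  let B := A.comap (algebraMap F K)
  have : B.valuation.IsTrivialOn (ZMod p) := by
    refine ⟨fun c hc => ?_⟩
    apply le_antisymm
    · exact (B.valuation_le_one_iff _).2 (B.map_zmod_mem (algebraMap _ _) c)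
    · have := (B.valuation_le_one_iff _).2 (B.map_zmod_mem (algebraMap _ _) c⁻¹)
      rw [map_inv₀, map_inv₀] at this
      rwa [inv_le_one₀] at this
      simpa [zero_lt_iff] using hc
  have h1 : 1 < B.valuation RatFunc.X := by
    rw [← not_le, B.valuation_le_one_iff]
    exact hA
  have h2 := RatFunc.valuation_isEquiv_inftyValuation_of_one_lt_valuation_X h1
  have h3 := (Valuation.isEquiv_iff_valuationSubring _ _).1 h2
  rw [ValuationSubring.valuationSubring_valuation] at h3
  have : algebraMap (Polynomial (ZMod p)) F h / algebraMap _ _ g ∈ B := by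
    rw [h3, Valuation.mem_valuationSubring_iff, map_div₀]
    by_cases h0 : h = 0
    · simp [h0]
    have e : ∀ q : Polynomial (ZMod p), q ≠ 0 → RatFunc.inftyValuation (ZMod p)
        (algebraMap (Polynomial (ZMod p)) F q) = WithZero.exp (q.natDegree : ℤ) :=
      fun q hq => RatFunc.inftyValuation.polynomial _ hq
    rw [e h h0, e g hg, div_le_one₀ (by simp), WithZero.exp_le_exp]
    exact_mod_cast Polynomial.natDegree_le_natDegree hh
  exact this

/-- High powers of `X⁻¹` make integral combinations of given elements small at a place where `X`
is not integral. -/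
theorem exists_forall_absValue_inv_X_pow_lt [IsGlobalField K] {A : ValuationSubring K} (hA : A ≠ ⊤)
    {t : K} (ht : t ∉ A) {ι : Type*} [Finite ι] (e : ι → K) {ε : ℝ} (hε : 0 < ε) :
    ∃ N : ℕ, ∀ B, N ≤ B → ∀ (s : Finset ι) (z : ι → K), (∀ i, z i ∈ A) →
      (Place.finite A hA).absValue (t⁻¹ ^ B * ∑ i ∈ s, z i * e i) < ε := by
  classical
  have := Fintype.ofFinite ι
  have htn : t⁻¹ ∈ A.nonunits := A.inv_mem_nonunits_iff.2 (Or.inr ht)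
  have htA : t⁻¹ ∈ A := ValuationSubring.nonunits_subset htn
  have hc : ∀ i, ∃ c : ℕ, t⁻¹ ^ c * e i ∈ A := by
    intro i
    rcases A.mem_or_inv_mem (e i) with h | h
    · exact ⟨0, by simpa using h⟩
    by_cases h0 : e i = 0
    · exact ⟨0, by simp [h0]⟩
    obtain ⟨n, z, hz⟩ := A.exists_dvd_pow (x := ⟨t⁻¹, htA⟩) (u := ⟨(e i)⁻¹, h⟩) htn
      (fun h1 => inv_ne_zero h0 (congrArg Subtype.val h1))
    have hz' : t⁻¹ ^ n = (e i)⁻¹ * z := congrArg Subtype.val hz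
    refine ⟨n, ?_⟩
    rw [hz', mul_right_comm, inv_mul_cancel₀ h0, one_mul]
    exact z.2
  choose c hc using hc
  obtain ⟨M, hM⟩ := exists_pow_lt_of_lt_one hε (Place.absValue_finite_lt_one hA htn)
  -- The sum exceeds each `c i`, which clears the pole of `e i`; the remaining `M` powers of `t⁻¹`
  -- make the value less than `ε`.
  refine ⟨∑ i, c i + M, fun B hB s z hz => ?_⟩
  have e1 : t⁻¹ ^ B * ∑ i ∈ s, z i * e i =
      t⁻¹ ^ M * ∑ i ∈ s, z i * (t⁻¹ ^ (B - M - c i) * (t⁻¹ ^ c i * e i)) := by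
    rw [Finset.mul_sum, Finset.mul_sum]
    refine Finset.sum_congr rfl fun i _ => ?_
    have : c i ≤ ∑ i, c i := Finset.single_le_sum (fun _ _ => Nat.zero_le _) (Finset.mem_univ i)
    have hBi : B = M + ((B - M - c i) + c i) := by lia
    rw [show t⁻¹ ^ B = t⁻¹ ^ (M + ((B - M - c i) + c i)) from congrArg _ hBi, pow_add, pow_add]
    ring
  rw [e1, Place.absValue_mul, Place.absValue_pow]
  refine lt_of_le_of_lt (mul_le_of_le_one_right ?_ (Place.absValue_finite_le_one hA ?_)) hM
  · exact pow_nonneg (Place.absValue_pos _ fun h =>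
      ht (by rw [inv_eq_zero.1 h]; exact A.zero_mem)).le _
  · exact sum_mem fun i _ => A.mul_mem _ _ (hz i) (A.mul_mem _ _ (pow_mem htA _) (hc i))

theorem isEmpty_infinitePlace_of_algebra_ratFunc (K : Type*) [Field K] (p : ℕ) [Fact p.Prime]
    [Algebra (RatFunc (ZMod p)) K] : IsEmpty (NumberField.InfinitePlace K) := by
  refine ⟨fun w => ?_⟩
  have h : (p : ℂ) = 0 := by
    have h1 : ((p : ZMod p) : ZMod p) = 0 := ZMod.natCast_self p
    have h2 := congrArg ((w.embedding.comp (algebraMap (RatFunc (ZMod p)) K)).comp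
      (algebraMap (ZMod p) (RatFunc (ZMod p)))) h1
    rwa [map_natCast, map_zero] at h2
  exact (Fact.out : p.Prime).ne_zero (by exact_mod_cast h)

/-- Pigeonhole on tuples of polynomials of degree below `d`: two of them agree modulo `I` and in the
coefficients of `X ^ B * a i` from `d` to `d + B - 1`, and their difference is the required tuple.
Multiplying by `X ^ B` avoids the subtraction `d - B`. -/
theorem exists_ne_forall_degree_lt {F S ι : Type*} [Field F] [Finite F] [CommRing S] [Finite ι]
    (f : (ι → Polynomial F) →+ S) (d B : ℕ) {I : Ideal S} [Finite (S ⧸ I)]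
    (h : Nat.card F ^ (Nat.card ι * B) * Nat.card (S ⧸ I) < Nat.card F ^ (Nat.card ι * d)) :
    ∃ a : ι → Polynomial F, a ≠ 0 ∧ f a ∈ I ∧
      ∀ i, (Polynomial.X ^ B * a i).degree < (d : WithBot ℕ) := by
  classical
  let V := Polynomial.degreeLT F d
  have : Module.Finite F V := Module.Finite.equiv (Polynomial.degreeLTEquiv F d).symm
  have : Finite V := Module.finite_of_finite F
  have hV : Nat.card V = Nat.card F ^ d := by
    rw [Nat.card_congr (Polynomial.degreeLTEquiv F d).toEquiv, Nat.card_fun]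
    simp
  let φ : (ι → V) → (S ⧸ I) × (ι → Fin B → F) := fun a =>
    (Ideal.Quotient.mk I (f fun i => (a i : Polynomial F)),
      fun i j => (Polynomial.X ^ B * (a i : Polynomial F)).coeff (d + j))
  have hφ : ¬ Function.Injective φ := by
    intro hinj
    have h1 := Nat.card_le_card_of_injective φ hinj
    rw [Nat.card_prod, Nat.card_fun, Nat.card_fun, Nat.card_fun, hV, Nat.card_fin, ← pow_mul,
      ← pow_mul, mul_comm d, mul_comm B, mul_comm (Nat.card (S ⧸ I))] at h1
    exact absurd h1 h.not_ge
  rw [Function.Injective] at hφ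
  push Not at hφ
  obtain ⟨a, b, hab, hne⟩ := hφ
  refine ⟨fun i => (a i : Polynomial F) - b i, fun h0 => hne ?_, ?_, fun i => ?_⟩
  · funext i
    exact Subtype.ext (sub_eq_zero.1 (congrFun h0 i))
  · have h1 := (Prod.ext_iff.1 hab).1
    have h2 := (Ideal.Quotient.mk_eq_mk_iff_sub_mem _ _).1 h1
    rwa [← map_sub] at h2
  · rw [Polynomial.degree_lt_iff_coeff_zero]
    intro m hm
    obtain ⟨j, rfl⟩ := Nat.exists_eq_add_of_le hm
    by_cases hj : j < B
    · have h1 := congrFun (congrFun (Prod.ext_iff.1 hab).2 i) ⟨j, hj⟩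
      rw [mul_sub, Polynomial.coeff_sub, sub_eq_zero]
      exact h1
    · have h1 : ((a i : Polynomial F) - b i).degree < (d : WithBot ℕ) :=
        Polynomial.mem_degreeLT.1 (V.sub_mem (a i).2 (b i).2)
      have e : d + j = (d + (j - B)) + B := by lia
      rw [e, Polynomial.coeff_X_pow_mul]
      exact (Polynomial.degree_lt_iff_coeff_zero _ _).1 h1 _ (by lia)

-- This plays the role of Riemann–Roch. With an integral basis `b i` of the field extension, the
-- pigeonhole gives `x = ∑ a i * b i` in `I` with `X ^ B * a i` of degree below that of `g`. Then `x
-- / g = X⁻ᴮ ∑ (X ^ B * a i / g) * b i` has integral coefficients at every pole of `X`, and a large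
-- `B` makes it small at these finitely many places. The upper bound `[S : g] ≤ p ^ (n deg g)` is
-- all the count needs, so the `b i` need not generate `S`.
variable (K p) in
theorem integralClosure.hasSmallElements [FiniteDimensional (RatFunc (ZMod p)) K]
    [IsGlobalField K] [Algebra (Polynomial (ZMod p)) K]
    [IsScalarTower (Polynomial (ZMod p)) (RatFunc (ZMod p)) K] :
    HasSmallElements (Polynomial (ZMod p)) (integralClosure (Polynomial (ZMod p)) K) K := by
  classical
  let R := Polynomial (ZMod p)
  let F := RatFunc (ZMod p)
  let S := integralClosure R K
  let t : K := algebraMap F K RatFunc.X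
  have htow : ∀ q : R, algebraMap R K q = algebraMap F K (algebraMap R F q) :=
    fun q => IsScalarTower.algebraMap_apply R F K q
  have ht : algebraMap R K Polynomial.X = t := by rw [htow, RatFunc.algebraMap_X]
  have ht0 : t ≠ 0 := (map_ne_zero _).2 RatFunc.X_ne_zero
  intro ε hε
  obtain ⟨ι, b, hb⟩ := FiniteDimensional.exists_is_basis_integral R F K
  have hfin := finite_valuationSubring_notMem t
  have hN : ∀ A : {A : ValuationSubring K // A ≠ ⊤ ∧ t ∉ A}, ∃ N : ℕ, ∀ B, N ≤ B →
      ∀ (s : Finset ι) (z : ι → K), (∀ i, z i ∈ A.1) →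
      (Place.finite A.1 A.2.1).absValue (t⁻¹ ^ B * ∑ i ∈ s, z i * b i) < ε :=
    fun A => exists_forall_absValue_inv_X_pow_lt A.2.1 A.2.2 b hε
  choose N hN using hN
  have : Finite {A : ValuationSubring K // A ≠ ⊤ ∧ t ∉ A} := hfin
  have := Fintype.ofFinite {A : ValuationSubring K // A ≠ ⊤ ∧ t ∉ A}
  let B := ∑ A, N A
  have hB : ∀ A, N A ≤ B := fun A =>
    Finset.single_le_sum (fun _ _ => Nat.zero_le _) (Finset.mem_univ A)
  let n := Nat.card ι
  have hn : Module.finrank F K = n := by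
    rw [Module.finrank_eq_nat_card_basis b]
  refine ⟨(p : ℝ) ^ (n * B), fun I hI g hg hC => ?_⟩
  have hR : ∀ g : R, g ≠ 0 → Finite (R ⧸ Ideal.span {g}) := fun g hg =>
    (card_polynomial_quotient hg).1
  have := hR g hg
  have hSI := integralClosure.finite_quotient R F K hR hI
  have hcard := (integralClosure.card_quotient_le R F K (g := g)
    (I := Ideal.span {algebraMap R S g}) (Ideal.mem_span_singleton_self _)).2
  rw [(card_polynomial_quotient hg).2, ← pow_mul, hn, mul_comm _ n] at hcard
  have hp : Nat.card (ZMod p) = p := Nat.card_zmod p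
  let e : ι → S := fun i => ⟨b i, hb i⟩
  let f : (ι → R) →+ S := ((Fintype.linearCombination R e : (ι → R) →ₗ[R] S)).toAddMonoidHom
  have hf : ∀ a, (f a : K) = ∑ i, algebraMap R K (a i) * b i := by
    intro a
    change ((∑ i, a i • e i : S) : K) = _
    rw [AddSubmonoidClass.coe_finsetSum]
    refine Finset.sum_congr rfl fun i _ => ?_
    rw [← Algebra.smul_def]
    rfl
  obtain ⟨a, ha0, haI, hdeg⟩ := exists_ne_forall_degree_lt f g.natDegree B (I := I) (by
    refine lt_of_lt_of_le ?_ hcard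
    rw [hp]
    exact_mod_cast hC)
  have hgK : algebraMap R K g ≠ 0 := by
    rw [htow]
    simpa using hg
  refine ⟨f a, haI, fun h0 => ha0 ?_, fun w hw => ?_⟩
  · have h1 : ∑ i, algebraMap R F (a i) • b i = 0 := by
      have := hf a
      rw [h0] at this
      simp_rw [Algebra.smul_def, ← htow]
      exact this.symm
    funext i
    have := Fintype.linearIndependent_iff.1 b.linearIndependent _ h1 i
    simpa using this
  · rcases w with w | ⟨A, hA⟩
    · exact ((isEmpty_infinitePlace_of_algebra_ratFunc K p).false w).elim
    have htA : t ∉ A := by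
      intro htA
      apply hw
      intro r
      have hRA : ∀ q : R, algebraMap R K q ∈ A := fun q => by
        rw [htow]
        exact A.algebraMap_polynomial_mem htA q
      exact A.mem_of_isIntegral hRA r.2
    have h1 := hN ⟨A, hA, htA⟩ B (hB _) Finset.univ
      (fun i => algebraMap F K (algebraMap R F (Polynomial.X ^ B * a i) / algebraMap R F g))
      (fun i => A.algebraMap_div_mem htA hg
        ((hdeg i).le.trans (Polynomial.degree_eq_natDegree hg).ge))
    refine lt_of_eq_of_lt (congrArg _ ?_) h1
    change (f a : K) / algebraMap R K g = _
    rw [hf, Finset.sum_div, Finset.mul_sum]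
    refine Finset.sum_congr rfl fun i _ => ?_
    rw [map_div₀, ← htow, ← htow, map_mul, map_pow, ht, inv_pow]
    field_simp

end

/-! ### Multipliers of nonclassical classes -/

section

/-- At every place other than `v`, either `k` is integral, or the valuation ring is in `T` and
`k` times its maximal ideal is integral. -/
def IsNearlyIntegral {K : Type*} [Field K] (v : Place K) (T : Set (ValuationSubring K)) (k : K) :
    Prop :=
  ∀ w, w ≠ v → w.absValue k ≤ 1 ∨
    ∃ A ∈ T, ∃ hA, w = Place.finite A hA ∧ ∀ π ∈ A.nonunits, k * π ∈ A

/-- Only finitely many members of `T` fail to contain `S`; discarding them leaves an infinite set to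
which `exists_of_infinite` applies. -/
theorem HasSmallElements.exists_isNearlyIntegral {R S K : Type*} [CommRing R] [CommRing S]
    [IsDedekindDomain S] [Field K] [Algebra R S] [FaithfulSMul R S] [Algebra.IsAlgebraic R S]
    [Algebra S K] [IsGlobalField K] [IsFractionRing S K] (h : HasSmallElements R S K)
    (hfin : ∀ I : Ideal S, I ≠ ⊥ → Finite (S ⧸ I)) {ε : ℝ} (hε : 0 < ε) {v : Place K}
    {T : Set (ValuationSubring K)} (hT : T.Infinite)
    (hTv : ∀ A ∈ T, ∃ hA : A ≠ ⊤, Place.finite A hA ≠ v)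
    (hTS : {A ∈ T | ∃ r : S, algebraMap S K r ∉ A}.Finite) :
    ∃ k : K, k ≠ 0 ∧ v.absValue k < ε ∧ IsNearlyIntegral v T k := by
  obtain ⟨k, hk0, hkv, hkT, hk⟩ := h.exists_of_infinite hfin hε (hT.sdiff hTS) (v := v) (by
    rintro A ⟨hAT, hA'⟩
    obtain ⟨hA, hAv⟩ := hTv A hAT
    refine ⟨hA, hAv, fun r => ?_⟩
    by_contra hr
    exact hA' ⟨hAT, r, hr⟩)
  refine ⟨k, hk0, hkv, fun w hw => (hk w hw).imp_right ?_⟩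
  rintro ⟨A, hAT, hA, rfl⟩
  exact ⟨A, hAT.1, hA, rfl, hkT A hAT⟩

section FunctionField

variable {K : Type*} [Field K] [IsGlobalField K] {p : ℕ} [Fact p.Prime]
  [Algebra (RatFunc (ZMod p)) K] [FiniteDimensional (RatFunc (ZMod p)) K]

variable (K p) in
/-- The ring of elements of a function field that are integral away from the poles of `X`. -/
theorem exists_isDedekindDomain_hasSmallElements :
    ∃ S : Subring K, ∃ (_ : Algebra (Polynomial (ZMod p)) S), IsDedekindDomain S ∧
      FaithfulSMul (Polynomial (ZMod p)) S ∧ Algebra.IsAlgebraic (Polynomial (ZMod p)) S ∧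
      IsFractionRing S K ∧ HasSmallElements (Polynomial (ZMod p)) S K ∧
      (∀ I : Ideal S, I ≠ ⊥ → Finite (S ⧸ I)) ∧ ∀ A : ValuationSubring K,
        algebraMap (RatFunc (ZMod p)) K RatFunc.X ∈ A → ∀ r : S, algebraMap S K r ∈ A := by
  let R := Polynomial (ZMod p)
  let F := RatFunc (ZMod p)
  let : Algebra R K := ((algebraMap F K).comp (algebraMap R F)).toAlgebra
  have : IsScalarTower R F K := IsScalarTower.of_algebraMap_eq fun _ => rfl
  have : FaithfulSMul R K := (faithfulSMul_iff_algebraMap_injective R K).2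
    ((algebraMap F K).injective.comp (IsFractionRing.injective R F))
  have hR : ∀ g : R, g ≠ 0 → Finite (R ⧸ Ideal.span {g}) := fun g hg =>
    (card_polynomial_quotient hg).1
  refine ⟨(integralClosure R K).toSubring, inferInstanceAs (Algebra R (integralClosure R K)),
    integralClosure.isDedekindDomain_of_finite_quotient R F K hR,
    inferInstanceAs (FaithfulSMul R (integralClosure R K)),
    inferInstanceAs (Algebra.IsAlgebraic R (integralClosure R K)),
    integralClosure.isFractionRing_of_finite_extension F K,
    integralClosure.hasSmallElements K p,
    fun I hI => integralClosure.finite_quotient R F K hR hI, fun A hA r => ?_⟩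
  exact A.mem_of_isIntegral (A.algebraMap_polynomial_mem hA) r.2

end FunctionField

variable {K : Type*} [Field K] [IsGlobalField K]

theorem NumberField.finite_quotient_ringOfIntegers (K : Type*) [Field K] [NumberField K]
    {I : Ideal (NumberField.RingOfIntegers K)} (hI : I ≠ ⊥) :
    Finite (NumberField.RingOfIntegers K ⧸ I) :=
  Ideal.finiteQuotientOfFreeOfNeBot I hI

/-- Nonzero elements that are small at `v` and integral away from `v` and one other place. -/
theorem exists_absValue_lt_of_ne {v w₀ : Place K} (hv : v ≠ w₀) {ε : ℝ} (hε : 0 < ε) :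
    ∃ k : K, k ≠ 0 ∧ v.absValue k < ε ∧ ∀ w, w ≠ v → w ≠ w₀ → w.absValue k ≤ 1 := by
  rcases IsGlobalField.numberField_or_functionField (K := K) with h | ⟨p, hp, _, _⟩
  · rcases w₀ with w₀ | ⟨A, hA⟩
    · exact NumberField.exists_of_infinitePlace hε hv
    · exact (NumberField.hasSmallElements K).exists_of_place
        (fun I hI => NumberField.finite_quotient_ringOfIntegers K hI) hε hv
        (NumberField.isOver_ringOfIntegers A hA)
  · rcases w₀ with w₀ | ⟨A, hA⟩
    · exact ((isEmpty_infinitePlace_of_algebra_ratFunc K p).false w₀).elim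
    -- The rational subfield is chosen so that `w₀` is not a pole of `X`; then `w₀` is over the ring
    -- `S`.
    · obtain ⟨_, _, hX⟩ := exists_algebra_ratFunc_mem (p := p) A
      obtain ⟨S, _, _, _, _, _, h, hfin, hS⟩ := exists_isDedekindDomain_hasSmallElements K p
      exact h.exists_of_place hfin hε hv (hS A hX)

theorem exists_absValue_lt_isNearlyIntegral {v : Place K} {T : Set (ValuationSubring K)}
    (hT : T.Infinite) (hTv : ∀ A ∈ T, ∃ hA : A ≠ ⊤, Place.finite A hA ≠ v) {ε : ℝ} (hε : 0 < ε) :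
    ∃ k : K, k ≠ 0 ∧ v.absValue k < ε ∧ IsNearlyIntegral v T k := by
  rcases IsGlobalField.numberField_or_functionField (K := K) with h | ⟨p, hp, _, _⟩
  · refine (NumberField.hasSmallElements K).exists_isNearlyIntegral
      (fun I hI => NumberField.finite_quotient_ringOfIntegers K hI) hε hT hTv ?_
    refine Set.finite_empty.subset ?_
    rintro A ⟨hAT, r, hr⟩
    obtain ⟨hA, -⟩ := hTv A hAT
    exact hr (NumberField.isOver_ringOfIntegers A hA r)
  · obtain ⟨S, _, _, _, _, _, h, hfin, hS⟩ := exists_isDedekindDomain_hasSmallElements K p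
    -- The valuation rings that do not contain `S` are among the finitely many poles of `X`.
    refine h.exists_isNearlyIntegral hfin hε hT hTv
      ((finite_valuationSubring_notMem (algebraMap (RatFunc (ZMod p)) K RatFunc.X)).subset ?_)
    rintro A ⟨hAT, r, hr⟩
    exact ⟨(hTv A hAT).1, fun hX => hr (hS A hX r)⟩

theorem Place.zero_mem_interior_closedUnitBall {K : Type*} [Field K] : (w : Place K) →
    (0 : w.Completion) ∈ interior w.closedUnitBall
  | .infinite w => by
    refine mem_interior_iff_mem_nhds.2 (mem_of_superset (Metric.ball_mem_nhds (0 : w.Completion)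
      one_pos) fun x hx => ?_)
    exact (mem_ball_zero_iff.1 hx).le
  | .finite A hA => by
    rw [Place.interior_closedUnitBall_finite]
    exact zero_mem _

/-- At an archimedean place, multiplication by a nonzero element is open, so the image of the open
ball is an open subset of the closed unit ball. At a nonarchimedean place the interior is the ring
of integers. -/
theorem Place.embedding_mul_mem_interior {k : K} (hk : k ≠ 0) : (w : Place K) →
    w.absValue k ≤ 1 → ∀ {z : w.Completion}, z ∈ interior w.closedUnitBall →
      w.embedding k * z ∈ interior w.closedUnitBall
  | .infinite w => fun hkw z hz => by
    have hkw' : w k ≤ 1 :=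
      (pow_le_one_iff_of_nonneg (apply_nonneg w k) w.mult_ne_zero).1 hkw
    have h0 : algebraMap K w.Completion k ≠ 0 := (map_ne_zero _).2 hk
    refine interior_maximal ?_ ((Homeomorph.mulLeft₀ _ h0).isOpenMap _
      (isOpen_interior (s := {x : w.Completion | ‖x‖ ≤ 1}))) ⟨z, hz, rfl⟩
    rintro _ ⟨x, hx, rfl⟩
    have hx1 : ‖x‖ ≤ 1 := interior_subset (s := {x : w.Completion | ‖x‖ ≤ 1}) hx
    change ‖algebraMap K w.Completion k * x‖ ≤ 1
    rw [norm_mul, w.norm_algebraMap_completion]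
    exact mul_le_one₀ hkw' (norm_nonneg _) hx1
  | .finite A hA => fun hkw z hz => by
    rw [Place.interior_closedUnitBall_finite] at hz ⊢
    refine mul_mem ?_ hz
    change Valued.v (A.toCompletion k) ≤ 1
    rw [A.v_toCompletion, A.valuation_le_one_iff]
    exact (Place.absValue_finite_le_one_iff hA).1 hkw

/-- If the class of `y` is not in the classical orbit, `y` has multiples in the unit space by
elements that are arbitrarily small at `v`. -/
theorem exists_smul_mem_unitSpace_absValue_lt {v : Place K} {y : AdeleRing K}
    (hy : y ∈ unitSpace v) (hyo : adeleClass y ∉ classicalOrbit v) {ε : ℝ} (hε : 0 < ε) :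
    ∃ k : Kˣ, k • y ∈ unitSpace v ∧ v.absValue (k : K) < ε := by
  classical
  have hmem : ∀ k : Kˣ, (∀ w, w ≠ v → y w ≠ 0 →
      w.embedding (k : K) * y w ∈ interior w.closedUnitBall) → k • y ∈ unitSpace v := by
    intro k hk
    refine ⟨by rw [AdeleRing.smul_apply, hy.1, mul_zero], fun w => ?_⟩
    rw [AdeleRing.smul_apply]
    by_cases h0 : y w = 0
    · rw [h0, mul_zero]
      exact w.zero_mem_interior_closedUnitBall
    · exact hk w (fun h => h0 (h ▸ hy.1)) h0
  rw [adeleClass_mem_classicalOrbit_iff hy.1, not_and_or] at hyo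
  rcases hyo with hyo | hyo
  · push Not at hyo
    obtain ⟨w₀, hw₀, hyw₀⟩ := hyo
    obtain ⟨k, hk0, hkv, hk⟩ := exists_absValue_lt_of_ne hw₀.symm hε
    refine ⟨Units.mk0 k hk0, hmem _ fun w hwv hyw => ?_, hkv⟩
    exact w.embedding_mul_mem_interior hk0 (hk w hwv fun h => hyw (h ▸ hyw₀)) (hy.2 w)
  -- Since the inverse of zero is zero, `T` records exactly the nonarchimedean places other than `v`
  -- with `0 < |y_w| < 1`. There `y_w` absorbs a simple pole of `k`, and vanishing components impose
  -- no condition.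
  · let T : Set (ValuationSubring K) := {A | ∃ hA : A ≠ ⊤, Place.finite A hA ≠ v ∧
      (y (Place.finite A hA))⁻¹ ∉ (Place.finite A hA).integers}
    have hT : T.Infinite := by
      intro hT
      apply hyo
      have : Finite T := hT
      have hfin := Set.finite_range fun A : T => Place.finite A.1 A.2.1
      filter_upwards [Place.eventually_exists_finite K, hfin.compl_mem_cofinite] with w hw hwT hwv
      obtain ⟨A, hA, rfl⟩ := hw
      by_contra hn
      exact hwT ⟨⟨A, hA, hwv, hn⟩, rfl⟩
    obtain ⟨k, hk0, hkv, hk⟩ := exists_absValue_lt_isNearlyIntegral (v := v) hT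
      (fun A hA => ⟨hA.1, hA.2.1⟩) hε
    refine ⟨Units.mk0 k hk0, hmem _ fun w hwv hyw => ?_, hkv⟩
    rcases hk w hwv with h | ⟨A, ⟨_, -, hAT⟩, hA, rfl, hkA⟩
    · exact w.embedding_mul_mem_interior hk0 h (hy.2 w)
    rw [Place.interior_closedUnitBall_finite]
    let z : A.valuation.Completion := y (Place.finite A hA)
    have hz1 : Valued.v z < 1 := by
      have h1 : ¬ Valued.v z⁻¹ ≤ 1 := hAT
      have hz0 : z ≠ 0 := hyw
      rw [map_inv₀, inv_le_one₀ (zero_lt_iff.2 ((map_ne_zero _).2 hz0)), not_le] at h1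
      exact h1
    obtain ⟨b, hb⟩ := A.exists_valuation_eq z
    have hbA : b ∈ A.nonunits := by
      rw [ValuationSubring.mem_nonunits_iff, ← hb]
      exact hz1
    change Valued.v (A.toCompletion k * z) ≤ 1
    rw [map_mul, hb, A.v_toCompletion, ← map_mul, A.valuation_le_one_iff]
    exact hkA b hbA

theorem mem_classicalOrbit_of_le_energy {v : Place K} {y : unitSpace v} {c : ℝ}
    (hc : ∀ γ, c ≤ energy y γ) : adeleClass (y : AdeleRing K) ∈ classicalOrbit v := by
  by_contra hy
  obtain ⟨k, hky, hk⟩ := exists_smul_mem_unitSpace_absValue_lt y.2 hy (Real.exp_pos c)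
  have h := hc ⟨⟨k, y.1, y.2, hky⟩, rfl⟩
  exact absurd ((Real.le_log_iff_exp_le (v.absValue_pos k.ne_zero)).1 h) hk.not_ge

end

theorem theorem8p11 (K : Type*) [Field K] [IsGlobalField K] (v : Place K) (y : unitSpace v) :
    Implements (regularRep y) (timeEvolution v) (hamiltonian y) ∧
    (IsBoundedBelow (hamiltonian y) ↔ adeleClass (y : AdeleRing K) ∈ classicalOrbit v) ∧
    (IsPositiveEnergy (regularRep y) (timeEvolution v) ↔
      adeleClass (y : AdeleRing K) ∈ classicalOrbit v) := by
  have himp := implements_hamiltonian y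
  have hbdd : adeleClass (y : AdeleRing K) ∈ classicalOrbit v → IsBoundedBelow (hamiltonian y) :=
    fun h => by
      obtain ⟨c, hc⟩ := exists_le_energy_of_mem_classicalOrbit y h
      exact isBoundedBelow_hamiltonian y hc
  have hpos : IsPositiveEnergy (regularRep y) (timeEvolution v) →
      adeleClass (y : AdeleRing K) ∈ classicalOrbit v := fun h => by
    obtain ⟨c, hc⟩ := exists_le_energy_of_isPositiveEnergy (fun γ₀ => γ₀.1.exists_bump) h
    exact mem_classicalOrbit_of_le_energy hc
  -- If `H_y` is bounded below, it is itself a positive energy Hamiltonian, so both remaining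
  -- conditions pass through the lower bound on the energies.
  exact ⟨himp, ⟨fun h => hpos ⟨_, himp, h⟩, hbdd⟩, ⟨hpos, fun h => ⟨_, himp, hbdd h⟩⟩⟩
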